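/- **Theorem 2.1 (Nearly independent Hamiltonians).** Let $H=\sum_{i=1}^m v_iP_i$ be a commuting Pauli Hamiltonian on $n$ qubits: $v_i\in\{\pm1\}$, $P_i\in\{I,X,Y,Z\}^{\otimes n}$, and $[P_i,P_j]=0$ for all $i,j$, with $m=\mathrm{poly}(n)$. Its *symplectic code* is $\mathrm{Symp}(H)=\ker B^{\intercal}\subseteq\mathbb F_2^m$, where the $i$-th column of $B^{\intercal}\in\mathbb F_2^{2n\times m}$ is the symplectic representation of $P_i$ (the $X$-bits followed by the $Z$-bits; $Y$ has both bits equal to $1$). Let $\mathrm{Spec}(H)$ be the set of eigenvalues of $H$. *HDQI circuits.* An HDQI circuit for $H$ acts on registers $A$ ($m$ qubits), $B$ and $C$ ($n$ qubits each) and workspace qubits, all initially $|0\rangle$, and performs the following steps: (1) prepare a pilot state $\sum_{y}c_y|y\rangle$ on $A$, with support in some $Y\subseteq\mathbb F_2^m$, and the maximally entangled state $|\Phi^n\rangle=2^{-n/2}\sum_{x\in\mathbb F_2^n}|x\rangle|x\rangle$ on $BC$; (2) apply $Z$ to each qubit $i$ of $A$ with $v_i=-1$, and apply each $P_i$ to $B$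 controlled on qubit $i$ of $A$; (3) apply the coherent Bell measurement to $BC$ (mapping $(P\otimes I)|\Phi^n\rangle$ to the symplectic representation of $P$, up to a phase), apply a decoder, i.e. a circuit that maps $|y\rangle_A|B^{\intercal}y\rangle_{BC}$ to $|0\rangle_A|B^{\intercal}y\rangle_{BC}$ for all $y\in Y$, and undo the Bell measurement. The output is register $B$. The elementary gates are the one-qubit gates Hadamard, $X$, $Y$, $Z$ and real rotations $\begin{pmatrix}c&-s\\ s&c\end{pmatrix}$ with $c^2+s^2=1$, their singly controlled versions, and the Toffoli gate. *Running time.* The circuit is computed by a classical random access machine with exact real arithmetic ($+,-,\times,/,\sqrt{\ }$ and comparisons, at unit cost; no real constants other than natural numbers), whose input consists of $n$, $m$, the signs $v_i$, the symplectic representations of the $P_i$, and the values of $f$ at $m,m-2,\dots,-m$ (all eigenvalues of $H$ are among these numbers; where such a number is not an eigenvalue, the supplied value is arbitrary). The running time is the number of classical steps plus the number of gates plus the number of qubits. There is one classical program such that, for every constant $k$ and every polynomial $p$, there is a polynomial $q$, depending only on $k$ and $p$, for which the following holds for all $n$, all $m\le p(n)$ and all commuting Pauli Hamiltonians $H$ as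 above with $\dim\mathrm{Symp}(H)\le k$. 1. For every function $f:\mathrm{Spec}(H)\to\mathbb R_{\ge0}$ that is not identically zero, the program on input $(H,f)$ outputs an HDQI circuit for $H$ that prepares on register $B$ exactly the density matrix $$\rho_f(H)=\frac{f(H)}{\operatorname{Tr}[f(H)]},$$ in total running time at most $q(n)$. 2. In particular, for every $\beta\in[0,\infty]$ the same holds for the Gibbs state of $H$ at inverse temperature $\beta$, namely $e^{-\beta H}/\operatorname{Tr}[e^{-\beta H}]$ for $\beta<\infty$ and the limit of these states as $\beta\to\infty$ for $\beta=\infty$; here $f(E)=e^{-\beta E}$ for $\beta<\infty$, and for $\beta=\infty$ $f$ is the indicator function of the smallest eigenvalue of $H$. -/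

import Mathlib

open scoped ENNReal Matrix

/-! ## Pauli Hamiltonians and their symplectic codes -/

/-- The four one-qubit Pauli operators. -/
inductive Pauli
  | I
  | X
  | Y
  | Z

namespace Pauli

/-- The `2 × 2` matrix of a Pauli operator; computational basis states are labelled by `𝔽₂`. -/
noncomputable def mat : Pauli → Matrix (ZMod 2) (ZMod 2) ℂ
  | I => Matrix.of fun a b => if a = b then 1 else 0
  | X => Matrix.of fun a b => if a = b then 0 else 1
  | Y => Matrix.of fun a b => if a = b then 0 else if a = 0 then -Complex.I else Complex.I
  | Z => Matrix.of fun a b => if a = b then (if a = 0 then 1 else -1) else 0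

/-- The `X`-bit of the symplectic representation. -/
def xBit : Pauli → ZMod 2
  | I => 0
  | X => 1
  | Y => 1
  | Z => 0

/-- The `Z`-bit of the symplectic representation. -/
def zBit : Pauli → ZMod 2
  | I => 0
  | X => 0
  | Y => 1
  | Z => 1

end Pauli

/-- The operator `P₁ ⊗ ⋯ ⊗ Pₙ` on `n` qubits. -/
noncomputable def pauliString {n : ℕ} (P : Fin n → Pauli) :
    Matrix (Fin n → ZMod 2) (Fin n → ZMod 2) ℂ :=
  Matrix.of fun x y => ∏ j, (P j).mat (x j) (y j)

/-- The symplectic representation in `𝔽₂²ⁿ`: the `X`-bits (`inl`), then the `Z`-bits (`inr`). -/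
def symp {n : ℕ} (P : Fin n → Pauli) : Fin n ⊕ Fin n → ZMod 2 :=
  Sum.elim (fun j => (P j).xBit) (fun j => (P j).zBit)

/-- A signed Pauli Hamiltonian `∑ᵢ vᵢ Pᵢ` with `m` terms on `n` qubits, `vᵢ ∈ {1, -1}`. -/
structure PauliHamiltonian (n m : ℕ) where
  sign : Fin m → ℤˣ
  term : Fin m → Fin n → Pauli

namespace PauliHamiltonian

variable {n m : ℕ} (H : PauliHamiltonian n m)

/-- The operator `∑ᵢ vᵢ Pᵢ`. -/
noncomputable def op : Matrix (Fin n → ZMod 2) (Fin n → ZMod 2) ℂ :=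
  ∑ i, (((H.sign i : ℤˣ) : ℤ) : ℂ) • pauliString (H.term i)

/-- All terms commute pairwise. -/
def IsCommuting : Prop :=
  ∀ i j, Commute (pauliString (H.term i)) (pauliString (H.term j))

/-- The parity check matrix `Bᵀ ∈ 𝔽₂^{2n × m}`, whose `i`-th column is `symp Pᵢ`. -/
def checkMatrix : Matrix (Fin n ⊕ Fin n) (Fin m) (ZMod 2) :=
  Matrix.of fun r i => symp (H.term i) r

/-- The symplectic code: the kernel of the parity check matrix. -/
noncomputable def sympCode : Submodule (ZMod 2) (Fin m → ZMod 2) :=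
  LinearMap.ker H.checkMatrix.mulVecLin

/-- The set of eigenvalues of the Hamiltonian. -/
def Spec : Set ℝ := spectrum ℝ H.op

/-- The state `f(H) / Tr f(H)`. -/
noncomputable def rho (f : ℝ → ℝ) : Matrix (Fin n → ZMod 2) (Fin n → ZMod 2) ℂ :=
  ((cfc f H.op).trace)⁻¹ • cfc f H.op

/-- The Gibbs state `exp(-βH) / Tr exp(-βH)` at a finite inverse temperature. -/
noncomputable def finiteGibbs (β : ℝ) : Matrix (Fin n → ZMod 2) (Fin n → ZMod 2) ℂ :=
  ((NormedSpace.exp ((-β : ℂ) • H.op)).trace)⁻¹ • NormedSpace.exp ((-β : ℂ) • H.op)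

/-- `ρ` is the Gibbs state at inverse temperature `β ∈ [0, ∞]`; at `β = ∞` it is the limit of the
Gibbs states as `β → ∞`. -/
def IsGibbsState (β : ℝ≥0∞) (ρ : Matrix (Fin n → ZMod 2) (Fin n → ZMod 2) ℂ) : Prop :=
  (β ≠ ⊤ ∧ ρ = H.finiteGibbs β.toReal) ∨
    (β = ⊤ ∧ Filter.Tendsto H.finiteGibbs Filter.atTop (nhds ρ))

open Classical in
/-- The spectral function of the Gibbs state: `E ↦ exp(-βE)` for `β < ∞`, and the indicator
function of the smallest eigenvalue for `β = ∞`. -/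
noncomputable def gibbsWeight (β : ℝ≥0∞) (E : ℝ) : ℝ :=
  if β = ⊤ then (if IsLeast H.Spec E then 1 else 0) else Real.exp (-β.toReal * E)

end PauliHamiltonian

/-! ## Quantum circuits -/

/-- One-qubit gates. `rot c s` is the real rotation matrix with rows `(c, -s)` and `(s, c)`. -/
inductive OneQubit (R : Type)
  | had
  | X
  | Y
  | Z
  | rot (c s : R)

/-- Elementary gates on qubits with labels in `Q`: one-qubit gates, singly controlled one-qubit
gates (control `c`, target `t`), and the Toffoli gate (controls `a`, `b`). -/
inductive Gate (Q R : Type)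
  | one (u : OneQubit R) (t : Q)
  | ctrl (u : OneQubit R) (c t : Q)
  | toffoli (a b t : Q)

/-- The `2 × 2` matrix of a one-qubit gate. -/
noncomputable def OneQubit.mat : OneQubit ℝ → Matrix (ZMod 2) (ZMod 2) ℂ
  | .had => Matrix.of fun a b => ((Real.sqrt 2 : ℝ) : ℂ)⁻¹ * (if a = 1 ∧ b = 1 then -1 else 1)
  | .X => Pauli.X.mat
  | .Y => Pauli.Y.mat
  | .Z => Pauli.Z.mat
  | .rot c s => Matrix.of fun a b => if a = b then (c : ℂ) else if a = 0 then -(s : ℂ) else (s : ℂ)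

/-- The rotation parameters of a one-qubit gate lie on the unit circle. -/
def OneQubit.Valid : OneQubit ℝ → Prop
  | .rot c s => c ^ 2 + s ^ 2 = 1
  | _ => True

/-- Change of labels and of parameters. -/
def OneQubit.map {R R' : Type} (g : R → R') : OneQubit R → OneQubit R'
  | .had => .had
  | .X => .X
  | .Y => .Y
  | .Z => .Z
  | .rot c s => .rot (g c) (g s)

namespace Gate

/-- Change of labels and of parameters. -/
def map {Q Q' R R' : Type} (h : Q → Q') (g : R → R') : Gate Q R → Gate Q' R'
  | .one u t => .one (u.map g) (h t)
  | .ctrl u c t => .ctrl (u.map g) (h c) (h t)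
  | .toffoli a b t => .toffoli (h a) (h b) (h t)

/-- Change of labels. -/
def relabel {Q Q' R : Type} (h : Q → Q') : Gate Q R → Gate Q' R := map h id

variable {Q : Type}

/-- The gate is a unitary operation: it acts on distinct qubits, with admissible parameters. -/
def Valid : Gate Q ℝ → Prop
  | .one u _ => u.Valid
  | .ctrl u c t => u.Valid ∧ c ≠ t
  | .toffoli a b t => a ≠ b ∧ a ≠ t ∧ b ≠ t

variable [DecidableEq Q]

/-- The one-qubit operator `u` applied to qubit `t`. -/
noncomputable def applyAt (u : Matrix (ZMod 2) (ZMod 2) ℂ) (t : Q) (ψ : (Q → ZMod 2) → ℂ) :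
    (Q → ZMod 2) → ℂ :=
  fun x => ∑ b : ZMod 2, u (x t) b * ψ (Function.update x t b)

/-- The action of a gate on a state vector, given by its amplitudes in the computational basis. -/
noncomputable def apply (ψ : (Q → ZMod 2) → ℂ) : Gate Q ℝ → ((Q → ZMod 2) → ℂ)
  | .one u t => applyAt u.mat t ψ
  | .ctrl u c t => fun x => if x c = 1 then applyAt u.mat t ψ x else ψ x
  | .toffoli a b t => fun x => if x a = 1 ∧ x b = 1 then applyAt Pauli.X.mat t ψ x else ψ x

end Gate

/-- The action of a circuit; the gates of the list are applied from left to right. -/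
noncomputable def runCircuit {Q : Type} [DecidableEq Q] (C : List (Gate Q ℝ))
    (ψ : (Q → ZMod 2) → ℂ) : (Q → ZMod 2) → ℂ :=
  C.foldl Gate.apply ψ

open Classical in
/-- The computational basis state `|x⟩`. -/
noncomputable def ket {Q : Type} (x : Q → ZMod 2) : (Q → ZMod 2) → ℂ :=
  fun y => if y = x then 1 else 0

/-! ## Hamiltonian Decoded Quantum Interferometry -/

/-- The qubits: register `A` (`m` qubits), registers `B` and `C` (`n` qubits each), and `a`
workspace qubits. -/
abbrev Qubit (m n a : ℕ) : Type := Fin m ⊕ Fin n ⊕ Fin n ⊕ Fin a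

namespace Qubit

variable {m n a : ℕ}

def A (i : Fin m) : Qubit m n a := Sum.inl i
def B (j : Fin n) : Qubit m n a := Sum.inr (Sum.inl j)
def C (j : Fin n) : Qubit m n a := Sum.inr (Sum.inr (Sum.inl j))
def W (l : Fin a) : Qubit m n a := Sum.inr (Sum.inr (Sum.inr l))

/-- The number of a qubit; the registers `A`, `B`, `C`, `W` are numbered consecutively. -/
def index : Qubit m n a → ℕ :=
  Sum.elim (fun i => i.val) (Sum.elim (fun j => m + j.val)
    (Sum.elim (fun j => m + n + j.val) (fun l => m + 2 * n + l.val)))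

/-- The contents of all registers, assembled from the contents of each. -/
def join (xA : Fin m → ZMod 2) (xB xC : Fin n → ZMod 2) (xW : Fin a → ZMod 2) :
    Qubit m n a → ZMod 2 :=
  Sum.elim xA (Sum.elim xB (Sum.elim xC xW))

end Qubit

/-- The reduced density matrix of register `B`: all other registers are traced out. -/
noncomputable def reducedB {m n a : ℕ} (ψ : (Qubit m n a → ZMod 2) → ℂ) :
    Matrix (Fin n → ZMod 2) (Fin n → ZMod 2) ℂ :=
  Matrix.of fun b b' => ∑ xA : Fin m → ZMod 2, ∑ xC : Fin n → ZMod 2, ∑ xW : Fin a → ZMod 2,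
    ψ (Qubit.join xA b xC xW) * star (ψ (Qubit.join xA b' xC xW))

namespace HDQI

variable {n m a : ℕ}

/-- Preparation of `n` Bell pairs on registers `B` and `C`; it maps `|0⟩|0⟩` to the maximally
entangled state. -/
def bellPrep (m n a : ℕ) : List (Gate (Qubit m n a) ℝ) :=
  (List.finRange n).flatMap fun j => [.one .had (Qubit.B j), .ctrl .X (Qubit.B j) (Qubit.C j)]

/-- The coherent Bell measurement, the inverse of `bellPrep`. Up to a phase it maps
`(P ⊗ I)|Φⁿ⟩` to the symplectic representation of `P`: the `Z`-bits in register `B` and the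
`X`-bits in register `C`. -/
def bellMeasure (m n a : ℕ) : List (Gate (Qubit m n a) ℝ) :=
  (List.finRange n).flatMap fun j => [.ctrl .X (Qubit.B j) (Qubit.C j), .one .had (Qubit.B j)]

/-- A `Z` gate on every qubit `i` of register `A` with `vᵢ = -1`. -/
def signPhases (a : ℕ) (H : PauliHamiltonian n m) : List (Gate (Qubit m n a) ℝ) :=
  (List.finRange m).flatMap fun i => if H.sign i = -1 then [.one .Z (Qubit.A i)] else []

/-- A one-qubit Pauli operator on the target `t`, controlled on `c`. -/
def controlledPauli {Q : Type} (c t : Q) : Pauli → List (Gate Q ℝ)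
  | .I => []
  | .X => [.ctrl .X c t]
  | .Y => [.ctrl .Y c t]
  | .Z => [.ctrl .Z c t]

/-- For every `i`, the operator `Pᵢ` on register `B`, controlled on qubit `i` of register `A`. -/
def controlledTerms (a : ℕ) (H : PauliHamiltonian n m) : List (Gate (Qubit m n a) ℝ) :=
  (List.finRange m).flatMap fun i => (List.finRange n).flatMap fun j =>
    controlledPauli (Qubit.A i) (Qubit.B j) (H.term i j)

/-- The HDQI circuit: prepare the pilot state on register `A`; prepare Bell pairs on `BC`; apply
the sign phases and the controlled Pauli terms; apply the coherent Bell measurement; uncompute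
register `A` by the decoder; undo the Bell measurement. -/
def circuit (H : PauliHamiltonian n m) (pilot : List (Gate (Fin m ⊕ Fin a) ℝ))
    (decoder : List (Gate (Qubit m n a) ℝ)) : List (Gate (Qubit m n a) ℝ) :=
  pilot.map (Gate.relabel (Sum.elim Qubit.A Qubit.W)) ++ bellPrep m n a ++ signPhases a H ++
    controlledTerms a H ++ bellMeasure m n a ++ decoder ++ bellPrep m n a

open Classical in
/-- From `|0⟩`, the circuit prepares a pilot state `∑_y c_y |y⟩` on register `A` whose support is
contained in `Y`, and returns the workspace to `|0⟩`. -/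
def PreparesPilot (pilot : List (Gate (Fin m ⊕ Fin a) ℝ)) (Y : Set (Fin m → ZMod 2)) : Prop :=
  ∃ c : (Fin m → ZMod 2) → ℂ, (∀ y, y ∉ Y → c y = 0) ∧
    runCircuit pilot (ket 0) =
      fun x => if (fun l => x (Sum.inr l)) = 0 then c (fun i => x (Sum.inl i)) else 0

/-- The circuit decodes all errors in `Y` on the symplectic code of `H`: it maps
`|y⟩|Bᵀy⟩` to `|0⟩|Bᵀy⟩` for `y ∈ Y`, with the workspace starting and ending in `|0⟩`. -/
def Decodes (H : PauliHamiltonian n m) (decoder : List (Gate (Qubit m n a) ℝ))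
    (Y : Set (Fin m → ZMod 2)) : Prop :=
  ∀ y ∈ Y,
    runCircuit decoder
        (ket (Qubit.join y (fun j => (H.checkMatrix *ᵥ y) (Sum.inr j))
          (fun j => (H.checkMatrix *ᵥ y) (Sum.inl j)) 0)) =
      ket (Qubit.join 0 (fun j => (H.checkMatrix *ᵥ y) (Sum.inr j))
          (fun j => (H.checkMatrix *ᵥ y) (Sum.inl j)) 0)

end HDQI

/-! ## The classical machine

A real random access machine: two-dimensional arrays of natural numbers and of real numbers, with
exact arithmetic, that emits the gates of a quantum circuit. Each assignment, each test and each
emitted gate takes one time step. Array names and numerical constants are fixed in the program,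
so the expressions in a given program have bounded size. -/

/-- Memory of the machine and the gates emitted so far. -/
structure Store where
  nat : ℕ → ℕ → ℕ → ℕ
  real : ℕ → ℕ → ℕ → ℝ
  out : List (Gate ℕ ℝ)

/-- Integer expressions: constants, array look-ups, sums, and truncated differences. -/
inductive IExpr
  | lit (c : ℕ)
  | get (arr : ℕ) (i j : IExpr)
  | add (e e' : IExpr)
  | sub (e e' : IExpr)

/-- Real expressions. There are no real constants other than natural numbers. -/
inductive RExpr
  | ofInt (e : IExpr)
  | get (arr : ℕ) (i j : IExpr)
  | add (e e' : RExpr)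
  | sub (e e' : RExpr)
  | mul (e e' : RExpr)
  | div (e e' : RExpr)
  | sqrt (e : RExpr)

/-- Tests. -/
inductive Test
  | ilt (e e' : IExpr)
  | rlt (e e' : RExpr)
  | neg (b : Test)
  | conj (b b' : Test)

/-- Programs. -/
inductive Prog
  | iset (arr : ℕ) (i j : IExpr) (e : IExpr)
  | rset (arr : ℕ) (i j : IExpr) (e : RExpr)
  | emit (g : Gate IExpr RExpr)
  | seq (p q : Prog)
  | cond (b : Test) (p q : Prog)
  | loop (b : Test) (p : Prog)

def IExpr.eval (s : Store) : IExpr → ℕ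
  | .lit c => c
  | .get arr i j => s.nat arr (i.eval s) (j.eval s)
  | .add e e' => e.eval s + e'.eval s
  | .sub e e' => e.eval s - e'.eval s

/-- Division by zero and square roots of negative numbers return zero. -/
noncomputable def RExpr.eval (s : Store) : RExpr → ℝ
  | .ofInt e => (e.eval s : ℝ)
  | .get arr i j => s.real arr (i.eval s) (j.eval s)
  | .add e e' => e.eval s + e'.eval s
  | .sub e e' => e.eval s - e'.eval s
  | .mul e e' => e.eval s * e'.eval s
  | .div e e' => e.eval s / e'.eval s
  | .sqrt e => Real.sqrt (e.eval s)

def Test.Holds (s : Store) : Test → Prop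
  | .ilt e e' => e.eval s < e'.eval s
  | .rlt e e' => e.eval s < e'.eval s
  | .neg b => ¬ b.Holds s
  | .conj b b' => b.Holds s ∧ b'.Holds s

/-- Write the natural number `v` into cell `(i, j)` of the array `arr`. -/
def Store.setNat (s : Store) (arr i j v : ℕ) : Store :=
  { s with nat := fun x y z => if x = arr ∧ y = i ∧ z = j then v else s.nat x y z }

/-- Write the real number `v` into cell `(i, j)` of the array `arr`. -/
def Store.setReal (s : Store) (arr i j : ℕ) (v : ℝ) : Store :=
  { s with real := fun x y z => if x = arr ∧ y = i ∧ z = j then v else s.real x y z }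

/-- Append a gate to the output. -/
def Store.push (s : Store) (g : Gate ℕ ℝ) : Store :=
  { s with out := s.out ++ [g] }

/-- `Exec p s t s'`: started on `s`, the program `p` halts after exactly `t` steps, on `s'`. -/
inductive Exec : Prog → Store → ℕ → Store → Prop
  | iset (arr : ℕ) (i j e : IExpr) (s : Store) :
      Exec (.iset arr i j e) s 1 (s.setNat arr (i.eval s) (j.eval s) (e.eval s))
  | rset (arr : ℕ) (i j : IExpr) (e : RExpr) (s : Store) :
      Exec (.rset arr i j e) s 1 (s.setReal arr (i.eval s) (j.eval s) (e.eval s))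
  | emit (g : Gate IExpr RExpr) (s : Store) :
      Exec (.emit g) s 1 (s.push (g.map (fun e => e.eval s) (fun e => e.eval s)))
  | seq {p q : Prog} {s s' s'' : Store} {t t' : ℕ} :
      Exec p s t s' → Exec q s' t' s'' → Exec (.seq p q) s (t + t') s''
  | cond_true {b : Test} {p q : Prog} {s s' : Store} {t : ℕ} :
      b.Holds s → Exec p s t s' → Exec (.cond b p q) s (t + 1) s'
  | cond_false {b : Test} {p q : Prog} {s s' : Store} {t : ℕ} :
      ¬ b.Holds s → Exec q s t s' → Exec (.cond b p q) s (t + 1) s'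
  | loop_true {b : Test} {p : Prog} {s s' s'' : Store} {t t' : ℕ} :
      b.Holds s → Exec p s t s' → Exec (.loop b p) s' t' s'' →
        Exec (.loop b p) s (t + t' + 1) s''
  | loop_false {b : Test} {p : Prog} {s : Store} :
      ¬ b.Holds s → Exec (.loop b p) s 1 s

open Classical in
/-- The input. Integer array `0`: the numbers `n` and `m` in cells `(0, 0)` and `(0, 1)`. Integer
arrays `1` and `2`: the `X`-bit and the `Z`-bit of the term `Pᵢ` at qubit `j` in cell `(i, j)`.
Integer array `3`: in cell `(i, 0)` the number `1` if `vᵢ = -1`. Real array `0`: in cell `(w, 0)`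
the value of `f` at `m - 2w`, for `0 ≤ w ≤ m`; every eigenvalue of a commuting Hamiltonian is of
the form `m - 2w`. All other cells are zero. -/
noncomputable def inputStore {n m : ℕ} (H : PauliHamiltonian n m) (f : ℝ → ℝ) : Store where
  nat arr i j :=
    if arr = 0 ∧ i = 0 ∧ j = 0 then n
    else if arr = 0 ∧ i = 0 ∧ j = 1 then m
    else if h : arr = 1 ∧ i < m ∧ j < n then (H.term ⟨i, h.2.1⟩ ⟨j, h.2.2⟩).xBit.val
    else if h : arr = 2 ∧ i < m ∧ j < n then (H.term ⟨i, h.2.1⟩ ⟨j, h.2.2⟩).zBit.val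
    else if h : arr = 3 ∧ i < m ∧ j = 0 then (if H.sign ⟨i, h.2.1⟩ = -1 then 1 else 0)
    else 0
  real arr w j := if arr = 0 ∧ w ≤ m ∧ j = 0 then f ((m : ℝ) - 2 * (w : ℝ)) else 0
  out := []

/-- On input `H` and `f`, the program emits an HDQI circuit for `H`, with a pilot state and a
decoder for the errors in its support, and this circuit, started on `|0⟩`, leaves register `B` in
the state `ρ`. The total time, consisting of the classical steps, the gates, and the number of
qubits to initialize, is at most `T`. -/
def HDQI.Prepares {n m : ℕ} (prog : Prog) (H : PauliHamiltonian n m) (f : ℝ → ℝ) (T : ℕ)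
    (ρ : Matrix (Fin n → ZMod 2) (Fin n → ZMod 2) ℂ) : Prop :=
  ∃ (t a : ℕ) (s : Store) (pilot : List (Gate (Fin m ⊕ Fin a) ℝ))
    (decoder : List (Gate (Qubit m n a) ℝ)) (Y : Set (Fin m → ZMod 2)),
    Exec prog (inputStore H f) t s ∧
    s.out = (HDQI.circuit H pilot decoder).map (Gate.relabel Qubit.index) ∧
    t + (HDQI.circuit H pilot decoder).length + (m + 2 * n + a) ≤ T ∧
    (∀ g ∈ HDQI.circuit H pilot decoder, g.Valid) ∧
    HDQI.PreparesPilot pilot Y ∧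
    HDQI.Decodes H decoder Y ∧
    reducedB (runCircuit (HDQI.circuit H pilot decoder) (ket 0)) = ρ

/-! The signed terms commute and square to one, so the products `Q(y) = ∏ (vᵢPᵢ)^(yᵢ)` (`termProd`)
form a representation of `𝔽₂ᵐ` by Hermitian matrices. Gaussian elimination of `Bᵀ` selects a set `S`
of pivot columns; each remaining column, at most `k` of them by `card_relations_le`, is a sum of
pivot columns. On vectors supported on `S` the matrix `Bᵀ` is injective, so `Q(y)` is traceless
unless `y = 0`. Hence all joint eigenspaces of the pivot terms, labelled by `z ∈ 𝔽₂^S`, have the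
same nonzero dimension. The remaining terms act on them by signs, because the terms in a relation
multiply to `±1` (`termProd_of_relation`). So `H` acts on the eigenspace of `z` as `m - 2 wt(z)`,
where `wt(z)` is the Hamming weight of `z` plus the number of remaining columns `j` whose affine
form `εⱼ + ⟨dⱼ, z⟩` equals `1` (`op_eq_calculus`), and `f(H) = ∑ f(m - 2 wt(z)) Π_z`.

The amplitudes on `BC` form a matrix on which operators on `B` act by left multiplication, and
`|Φⁿ⟩` is a multiple of the identity. A pilot state `∑ c_y |y⟩` therefore leads to `2⁻ⁿ M Mᴴ` on
register `B`, with `M = ∑ c_y Q(y)` (`reducedB_circuit`). If `c` is the Hadamard transform over `S`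
of `z ↦ √(f(m - 2 wt(z)) / W)`, with `W` the sum of all these values of `f`, Fourier inversion makes
`M` a multiple of `∑ √(f(m - 2 wt(z)) / W) Π_z`, and `M Mᴴ` is proportional to `f(H)`
(`amplitude_state`). Decoding is linear: the recorded row operations contain a left inverse of `Bᵀ`
on `S` (`decode`).

It remains to prepare `∑ √(f(m - 2 wt(z)) / W) |z⟩` efficiently. The number `wt(z)` depends only on
the Hamming weight of `z` and the parities `⟨dⱼ, z⟩`, so an automaton with `(m + 1) * 2 ^ (m - |S|)
≤ (m + 1) * 2 ^ k` states computes it bit by bit (`Trellis`). Dynamic programming gives, for each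
level and state, the total weight of all completions. Ratios of these numbers are conditional
probabilities; rotating one qubit after another by their square roots, controlled on the state of
the automaton, which the workspace holds in unary, builds the superposition (`layer_partialState`).
Then the automaton is uncomputed and Hadamard gates on `S` yield the pilot state
(`Pilot.circuit_run`).

One explicit program does all this. It is verified in a small Hoare logic with time bounds (`Runs`),
and its cost is a fixed polynomial expression in `n`, `m` and the number of states. Gibbs states are
the case `f(E) = exp(-βE)`; for `β = ∞` an energy shift, which the normalized state does not see,
makes the weights converge. -/

/-! ## Total correctness of programs with time bounds -/

/-- The arrays of natural numbers that a program may change. -/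
def Prog.natWrites : Prog → List ℕ
  | .iset arr _ _ _ => [arr]
  | .rset _ _ _ _ => []
  | .emit _ => []
  | .seq p q => p.natWrites ++ q.natWrites
  | .cond _ p q => p.natWrites ++ q.natWrites
  | .loop _ p => p.natWrites

/-- The arrays of real numbers that a program may change. -/
def Prog.realWrites : Prog → List ℕ
  | .iset _ _ _ _ => []
  | .rset arr _ _ _ => [arr]
  | .emit _ => []
  | .seq p q => p.realWrites ++ q.realWrites
  | .cond _ p q => p.realWrites ++ q.realWrites
  | .loop _ p => p.realWrites

/-- The program emits no gates. -/
def Prog.silent : Prog → Bool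
  | .iset _ _ _ _ => true
  | .rset _ _ _ _ => true
  | .emit _ => false
  | .seq p q => p.silent && q.silent
  | .cond _ p q => p.silent && q.silent
  | .loop _ p => p.silent

/-- `s'` differs from `s` only in places where `p` may write. -/
structure Prog.Frame (p : Prog) (s s' : Store) : Prop where
  nat : ∀ x, x ∉ p.natWrites → s'.nat x = s.nat x
  real : ∀ x, x ∉ p.realWrites → s'.real x = s.real x
  out : p.silent = true → s'.out = s.out

theorem Store.setNat_nat_ne (s : Store) {arr x : ℕ} (i j v : ℕ) (h : x ≠ arr) :
    (s.setNat arr i j v).nat x = s.nat x := by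
  funext y z; simp [Store.setNat, h]

theorem Store.setReal_real_ne (s : Store) {arr x : ℕ} (i j : ℕ) (v : ℝ) (h : x ≠ arr) :
    (s.setReal arr i j v).real x = s.real x := by
  funext y z; simp [Store.setReal, h]

theorem Prog.Frame.refl (p : Prog) (s : Store) : p.Frame s s :=
  ⟨fun _ _ => rfl, fun _ _ => rfl, fun _ => rfl⟩

theorem Prog.Frame.trans {p : Prog} {s s' s'' : Store} (h : p.Frame s s') (h' : p.Frame s' s'') :
    p.Frame s s'' :=
  ⟨fun x hx => (h'.nat x hx).trans (h.nat x hx), fun x hx => (h'.real x hx).trans (h.real x hx),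
    fun hx => (h'.out hx).trans (h.out hx)⟩

theorem Prog.Frame.mono {p q : Prog} {s s' : Store} (h : p.Frame s s')
    (h1 : ∀ x ∈ p.natWrites, x ∈ q.natWrites) (h2 : ∀ x ∈ p.realWrites, x ∈ q.realWrites)
    (h3 : q.silent = true → p.silent = true) : q.Frame s s' :=
  ⟨fun x hx => h.nat x fun hh => hx (h1 x hh), fun x hx => h.real x fun hh => hx (h2 x hh),
    fun hx => h.out (h3 hx)⟩

/-- The write sets are syntactic, so for a concrete program `decide` settles which arrays survive.
Loop invariants then need to mention only what the body changes. -/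
theorem Exec.frame {p : Prog} {s s' : Store} {t : ℕ} (h : Exec p s t s') : p.Frame s s' := by
  induction h with
  | iset arr i j e s =>
    refine ⟨fun x hx => ?_, fun _ _ => rfl, fun _ => rfl⟩
    exact s.setNat_nat_ne _ _ _ (by simpa [Prog.natWrites] using hx)
  | rset arr i j e s =>
    refine ⟨fun _ _ => rfl, fun x hx => ?_, fun _ => rfl⟩
    exact s.setReal_real_ne _ _ _ (by simpa [Prog.realWrites] using hx)
  | emit g s => exact ⟨fun _ _ => rfl, fun _ _ => rfl, fun h => by simp [Prog.silent] at h⟩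
  | seq h1 h2 ih1 ih2 =>
    exact (ih1.mono (by simp +contextual [Prog.natWrites]) (by simp +contextual [Prog.realWrites])
      (by simp +contextual [Prog.silent])).trans
      (ih2.mono (by simp +contextual [Prog.natWrites]) (by simp +contextual [Prog.realWrites])
      (by simp +contextual [Prog.silent]))
  | cond_true _ _ ih =>
    exact ih.mono (by simp +contextual [Prog.natWrites]) (by simp +contextual [Prog.realWrites])
      (by simp +contextual [Prog.silent])
  | cond_false _ _ ih =>
    exact ih.mono (by simp +contextual [Prog.natWrites]) (by simp +contextual [Prog.realWrites])
      (by simp +contextual [Prog.silent])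
  | loop_true _ _ _ ih1 ih2 =>
    exact (ih1.mono (by simp [Prog.natWrites]) (by simp [Prog.realWrites])
      (by simp [Prog.silent])).trans ih2
  | loop_false _ => exact Prog.Frame.refl _ _

/-- Each emitted gate costs one step, so a bound on the running time bounds the number of gates as
well. -/
theorem Exec.length_out_le {p : Prog} {s s' : Store} {t : ℕ} (h : Exec p s t s') :
    s'.out.length ≤ s.out.length + t := by
  induction h with
  | iset | rset => simp [Store.setNat, Store.setReal]
  | emit => simp [Store.push]
  | _ => omega

/-- Started on `s`, the program `p` halts within `T` steps in a store that satisfies `Q`. -/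
def Runs (p : Prog) (s : Store) (T : ℕ) (Q : Store → Prop) : Prop :=
  ∃ t s', t ≤ T ∧ Exec p s t s' ∧ Q s'

namespace Runs

variable {p q : Prog} {s : Store} {T T' : ℕ} {Q Q' : Store → Prop}

theorem mono (h : Runs p s T Q) (hT : T ≤ T') : Runs p s T' Q := by
  obtain ⟨t, s', ht, he, hq⟩ := h
  exact ⟨t, s', ht.trans hT, he, hq⟩

theorem imp (h : Runs p s T Q) (hQ : ∀ s', p.Frame s s' → Q s' → Q' s') : Runs p s T Q' := by
  obtain ⟨t, s', ht, he, hq⟩ := h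
  exact ⟨t, s', ht, he, hQ s' he.frame hq⟩

theorem iset {arr : ℕ} {i j e : IExpr} (h : Q (s.setNat arr (i.eval s) (j.eval s) (e.eval s))) :
    Runs (.iset arr i j e) s 1 Q :=
  ⟨1, _, le_rfl, .iset .., h⟩

theorem rset {arr : ℕ} {i j : IExpr} {e : RExpr}
    (h : Q (s.setReal arr (i.eval s) (j.eval s) (e.eval s))) : Runs (.rset arr i j e) s 1 Q :=
  ⟨1, _, le_rfl, .rset .., h⟩

theorem emit {g : Gate IExpr RExpr}
    (h : Q (s.push (g.map (fun e => e.eval s) (fun e => e.eval s)))) : Runs (.emit g) s 1 Q :=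
  ⟨1, _, le_rfl, .emit .., h⟩

theorem seq (h : Runs p s T fun s' => Runs q s' T' Q) : Runs (.seq p q) s (T + T') Q := by
  obtain ⟨t, s', ht, he, t', s'', ht', he', hq⟩ := h
  exact ⟨t + t', s'', by omega, .seq he he', hq⟩

theorem seq_of {R : Store → Prop} (h : Runs p s T R)
    (h' : ∀ s', p.Frame s s' → R s' → Runs q s' T' Q) : Runs (.seq p q) s (T + T') Q :=
  seq (h.imp h')

theorem cond {b : Test} (h : b.Holds s → Runs p s T Q) (h' : ¬ b.Holds s → Runs q s T Q) :
    Runs (.cond b p q) s (T + 1) Q := by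
  by_cases hb : b.Holds s
  · obtain ⟨t, s', ht, he, hq⟩ := h hb
    exact ⟨t + 1, s', by omega, .cond_true hb he, hq⟩
  · obtain ⟨t, s', ht, he, hq⟩ := h' hb
    exact ⟨t + 1, s', by omega, .cond_false hb he, hq⟩

end Runs

/-- A scalar variable. -/
def var (v : ℕ) : IExpr := .get v (.lit 0) (.lit 0)

@[simp] theorem var_eval (v : ℕ) (s : Store) : (var v).eval s = s.nat v 0 0 := rfl

/-- A statement without relevant effect. -/
def Prog.skip : Prog := .iset 99 (.lit 0) (.lit 0) (.lit 0)

theorem Runs.skip {s : Store} {Q : Store → Prop} (h : Q (s.setNat 99 0 0 0)) :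
    Runs .skip s 1 Q := Runs.iset h

/-- The conditional statement without alternative. -/
def Prog.when (b : Test) (p : Prog) : Prog := .cond b p .skip

/-- The loop `for v < e`. -/
def Prog.for (v : ℕ) (e : IExpr) (p : Prog) : Prog :=
  .seq (.iset v (.lit 0) (.lit 0) (.lit 0))
    (.loop (.ilt (var v) e) (.seq p (.iset v (.lit 0) (.lit 0) (.add (var v) (.lit 1)))))

theorem Runs.when {b : Test} {p : Prog} {s : Store} {T : ℕ} {Q : Store → Prop}
    (h : b.Holds s → Runs p s (T + 1) Q) (h' : ¬ b.Holds s → Q (s.setNat 99 0 0 0)) :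
    Runs (.when b p) s (T + 2) Q :=
  Runs.cond h fun hb => (Runs.skip (h' hb)).mono (by omega)

/-- Induction on the number of remaining rounds. The bound `e` is evaluated anew before each round,
so its value has to be stable under everything the loop may write. A round costs the body, the
increment and the test; the final summand `2` is the initialization and the last test. -/
theorem Runs.for_loop {v : ℕ} {e : IExpr} {p : Prog} {s : Store} {N T : ℕ}
    (I : ℕ → Store → Prop) (hv : v ∉ p.natWrites)
    (he : ∀ s', (Prog.for v e p).Frame s s' → e.eval s' = N)
    (h0 : I 0 (s.setNat v 0 0 0))
    (hstep : ∀ i s', i < N → (Prog.for v e p).Frame s s' → s'.nat v 0 0 = i → I i s' →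
      Runs p s' T fun s'' => I (i + 1) (s''.setNat v 0 0 (i + 1))) :
    Runs (.for v e p) s (N * (T + 2) + 2) (I N) := by
  have key : ∀ k i s', k + i = N → (Prog.for v e p).Frame s s' → s'.nat v 0 0 = i → I i s' →
      Runs (.loop (.ilt (var v) e) (.seq p (.iset v (.lit 0) (.lit 0) (.add (var v) (.lit 1)))))
        s' (k * (T + 2) + 1) (I N) := by
    intro k
    induction k with
    | zero =>
      intro i s' hk hf hi hI
      refine ⟨1, s', by omega, .loop_false ?_, ?_⟩
      · simp only [Test.Holds, var_eval, hi, he s' hf]; omega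
      · have : i = N := by omega
        exact this ▸ hI
    | succ k ih =>
      intro i s' hk hf hi hI
      obtain ⟨t, s1, ht, hex, hI1⟩ := hstep i s' (by omega) hf hi hI
      have hv1 : s1.nat v 0 0 = i := by rw [hex.frame.nat v hv, hi]
      have hex2 : Exec (.seq p (.iset v (.lit 0) (.lit 0) (.add (var v) (.lit 1)))) s' (t + 1)
          (s1.setNat v 0 0 (i + 1)) := by
        refine .seq hex ?_
        have := Exec.iset v (.lit 0) (.lit 0) (.add (var v) (.lit 1)) s1
        simpa [IExpr.eval, hv1] using this
      have hf2 : (Prog.for v e p).Frame s (s1.setNat v 0 0 (i + 1)) :=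
        hf.trans (hex2.frame.mono (by simp +contextual [Prog.for, Prog.natWrites])
          (by simp +contextual [Prog.for, Prog.realWrites])
          (by simp +contextual [Prog.for, Prog.silent]))
      obtain ⟨t2, s2, ht2, hex3, hq⟩ := ih (i + 1) _ (by omega) hf2 (by simp [Store.setNat]) hI1
      refine ⟨t + 1 + t2 + 1, s2, ?_, .loop_true ?_ hex2 hex3, hq⟩
      · have : (k + 1) * (T + 2) = k * (T + 2) + (T + 2) := by ring
        omega
      · simp only [Test.Holds, var_eval, hi, he s' hf]; omega
  have hex0 : Exec (.iset v (.lit 0) (.lit 0) (.lit 0)) s 1 (s.setNat v 0 0 0) := .iset ..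
  obtain ⟨t, s', ht, hex, hq⟩ := key N 0 _ (by omega)
    (hex0.frame.mono (by simp +contextual [Prog.for, Prog.natWrites])
          (by simp +contextual [Prog.for, Prog.realWrites])
          (by simp +contextual [Prog.for, Prog.silent])) (by simp [Store.setNat]) h0
  exact ⟨1 + t, s', by omega, .seq hex0 hex, hq⟩

/-- A loop whose body emits gates emits the concatenation. -/
theorem Runs.for_emit {v : ℕ} {e : IExpr} {p : Prog} {s : Store} {N T : ℕ}
    (g : ℕ → List (Gate ℕ ℝ)) (hv : v ∉ p.natWrites)
    (he : ∀ s', (Prog.for v e p).Frame s s' → e.eval s' = N)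
    (hstep : ∀ i s', i < N → (Prog.for v e p).Frame s s' → s'.nat v 0 0 = i →
      Runs p s' T fun s'' => s''.out = s'.out ++ g i) :
    Runs (.for v e p) s (N * (T + 2) + 2) fun s' => s'.out = s.out ++ (List.range N).flatMap g :=
  Runs.for_loop (fun i s' => s'.out = s.out ++ (List.range i).flatMap g) hv he (by simp [Store.setNat])
    fun i s' hi hf hv' hI => (hstep i s' hi hf hv').imp fun s'' _ h => by
      simp only [Store.setNat] at h ⊢
      rw [h, hI, List.range_succ, List.flatMap_append]; simp

/-! ## Gaussian elimination over `𝔽₂` -/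

namespace Gauss

open Finset

/-- The state of the elimination, applied to a matrix `M` with `R` rows and `m` columns, after the
first `ρ` rows have been processed. The working matrix `G` has `m + R` columns; the last `R` columns
record the row operations. `piv j = r + 1` says that column `j` has its pivot in row `r`. -/
structure Reduced (R m : ℕ) (M : ℕ → ℕ → ZMod 2) (ρ : ℕ) (G : ℕ → ℕ → ℕ) (piv : ℕ → ℕ) :
    Prop where
  le_one : ∀ r c, G r c ≤ 1
  rowop : ∀ r < R, ∀ c < m, (G r c : ZMod 2) = ∑ r' ∈ range R, (G r (m + r') : ZMod 2) * M r' c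
  ker : ∀ y : ℕ → ZMod 2, (∀ r < R, ∑ c ∈ range m, (G r c : ZMod 2) * y c = 0) →
    ∀ r < R, ∑ c ∈ range m, M r c * y c = 0
  pivot : ∀ j < m, ∀ r, piv j = r + 1 → r < ρ ∧ ∀ r' < R, G r' j = if r' = r then 1 else 0
  inj : ∀ j < m, ∀ j' < m, piv j = piv j' → piv j ≠ 0 → j = j'
  rows : ∀ r < ρ, (∀ c < m, G r c = 0) ∨ ∃ j < m, piv j = r + 1

/-- Addition of row `ρ` to all rows with a nonzero entry in column `j`. -/
def elim (R W : ℕ) (G : ℕ → ℕ → ℕ) (ρ j : ℕ) : ℕ → ℕ → ℕ := fun σ c =>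
  if σ < R ∧ σ ≠ ρ ∧ 0 < G σ j ∧ c < W ∧ 0 < G ρ c then 1 - G σ c else G σ c

/-- For entries in `{0, 1}` the truncated difference `1 - x` is the sum `x + 1` in `𝔽₂`. -/
theorem cast_elim {R W : ℕ} {G : ℕ → ℕ → ℕ} (hG : ∀ r c, G r c ≤ 1) {ρ j σ c : ℕ} (hσ : σ < R)
    (hc : c < W) : (elim R W G ρ j σ c : ZMod 2) =
      G σ c + (if σ ≠ ρ ∧ 0 < G σ j then 1 else 0) * (G ρ c : ZMod 2) := by
  have h1 := hG σ c
  have h2 := hG ρ c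
  have h3 : (1 : ZMod 2) + 1 = 0 := by decide
  unfold elim
  by_cases h : σ ≠ ρ ∧ 0 < G σ j
  · rcases Nat.le_one_iff_eq_zero_or_eq_one.1 h1 with h1 | h1 <;>
      rcases Nat.le_one_iff_eq_zero_or_eq_one.1 h2 with h2 | h2 <;> simp [h, hσ, hc, h1, h2, h3]
  · rw [if_neg (by tauto), if_neg h]; simp

theorem Reduced.skip {R m ρ : ℕ} {M : ℕ → ℕ → ZMod 2} {G : ℕ → ℕ → ℕ} {piv : ℕ → ℕ}
    (h : Reduced R m M ρ G piv) (hz : ∀ c < m, G ρ c = 0) : Reduced R m M (ρ + 1) G piv where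
  le_one := h.le_one
  rowop := h.rowop
  ker := h.ker
  pivot j hj r hr := ⟨(h.pivot j hj r hr).1.trans (by omega), (h.pivot j hj r hr).2⟩
  inj := h.inj
  rows r hr := by
    rcases Nat.lt_succ_iff_lt_or_eq.1 hr with h' | rfl
    · exact h.rows r h'
    · exact .inl hz

/-- A Gauss–Jordan step. The existing pivot columns are unit vectors with their `1` above row `ρ`,
hence vanish in row `ρ`: column `j` is not among them, and adding row `ρ` elsewhere leaves them
intact. Row `ρ` itself is unchanged, so the old equations follow from the new ones. -/
theorem Reduced.step {R m ρ j : ℕ} {M : ℕ → ℕ → ZMod 2} {G : ℕ → ℕ → ℕ} {piv : ℕ → ℕ}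
    (h : Reduced R m M ρ G piv) (hρ : ρ < R) (hj : j < m) (hGj : 0 < G ρ j) :
    Reduced R m M (ρ + 1) (elim R (m + R) G ρ j) (Function.update piv j (ρ + 1)) := by
  have h1 : G ρ j = 1 := le_antisymm (h.le_one _ _) hGj
  have hself : ∀ c, elim R (m + R) G ρ j ρ c = G ρ c := fun c => by simp [elim]
  have hpj : piv j = 0 := by
    by_contra hne
    obtain ⟨r, hr⟩ := Nat.exists_eq_succ_of_ne_zero hne
    obtain ⟨hlt, hcol⟩ := h.pivot j hj r hr
    have := hcol ρ hρ
    rw [if_neg (by omega)] at this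
    omega
  refine ⟨fun r c => ?_, fun r hr c hc => ?_, fun y hy => h.ker y ?_, fun i hi r hr => ?_,
    fun i hi i' hi' he hne => ?_, fun r hr => ?_⟩
  · have := h.le_one r c
    unfold elim; split_ifs <;> omega
  · rw [cast_elim h.le_one hr (by omega), h.rowop r hr c hc, h.rowop ρ hρ c hc, mul_sum,
      ← sum_add_distrib]
    refine sum_congr rfl fun r' hr' => ?_
    rw [cast_elim h.le_one hr (by simp at hr'; omega)]
    ring
  · have hyρ : ∑ c ∈ range m, (G ρ c : ZMod 2) * y c = 0 := by simpa [hself] using hy ρ hρ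
    intro r hr
    have := hy r hr
    rw [sum_congr rfl fun c hc => by
      rw [cast_elim h.le_one hr (by simp at hc; omega), add_mul, mul_assoc], sum_add_distrib,
      ← mul_sum, hyρ] at this
    simpa using this
  · by_cases hij : i = j
    · subst hij
      obtain rfl : r = ρ := by simpa using hr.symm
      refine ⟨by omega, fun r' hr' => ?_⟩
      have := h.le_one r' i
      unfold elim
      by_cases h' : r' = r
      · subst h'; simp [h1]
      · simp only [h', if_false, hr', ne_eq, not_false_eq_true, true_and, hGj, and_true]
        split_ifs with hh <;> omega
    · rw [Function.update_of_ne hij] at hr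
      obtain ⟨hlt, hcol⟩ := h.pivot i hi r hr
      refine ⟨by omega, fun r' hr' => ?_⟩
      have h0 : G ρ i = 0 := by rw [hcol ρ hρ, if_neg (by omega)]
      rw [← hcol r' hr']
      simp [elim, h0]
  · by_cases hij : i = j
    · subst hij
      by_contra hne'
      rw [Function.update_self, Function.update_of_ne (Ne.symm hne')] at he
      have := (h.pivot i' hi' ρ he.symm).1
      omega
    · rw [Function.update_of_ne hij] at he hne
      by_cases hij' : i' = j
      · subst hij'
        rw [Function.update_self] at he
        have := (h.pivot i hi ρ he).1
        omega
      · rw [Function.update_of_ne hij'] at he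
        exact h.inj i hi i' hi' he hne
  · rcases Nat.lt_succ_iff_lt_or_eq.1 hr with h' | rfl
    · rcases h.rows r h' with h0 | ⟨i, hi, hp⟩
      · by_cases hz : r < R ∧ r ≠ ρ ∧ 0 < G r j
        · have := h0 j hj; omega
        · refine .inl fun c hc => ?_
          unfold elim
          rw [if_neg (by tauto), h0 c hc]
      · refine .inr ⟨i, hi, ?_⟩
        rw [Function.update_of_ne, hp]
        rintro rfl
        omega
    · exact .inr ⟨j, hj, by simp⟩

/-- The relation between column `j` and the pivot columns. -/
def rel (G : ℕ → ℕ → ℕ) (piv : ℕ → ℕ) (j i : ℕ) : ℕ :=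
  if i = j then 1 else if 0 < piv i ∧ 0 < G (piv i - 1) j then 1 else 0

/-- A zero row imposes nothing. In any other row `r` exactly one pivot column is nonzero, with entry
`1`, and there the relation has coefficient `G r j`. Together with column `j` itself this gives `G r
j + G r j = 0`. -/
theorem Reduced.rel_mem_ker {R m : ℕ} {M : ℕ → ℕ → ZMod 2} {G : ℕ → ℕ → ℕ} {piv : ℕ → ℕ}
    (h : Reduced R m M R G piv) {j : ℕ} (hj : j < m) (hpj : piv j = 0) :
    ∀ r < R, ∑ c ∈ range m, M r c * (rel G piv j c : ZMod 2) = 0 := by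
  have two : (1 : ZMod 2) + 1 = 0 := by decide
  refine h.ker _ fun r hr => ?_
  have hsplit : ∀ c ∈ range m, (G r c : ZMod 2) * (rel G piv j c : ZMod 2) =
      (if c = j then (G r j : ZMod 2) else 0) +
        (if piv c = r + 1 then (G r j : ZMod 2) else 0) := by
    intro c hc
    rw [mem_range] at hc
    by_cases hcj : c = j
    · subst hcj; simp [rel, hpj]
    · by_cases hp : piv c = 0
      · simp [rel, hp, hcj]
      · obtain ⟨r', hr'⟩ := Nat.exists_eq_succ_of_ne_zero hp
        obtain ⟨hlt, hcol⟩ := h.pivot c hc r' hr'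
        rw [hcol r hr]
        by_cases hrr : r = r'
        · subst hrr
          have := h.le_one r j
          rcases Nat.le_one_iff_eq_zero_or_eq_one.1 this with h1 | h1 <;> simp [rel, hcj, hr', h1]
        · have : ¬ r' = r := fun h => hrr h.symm
          simp [hcj, hrr, hr', this]
  rw [sum_congr rfl hsplit, sum_add_distrib, sum_ite_eq' , if_pos (by simpa using hj)]
  rcases h.rows r hr with h0 | ⟨i, hi, hp⟩
  · simp [h0 j hj]
  · rw [sum_eq_single i, if_pos hp]
    · rw [← two_mul]; have : (2 : ZMod 2) = 0 := by decide
      rw [this, zero_mul]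
    · intro c hc hci
      rw [if_neg]
      intro hpc
      exact hci (h.inj c (by simpa using hc) i hi (by rw [hpc, hp]) (by omega))
    · intro hh; exact absurd (by simpa using hi) hh

/-- The last columns of row `piv i - 1` record which combination of the rows of `M` this row is, and
on the pivot columns the row is a unit vector. -/
theorem Reduced.left_inverse {R m : ℕ} {M : ℕ → ℕ → ZMod 2} {G : ℕ → ℕ → ℕ} {piv : ℕ → ℕ}
    (h : Reduced R m M R G piv) {i c : ℕ} (hi : i < m) (hc : c < m) (hpi : 0 < piv i)
    (hpc : 0 < piv c) :
    ∑ r ∈ range R, (G (piv i - 1) (m + r) : ZMod 2) * M r c = if c = i then 1 else 0 := by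
  obtain ⟨r, hr⟩ := Nat.exists_eq_succ_of_ne_zero hpi.ne'
  obtain ⟨r', hr'⟩ := Nat.exists_eq_succ_of_ne_zero hpc.ne'
  have h1 := h.pivot i hi r hr
  have h2 := h.pivot c hc r' hr'
  rw [← h.rowop _ (by omega) c hc, h2.2 _ (by omega)]
  by_cases hci : c = i
  · subst hci; simp [hr']
  · have : ¬ r = r' := fun hh => hci (h.inj c hc i hi (by omega) (by omega))
    simp [hr, this, hci]

theorem Reduced.init {R m : ℕ} {M : ℕ → ℕ → ZMod 2} {G : ℕ → ℕ → ℕ} (hG : ∀ r c, G r c ≤ 1)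
    (h1 : ∀ r < R, ∀ c < m, (G r c : ZMod 2) = M r c)
    (h2 : ∀ r < R, ∀ r' < R, G r (m + r') = if r' = r then 1 else 0) :
    Reduced R m M 0 G 0 where
  le_one := hG
  rowop r hr c hc := by
    rw [h1 r hr c hc, sum_congr rfl fun r' hr' => by rw [h2 r hr r' (by simpa using hr')]]
    simp [hr]
  ker y hy r hr := by
    rw [← hy r hr]
    exact sum_congr rfl fun c hc => by rw [h1 r hr c (by simpa using hc)]
  pivot j hj r hr := by simp at hr
  inj j hj j' hj' _ h := by simp at h
  rows r hr := by omega

end Gauss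

/-! ## The program: Gaussian elimination of the check matrix -/

namespace Compiler

/-- The number of qubits. -/
def nE : IExpr := .get 0 (.lit 0) (.lit 0)

/-- The number of terms. -/
def mE : IExpr := .get 0 (.lit 0) (.lit 1)

/-- The number of rows of the check matrix. -/
def rE : IExpr := .add nE nE

/-- The width of the working matrix of the elimination. -/
def wE : IExpr := .add mE rE

/-- Copy the check matrix to array `4` and append an identity matrix. -/
def loadMatrix : Prog :=
  .seq (.for 100 mE (.for 101 nE (.seq
      (.iset 4 (var 101) (var 100) (.get 1 (var 100) (var 101)))
      (.iset 4 (.add nE (var 101)) (var 100) (.get 2 (var 100) (var 101))))))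
    (.for 100 rE (.iset 4 (var 100) (.add mE (var 100)) (.lit 1)))

/-- The entries of the working matrix before elimination. -/
def initialEntry (n m : ℕ) (X Z : ℕ → ℕ → ℕ) (r c : ℕ) : ℕ :=
  if c < m then (if r < n then X c r else if r < n + n then Z c (r - n) else 0)
  else if r < n + n ∧ c = m + r then 1 else 0

theorem loadMatrix_runs {s : Store} {n m : ℕ} (hn : s.nat 0 0 0 = n) (hm : s.nat 0 0 1 = m)
    (h4 : ∀ r c, s.nat 4 r c = 0) :
    Runs loadMatrix s ((m * ((n * ((1 + 1) + 2) + 2) + 2) + 2) + ((n + n) * (1 + 2) + 2)) fun s' =>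
      ∀ r c, s'.nat 4 r c = initialEntry n m (s.nat 1) (s.nat 2) r c := by
  refine Runs.seq_of (R := fun s' => ∀ r c, s'.nat 4 r c =
      if c < m then initialEntry n m (s.nat 1) (s.nat 2) r c else 0) ?_ ?_
  · refine Runs.for_loop (fun i s' => ∀ r c, s'.nat 4 r c =
      if c < i then (if c < m then initialEntry n m (s.nat 1) (s.nat 2) r c else 0) else 0)
      (by decide) (fun s' hf => by simp [mE, IExpr.eval, hf.nat 0 (by decide), hm])
      (by simp [Store.setNat, h4]) ?_ |>.imp ?_
    · intro i s' hi hf hv hI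
      -- Column `i` is filled in two halves at once: the `X`-bits in the rows below `l`, the
      -- `Z`-bits in the rows from `n` to `n + l - 1`.
      refine Runs.for_loop (fun l s'' => ∀ r c, s''.nat 4 r c =
        if c < i ∨ (c = i ∧ (r < l ∨ (n ≤ r ∧ r < n + l))) then
          (if c < m then initialEntry n m (s.nat 1) (s.nat 2) r c else 0) else 0)
        (by decide) (fun s'' hf' => by
          simp [nE, IExpr.eval, hf'.nat 0 (by decide), hf.nat 0 (by decide), hn]) ?_ ?_ |>.imp ?_
      · intro r c
        simp only [Store.setNat]
        rw [if_neg (by omega), hI]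
        congr 1
        apply propext; omega
      · intro l s'' hl hf' hv' hI'
        have e0 : s''.nat 0 = s.nat 0 := by rw [hf'.nat 0 (by decide), hf.nat 0 (by decide)]
        have e1 : s''.nat 1 = s.nat 1 := by rw [hf'.nat 1 (by decide), hf.nat 1 (by decide)]
        have e2 : s''.nat 2 = s.nat 2 := by rw [hf'.nat 2 (by decide), hf.nat 2 (by decide)]
        have e100 : s''.nat 100 0 0 = i := by rw [hf'.nat 100 (by decide), hv]
        refine Runs.seq (Runs.iset (Runs.iset ?_))
        intro r c
        have := hI' r c
        simp only [Store.setNat, IExpr.eval, var, nE, e0, e1, e2, e100, hv', hn] at this ⊢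
        simp only [this, initialEntry]
        grind
      · intro s'' hf' hI' r c
        simp only [Store.setNat]
        rw [if_neg (by omega), hI']
        simp only [initialEntry]
        grind
    · intro s' _ h r c
      rw [h]; split_ifs <;> rfl
  · intro s1 hf1 h1
    have e0 : s1.nat 0 = s.nat 0 := hf1.nat 0 (by decide)
    refine Runs.for_loop (fun i s' => ∀ r c, s'.nat 4 r c =
        if c < m ∨ r < i then initialEntry n m (s.nat 1) (s.nat 2) r c else 0)
        (by decide) (fun s' hf => by
          simp [rE, nE, IExpr.eval, hf.nat 0 (by decide), e0, hn]) ?_ ?_ |>.imp ?_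
    · intro r c
      simp [Store.setNat, h1]
    · intro i s' hi hf hv hI
      have e0 : s'.nat 0 = s.nat 0 := by rw [hf.nat 0 (by decide), e0]
      refine Runs.iset ?_
      intro r c
      have := hI r c
      simp only [Store.setNat, IExpr.eval, var, mE, e0, hv, hm] at this ⊢
      simp only [this, initialEntry]
      grind
    · intro s' hf h r c
      rw [h]; simp only [initialEntry]; grind

/-- Eliminate with the pivot in row `100` and the column given by cell `6`. -/
def eliminate : Prog :=
  .for 101 rE (.when (.conj (.neg (.conj (.neg (.ilt (var 101) (var 100)))
      (.neg (.ilt (var 100) (var 101)))))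
      (.ilt (.lit 0) (.get 4 (var 101) (.sub (var 6) (.lit 1)))))
    (.for 102 wE (.when (.ilt (.lit 0) (.get 4 (var 100) (var 102)))
      (.iset 4 (var 101) (var 102) (.sub (.lit 1) (.get 4 (var 101) (var 102)))))))

theorem eliminate_runs {s : Store} {n m ρ j : ℕ} (hn : s.nat 0 0 0 = n) (hm : s.nat 0 0 1 = m)
    (hρ : s.nat 100 0 0 = ρ) (hj : s.nat 6 0 0 = j + 1) :
    Runs eliminate s ((n + n) * ((((m + (n + n)) * ((1 + 2) + 2) + 2) + 2) + 2) + 2) fun s' =>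
      ∀ r c, s'.nat 4 r c = Gauss.elim (n + n) (m + (n + n)) (s.nat 4) ρ j r c := by
  refine Runs.for_loop (fun i s' => ∀ r c, s'.nat 4 r c =
      if r < i then Gauss.elim (n + n) (m + (n + n)) (s.nat 4) ρ j r c else s.nat 4 r c)
      (by decide) (fun s' hf => by simp [rE, nE, IExpr.eval, hf.nat 0 (by decide), hn])
      (by simp [Store.setNat]) ?_ |>.imp ?_
  · intro i s' hi hf hv hI
    have e0 : s'.nat 0 = s.nat 0 := hf.nat 0 (by decide)
    have e6 : s'.nat 6 = s.nat 6 := hf.nat 6 (by decide)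
    have e100 : s'.nat 100 = s.nat 100 := hf.nat 100 (by decide)
    refine Runs.when ?_ ?_
    · intro hb
      simp only [Test.Holds, var_eval, IExpr.eval, hv, e6, e100, hρ, hj, hI] at hb
      rw [if_neg (by omega)] at hb
      have hρi : i ≠ ρ := by omega
      refine Runs.for_loop (N := m + (n + n)) (T := 1 + 2) (fun k s'' => ∀ r c, s''.nat 4 r c =
        if r < i ∨ (r = i ∧ c < k) then Gauss.elim (n + n) (m + (n + n)) (s.nat 4) ρ j r c
          else s.nat 4 r c) (by decide) (fun s'' hf' => by
            simp [wE, rE, mE, nE, IExpr.eval, hf'.nat 0 (by decide), e0, hn, hm]) ?_ ?_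
          |>.mono (by omega) |>.imp ?_
      · intro r c
        have := hI r c
        simp [Store.setNat, this]
      · intro k s'' hk hf' hv' hI'
        have e101 : s''.nat 101 0 0 = i := by rw [hf'.nat 101 (by decide), hv]
        have e100 : s''.nat 100 0 0 = ρ := by rw [hf'.nat 100 (by decide), e100, hρ]
        have hrow := hI' ρ k
        have hold := hI' i k
        rw [if_neg (by omega)] at hold
        -- Row `ρ` is never a target of the elimination, so it can be read while the other rows are
        -- overwritten in place.
        have hrow' : s''.nat 4 ρ k = s.nat 4 ρ k := by
          rw [hrow]; split_ifs
          · simp [Gauss.elim]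
          · rfl
        refine Runs.when ?_ ?_
        · intro hb'
          refine (Runs.iset ?_).mono (by omega : 1 ≤ _)
          intro r c
          have := hI' r c
          simp only [Test.Holds, Store.setNat, IExpr.eval, var, e100, e101, hv', hold, hrow']
            at this hb' ⊢
          simp only [this, Gauss.elim]
          grind
        · intro hb' r c
          have := hI' r c
          simp only [Test.Holds, Store.setNat, IExpr.eval, var, e100, hv', hrow']
            at this hb' ⊢
          simp only [this, Gauss.elim]
          grind
      · intro s'' hf' hI' r c
        have := hI' r c
        simp only [Store.setNat]
        rw [if_neg (by omega), this]
        simp only [Gauss.elim]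
        grind
    · intro hb r c
      simp only [Test.Holds, var_eval, IExpr.eval, hv, e6, e100, hρ, hj, hI] at hb
      have := hI r c
      simp only [Store.setNat, this, Gauss.elim]
      grind
  · intro s' hf h r c
    rw [h]; simp only [Gauss.elim]; grind

/-- One step of the elimination: find a nonzero entry in row `100`; if there is one, record and
use it as a pivot. -/
def pivotStep : Prog :=
  .seq (.iset 6 (.lit 0) (.lit 0) (.lit 0))
    (.seq (.for 101 mE (.when (.ilt (.lit 0) (.get 4 (var 100) (var 101)))
        (.iset 6 (.lit 0) (.lit 0) (.add (var 101) (.lit 1)))))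
      (.when (.ilt (.lit 0) (var 6))
        (.seq (.iset 5 (.sub (var 6) (.lit 1)) (.lit 0) (.add (var 100) (.lit 1))) eliminate)))

/-- Gaussian elimination of the check matrix. -/
def gauss : Prog := .seq loadMatrix (.for 100 rE pivotStep)

/-- Costs are expressions over an arbitrary semiring: read in `ℕ` they bound numbers of steps, read
in `Polynomial ℕ` they supply the polynomial of the main theorem. -/
def pivotStepCost {R : Type*} [Semiring R] (n m : R) : R :=
  1 + ((m * ((1 + 2) + 2) + 2) +
    ((1 + ((n + n) * ((((m + (n + n)) * ((1 + 2) + 2) + 2) + 2) + 2) + 2)) + 2))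

theorem pivotStep_runs {s : Store} {n m ρ : ℕ} {M : ℕ → ℕ → ZMod 2} (hn : s.nat 0 0 0 = n)
    (hm : s.nat 0 0 1 = m) (hρ : s.nat 100 0 0 = ρ) (hρn : ρ < n + n)
    (h : Gauss.Reduced (n + n) m M ρ (s.nat 4) (fun j => s.nat 5 j 0)) :
    Runs pivotStep s (pivotStepCost n m) fun s' =>
      Gauss.Reduced (n + n) m M (ρ + 1) (s'.nat 4) (fun j => s'.nat 5 j 0) := by
  refine Runs.seq (Runs.iset ?_)
  obtain ⟨s1, hs1⟩ : ∃ s1, s1 = s.setNat 6 0 0 0 := ⟨_, rfl⟩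
  simp only [IExpr.eval, ← hs1]
  have hs1' : ∀ x, x ≠ 6 → s1.nat x = s.nat x := fun x hx =>
    hs1 ▸ s.setNat_nat_ne _ _ _ hx
  -- Cell `6` holds one plus the column of the last nonzero entry found in row `ρ`; zero means that
  -- the first `m` entries vanish. Any nonzero entry may serve as pivot.
  refine Runs.seq_of (R := fun s' => (s'.nat 6 0 0 = 0 ∧ ∀ c < m, s.nat 4 ρ c = 0) ∨
    ∃ c < m, s'.nat 6 0 0 = c + 1 ∧ 0 < s.nat 4 ρ c) ?_ ?_
  · refine Runs.for_loop (fun i s' => (s'.nat 6 0 0 = 0 ∧ ∀ c < i, s.nat 4 ρ c = 0) ∨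
      ∃ c < i, s'.nat 6 0 0 = c + 1 ∧ 0 < s.nat 4 ρ c) (by decide) (fun s' hf => by
        simp [mE, IExpr.eval, hf.nat 0 (by decide), hs1', hm])
      (by simp [Store.setNat, hs1]) ?_
    intro i s' hi hf hv hI
    have e4 : s'.nat 4 = s.nat 4 := by rw [hf.nat 4 (by decide), hs1' _ (by decide)]
    have e100 : s'.nat 100 0 0 = ρ := by rw [hf.nat 100 (by decide), hs1' _ (by decide), hρ]
    refine Runs.when ?_ ?_
    · intro hb
      simp only [Test.Holds, var_eval, IExpr.eval, hv, e100, e4] at hb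
      refine (Runs.iset ?_).mono (by omega : 1 ≤ _)
      exact .inr ⟨i, by omega, by simp [Store.setNat, IExpr.eval, hv], hb⟩
    · intro hb
      simp only [Test.Holds, var_eval, IExpr.eval, hv, e100, e4] at hb
      have hs6 : ∀ a, ((s'.setNat 99 0 0 0).setNat 101 0 0 a).nat 6 0 0 = s'.nat 6 0 0 := fun a => by
        simp [Store.setNat]
      rw [hs6]
      rcases hI with ⟨h6, hI⟩ | ⟨c, hc, hI⟩
      · refine .inl ⟨h6, fun c hc => ?_⟩
        rcases Nat.lt_succ_iff_lt_or_eq.1 hc with hc | rfl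
        · exact hI c hc
        · omega
      · exact .inr ⟨c, by omega, hI⟩
  · intro s2 hf2 h2
    have f2 : ∀ x, x ∈ [0, 4, 5, 100] → s2.nat x = s.nat x := fun x hx => by
      rw [hf2.nat x (by revert x; decide), hs1' x (by rintro rfl; revert hx; decide)]
    have e4 : s2.nat 4 = s.nat 4 := f2 4 (by decide)
    have e5 : s2.nat 5 = s.nat 5 := f2 5 (by decide)
    have e0 : s2.nat 0 = s.nat 0 := f2 0 (by decide)
    have e100 : s2.nat 100 = s.nat 100 := f2 100 (by decide)
    refine Runs.when ?_ ?_
    · intro hb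
      simp only [Test.Holds, var_eval, IExpr.eval] at hb
      rcases h2 with ⟨h6, -⟩ | ⟨c, hc, h6, hpos⟩
      · omega
      refine (Runs.seq (Runs.iset ?_)).mono (Nat.le_succ _)
      set s3 := s2.setNat 5 _ _ _ with hs3
      have hs3' : ∀ x, x ≠ 5 → s3.nat x = s2.nat x := fun x hx => s2.setNat_nat_ne _ _ _ hx
      refine (eliminate_runs (n := n) (m := m) (ρ := ρ) (j := c) (by simp [hs3', e0, hn])
        (by simp [hs3', e0, hm]) (by simp [hs3', e100, hρ]) (by simp [hs3', h6])).imp ?_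
      intro s4 hf4 h4
      have e5' : (fun j => s4.nat 5 j 0) = Function.update (fun j => s.nat 5 j 0) c (ρ + 1) := by
        funext j
        rw [hf4.nat 5 (by decide), hs3]
        simp only [Store.setNat, IExpr.eval, var_eval, h6, e5, e100, hρ, Function.update_apply]
        simp
      have e4' : s4.nat 4 = Gauss.elim (n + n) (m + (n + n)) (s.nat 4) ρ c := by
        funext r c'
        rw [h4, hs3' 4 (by decide), e4]
      rw [e4', e5']
      exact h.step hρn hc hpos
    · intro hb
      simp only [Test.Holds, var_eval, IExpr.eval] at hb
      rcases h2 with ⟨h6, hz⟩ | ⟨c, hc, h6, hpos⟩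
      · have e4' : (s2.setNat 99 0 0 0).nat 4 = s.nat 4 := by
          rw [Store.setNat_nat_ne _ _ _ _ (by decide), e4]
        have e5' : (s2.setNat 99 0 0 0).nat 5 = s.nat 5 := by
          rw [Store.setNat_nat_ne _ _ _ _ (by decide), e5]
        rw [e4', e5']
        exact h.skip hz
      · omega

def gaussCost {R : Type*} [Semiring R] (n m : R) : R :=
  ((m * ((n * ((1 + 1) + 2) + 2) + 2) + 2) + ((n + n) * (1 + 2) + 2)) +
    ((n + n) * (pivotStepCost n m + 2) + 2)

theorem gauss_runs {s : Store} {n m : ℕ} (hn : s.nat 0 0 0 = n)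
    (hm : s.nat 0 0 1 = m) (h4 : ∀ r c, s.nat 4 r c = 0) (h5 : ∀ j, s.nat 5 j 0 = 0)
    (hX : ∀ i l, s.nat 1 i l ≤ 1) (hZ : ∀ i l, s.nat 2 i l ≤ 1) :
    Runs gauss s (gaussCost n m) fun s' =>
      Gauss.Reduced (n + n) m (fun r c => if r < n then s.nat 1 c r else s.nat 2 c (r - n)) (n + n)
        (s'.nat 4) (fun j => s'.nat 5 j 0) := by
  refine Runs.seq_of (loadMatrix_runs hn hm h4) ?_
  intro s1 hf1 h1
  have e0 : s1.nat 0 = s.nat 0 := hf1.nat 0 (by decide)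
  have e5 : s1.nat 5 = s.nat 5 := hf1.nat 5 (by decide)
  refine Runs.for_loop (fun i s' => Gauss.Reduced (n + n) m
      (fun r c => if r < n then s.nat 1 c r else s.nat 2 c (r - n)) i
        (s'.nat 4) (fun j => s'.nat 5 j 0)) (by decide) (fun s' hf => by
          simp [rE, nE, IExpr.eval, hf.nat 0 (by decide), e0, hn]) ?_ ?_
  · have e4' : (s1.setNat 100 0 0 0).nat 4 = initialEntry n m (s.nat 1) (s.nat 2) := by
      rw [Store.setNat_nat_ne _ _ _ _ (by decide)]; funext r c; exact h1 r c
    have e5' : (fun j => (s1.setNat 100 0 0 0).nat 5 j 0) = 0 := by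
      funext j; rw [Store.setNat_nat_ne _ _ _ _ (by decide), e5]; exact h5 j
    rw [e4', e5']
    refine Gauss.Reduced.init (fun r c => ?_) (fun r hr c hc => ?_) (fun r hr r' hr' => ?_)
    · have := hX c r; have := hZ c (r - n)
      unfold initialEntry; split_ifs <;> omega
    · simp only [initialEntry, hc, hr, if_true]; split_ifs <;> rfl
    · simp only [initialEntry]; grind
  · intro i s' hi hf hv hI
    have e0' : s'.nat 0 = s.nat 0 := by rw [hf.nat 0 (by decide), e0]
    refine (pivotStep_runs (by rw [e0', hn]) (by rw [e0', hm]) hv hi hI).imp ?_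
    intro s'' _ h
    rwa [Store.setNat_nat_ne _ _ _ _ (by decide), Store.setNat_nat_ne _ _ _ _ (by decide)]

end Compiler

/-! ## The program: relations between the terms, and their phases -/

namespace Compiler

/-- `neE e e'` tests `e ≠ e'`. -/
def neE (e e' : IExpr) : Test := .neg (.conj (.neg (.ilt e e')) (.neg (.ilt e' e)))

theorem neE_holds {e e' : IExpr} {s : Store} : (neE e e').Holds s ↔ e.eval s ≠ e'.eval s := by
  simp only [neE, Test.Holds]; omega

/-- `posE e` tests `0 < e`. -/
def posE (e : IExpr) : Test := .ilt (.lit 0) e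

theorem posE_holds {e : IExpr} {s : Store} : (posE e).Holds s ↔ 0 < e.eval s := Iff.rfl

/-- Compute the relations between dependent and pivot columns in array `10`. -/
def relations : Prog :=
  .for 100 mE (.for 101 mE (.cond (neE (var 101) (var 100))
    (.cond (.conj (posE (.get 5 (var 101) (.lit 0)))
        (posE (.get 4 (.sub (.get 5 (var 101) (.lit 0)) (.lit 1)) (var 100))))
      (.iset 10 (var 100) (var 101) (.lit 1)) (.iset 10 (var 100) (var 101) (.lit 0)))
    (.iset 10 (var 100) (var 101) (.lit 1))))

theorem relations_runs {s : Store} {m : ℕ} (hm : s.nat 0 0 1 = m) :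
    Runs relations s (m * ((m * ((1 + 1 + 1) + 2) + 2) + 2) + 2) fun s' => ∀ j < m, ∀ i < m,
      s'.nat 10 j i = Gauss.rel (s.nat 4) (fun i => s.nat 5 i 0) j i := by
  refine Runs.for_loop (fun k s' => ∀ j < k, ∀ i < m,
      s'.nat 10 j i = Gauss.rel (s.nat 4) (fun i => s.nat 5 i 0) j i) (by decide)
      (fun s' hf => by simp [mE, IExpr.eval, hf.nat 0 (by decide), hm]) (by simp) ?_
  intro k s' hk hf hv hI
  refine Runs.for_loop (N := m) (fun l s' => ∀ j i, (j < k ∧ i < m) ∨ (j = k ∧ i < l) →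
      s'.nat 10 j i = Gauss.rel (s.nat 4) (fun i => s.nat 5 i 0) j i) (by decide)
      (fun s' hf' => by simp [mE, IExpr.eval, hf'.nat 0 (by decide), hf.nat 0 (by decide), hm])
      ?_ ?_ |>.imp ?_
  · rintro j i (⟨h1, h2⟩ | ⟨-, h⟩)
    · rw [Store.setNat_nat_ne _ _ _ _ (by decide), hI j h1 i h2]
    · omega
  · intro l s'' hl hf' hv' hI'
    have e4 : s''.nat 4 = s.nat 4 := by rw [hf'.nat 4 (by decide), hf.nat 4 (by decide)]
    have e5 : s''.nat 5 = s.nat 5 := by rw [hf'.nat 5 (by decide), hf.nat 5 (by decide)]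
    have e100 : s''.nat 100 0 0 = k := by rw [hf'.nat 100 (by decide), hv]
    have hset : ∀ v, v = Gauss.rel (s.nat 4) (fun i => s.nat 5 i 0) k l →
        ∀ j i, (j < k ∧ i < m) ∨ (j = k ∧ i < l + 1) →
        ((s''.setNat 10 k l v).setNat 101 0 0 (l + 1)).nat 10 j i =
          Gauss.rel (s.nat 4) (fun i => s.nat 5 i 0) j i := by
      intro v hveq j i hji
      rw [Store.setNat_nat_ne _ _ _ _ (by decide)]
      by_cases h : j = k ∧ i = l
      · obtain ⟨rfl, rfl⟩ := h
        simp [Store.setNat, hveq]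
      · have : (s''.setNat 10 k l v).nat 10 j i = s''.nat 10 j i := by simp [Store.setNat, h]
        rw [this]
        exact hI' j i (by omega)
    refine Runs.cond (fun hne => Runs.cond (fun hp => Runs.iset ?_) fun hp => Runs.iset ?_)
      fun hne => (Runs.iset ?_).mono (by omega)
    all_goals
      simp only [IExpr.eval, var_eval, e100, hv']
      apply hset
      simp only [neE_holds, var_eval, e100, hv'] at hne
      try simp only [Test.Holds, posE_holds, var_eval, IExpr.eval, e100, hv', e4, e5] at hp
      simp only [Gauss.rel]
      grind
  · intro s'' _ h j hj i hi
    rw [Store.setNat_nat_ne _ _ _ _ (by decide)]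
    exact h j i (by omega)

/-- The contribution of the signs to the phase of a product of terms, as a power of `i`. -/
def signPhase (D sg : ℕ → ℕ) (k : ℕ) : ℕ :=
  ∑ i ∈ Finset.range k, if 0 < D i ∧ 0 < sg i then 2 else 0

/-- The bit at one qubit after the first `k` of the selected Pauli operators, applied to `|0⟩`. -/
def bitAfter (D X : ℕ → ℕ) : ℕ → ℕ
  | 0 => 0
  | k + 1 => if 0 < D k ∧ 0 < X k then 1 - bitAfter D X k else bitAfter D X k

/-- The phase acquired at one qubit under the first `k` of the selected Pauli operators. -/
def qubitPhase (D X Z : ℕ → ℕ) (k : ℕ) : ℕ :=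
  ∑ i ∈ Finset.range k, if 0 < D i ∧ 0 < Z i then X i + 2 * bitAfter D X i else 0

theorem bitAfter_le_one (D X : ℕ → ℕ) (k : ℕ) : bitAfter D X k ≤ 1 := by
  induction k with
  | zero => simp [bitAfter]
  | succ k ih => simp only [bitAfter]; split_ifs <;> omega

/-- The phase of the product of the selected terms, as a power of `i`. -/
def totalPhase (n m : ℕ) (D : ℕ → ℕ) (X Z : ℕ → ℕ → ℕ) (sg : ℕ → ℕ) : ℕ :=
  signPhase D sg m + ∑ l ∈ Finset.range n, qubitPhase D (fun i => X i l) (fun i => Z i l) m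

/-- Add `e` to the phase of relation `100`, modulo `4`. -/
def addPhase (e : IExpr) : Prog :=
  .seq (.iset 12 (var 100) (.lit 0) (.add (.get 12 (var 100) (.lit 0)) e))
    (.when (.ilt (.lit 3) (.get 12 (var 100) (.lit 0)))
      (.iset 12 (var 100) (.lit 0) (.sub (.get 12 (var 100) (.lit 0)) (.lit 4))))

/-- Residue and increment are at most `3`, so one conditional subtraction of `4` replaces the
division that integer expressions lack. -/
theorem addPhase_runs {e : IExpr} {s : Store} {a : ℕ}
    (ha : s.nat 12 (s.nat 100 0 0) 0 = a % 4) (he : e.eval s ≤ 3) :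
    Runs (addPhase e) s 4 fun s' => ∀ i j, s'.nat 12 i j =
      if i = s.nat 100 0 0 ∧ j = 0 then (a + e.eval s) % 4 else s.nat 12 i j := by
  refine Runs.seq (T := 1) (T' := 3) (Runs.iset ?_)
  obtain ⟨s1, hs1⟩ : ∃ s1, s1 = s.setNat 12 (s.nat 100 0 0) 0 (a % 4 + e.eval s) := ⟨_, rfl⟩
  simp only [IExpr.eval, var_eval, ha, ← hs1]
  have e100 : s1.nat 100 = s.nat 100 := by rw [hs1, Store.setNat_nat_ne _ _ _ _ (by decide)]
  have e12 : ∀ i j, s1.nat 12 i j = if i = s.nat 100 0 0 ∧ j = 0 then a % 4 + e.eval s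
      else s.nat 12 i j := fun i j => by simp [hs1, Store.setNat]
  refine Runs.when (T := 1) (fun hb => (Runs.iset ?_).mono (by omega)) fun hb => ?_
  · intro i j
    simp only [Test.Holds, IExpr.eval, var_eval, e100, e12] at hb
    simp only [Store.setNat, IExpr.eval, var_eval, e100, e12]
    grind
  · intro i j
    simp only [Test.Holds, IExpr.eval, var_eval, e100, e12] at hb
    rw [Store.setNat_nat_ne _ _ _ _ (by decide), e12]
    grind

/-- Account for the signs in the phase of relation `100`. -/
def signPhases : Prog :=
  .for 101 mE (.when (.conj (posE (.get 10 (var 100) (var 101))) (posE (.get 3 (var 101) (.lit 0))))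
    (addPhase (.lit 2)))

theorem signPhases_runs {s : Store} {m j : ℕ} (hm : s.nat 0 0 1 = m) (hj : s.nat 100 0 0 = j)
    (h0 : s.nat 12 j 0 = 0) :
    Runs signPhases s (m * ((3 + 2) + 2) + 2) fun s' => ∀ i l, s'.nat 12 i l =
      if i = j ∧ l = 0 then signPhase (s.nat 10 j) (fun i => s.nat 3 i 0) m % 4
        else s.nat 12 i l := by
  refine Runs.for_loop (fun k s' => ∀ i l, s'.nat 12 i l =
      if i = j ∧ l = 0 then signPhase (s.nat 10 j) (fun i => s.nat 3 i 0) k % 4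
        else s.nat 12 i l) (by decide)
      (fun s' hf => by simp [mE, IExpr.eval, hf.nat 0 (by decide), hm]) ?_ ?_
  · intro i l
    rw [Store.setNat_nat_ne _ _ _ _ (by decide)]
    simp only [signPhase, Finset.range_zero, Finset.sum_empty]
    grind
  · intro k s' hk hf hv hI
    have e100 : s'.nat 100 0 0 = j := by rw [hf.nat 100 (by decide), hj]
    have e10 : s'.nat 10 = s.nat 10 := hf.nat 10 (by decide)
    have e3 : s'.nat 3 = s.nat 3 := hf.nat 3 (by decide)
    refine Runs.when (fun hb => ?_) (fun hb => ?_)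
    · simp only [Test.Holds, posE_holds, IExpr.eval, var_eval, e100, e10, e3, hv] at hb
      refine (addPhase_runs (a := signPhase (s.nat 10 j) (fun i => s.nat 3 i 0) k)
        (by rw [e100, hI]; simp) (by simp [IExpr.eval])).imp ?_
      intro s'' _ h i l
      rw [Store.setNat_nat_ne _ _ _ _ (by decide), h, hI, e100]
      simp only [signPhase, Finset.sum_range_succ, IExpr.eval]
      grind
    · simp only [Test.Holds, posE_holds, IExpr.eval, var_eval, e100, e10, e3, hv] at hb
      intro i l
      rw [Store.setNat_nat_ne _ _ _ _ (by decide), Store.setNat_nat_ne _ _ _ _ (by decide), hI]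
      simp only [signPhase, Finset.sum_range_succ]
      grind

/-- Account for the Pauli operators at qubit `101` in the phase of relation `100`. -/
def qubitPhases : Prog :=
  .for 102 mE (.when (posE (.get 10 (var 100) (var 102)))
    (.seq (.when (posE (.get 2 (var 102) (var 101)))
        (addPhase (.add (.get 1 (var 102) (var 101)) (.add (.get 11 (var 100) (var 101))
          (.get 11 (var 100) (var 101))))))
      (.when (posE (.get 1 (var 102) (var 101)))
        (.iset 11 (var 100) (var 101) (.sub (.lit 1) (.get 11 (var 100) (var 101)))))))

/-- On `|b⟩` a Pauli operator with bits `x`, `z` produces the phase `i ^ (z * (x + 2b))` and adds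
`x` to `b`. Array `11` holds the current bit, starting from `0`; each pair of a relation and a qubit
has its own cell, so nothing needs to be reset. -/
theorem qubitPhases_runs {s : Store} {m j l a : ℕ} (hm : s.nat 0 0 1 = m)
    (hj : s.nat 100 0 0 = j) (hl : s.nat 101 0 0 = l) (h12 : s.nat 12 j 0 = a % 4)
    (h11 : s.nat 11 j l = 0) (hX : ∀ i l, s.nat 1 i l ≤ 1) :
    Runs qubitPhases s (m * ((7 + 2) + 2) + 2) fun s' => (∀ i k, s'.nat 12 i k =
      if i = j ∧ k = 0 then
        (a + qubitPhase (s.nat 10 j) (fun i => s.nat 1 i l) (fun i => s.nat 2 i l) m) % 4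
        else s.nat 12 i k) ∧ ∀ i k, (i, k) ≠ (j, l) → s'.nat 11 i k = s.nat 11 i k := by
  refine Runs.for_loop (fun r s' => (∀ i k, s'.nat 12 i k =
      if i = j ∧ k = 0 then
        (a + qubitPhase (s.nat 10 j) (fun i => s.nat 1 i l) (fun i => s.nat 2 i l) r) % 4
        else s.nat 12 i k) ∧
      ∀ i k, s'.nat 11 i k = if i = j ∧ k = l then bitAfter (s.nat 10 j) (fun i => s.nat 1 i l) r
        else s.nat 11 i k) (by decide)
      (fun s' hf => by simp [mE, IExpr.eval, hf.nat 0 (by decide), hm]) ?_ ?_ |>.imp ?_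
  · refine ⟨fun i k => ?_, fun i k => ?_⟩ <;>
      rw [Store.setNat_nat_ne _ _ _ _ (by decide)] <;>
      simp only [qubitPhase, bitAfter, Finset.range_zero, Finset.sum_empty] <;> grind
  · intro r s' hr hf hv ⟨hI, hI'⟩
    have e100 : s'.nat 100 0 0 = j := by rw [hf.nat 100 (by decide), hj]
    have e101 : s'.nat 101 0 0 = l := by rw [hf.nat 101 (by decide), hl]
    have e10 : s'.nat 10 = s.nat 10 := hf.nat 10 (by decide)
    have e1 : s'.nat 1 = s.nat 1 := hf.nat 1 (by decide)
    have e2 : s'.nat 2 = s.nat 2 := hf.nat 2 (by decide)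
    have hb1 := bitAfter_le_one (s.nat 10 j) (fun i => s.nat 1 i l) r
    have hX1 := hX r l
    have hbit : s'.nat 11 j l = bitAfter (s.nat 10 j) (fun i => s.nat 1 i l) r := by
      rw [hI', if_pos ⟨rfl, rfl⟩]
    refine Runs.when (fun hb => ?_) (fun hb => ?_)
    · simp only [posE_holds, IExpr.eval, var_eval, e100, e10, hv] at hb
      -- The phase is updated before the bit, because it refers to the basis state on which the
      -- operator acts.
      refine (Runs.seq_of (T := 3 + 2) (T' := 1 + 2) (R := fun s1 => ∀ i k, s1.nat 12 i k =
        if i = j ∧ k = 0 then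
        (a + qubitPhase (s.nat 10 j) (fun i => s.nat 1 i l) (fun i => s.nat 2 i l) (r + 1)) % 4
        else s.nat 12 i k) ?_ ?_)
      · refine Runs.when (fun hz => ?_) (fun hz => ?_)
        · simp only [posE_holds, IExpr.eval, var_eval, e101, e2, hv] at hz
          refine (addPhase_runs
            (a := a + qubitPhase (s.nat 10 j) (fun i => s.nat 1 i l) (fun i => s.nat 2 i l) r)
            (by rw [e100, hI]; simp) ?_).imp ?_
          · simp only [IExpr.eval, var_eval, e100, e101, hv, hbit, e1]; omega
          · intro s1 _ h i k
            rw [h, hI, e100]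
            simp only [qubitPhase, Finset.sum_range_succ, IExpr.eval, var_eval, e100, e101, hv,
              hbit, e1, hb, hz, and_self, if_true]
            grind
        · simp only [posE_holds, IExpr.eval, var_eval, e101, e2, hv] at hz
          intro i k
          rw [Store.setNat_nat_ne _ _ _ _ (by decide), hI]
          simp only [qubitPhase, Finset.sum_range_succ, hz, and_false, if_false, add_zero]
      · intro s1 hf1 h1
        have f1 : ∀ x, x ∈ [1, 11, 100, 101, 102] → s1.nat x = s'.nat x := fun x hx =>
          hf1.nat x (by revert x; decide)
        refine Runs.when (fun hx => (Runs.iset ?_).mono (by omega)) (fun hx => ?_)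
        · simp only [posE_holds, IExpr.eval, var_eval, f1 1 (by decide), f1 101 (by decide),
            f1 102 (by decide), e101, e1, hv] at hx
          refine ⟨fun i k => ?_, fun i k => ?_⟩
          · rw [Store.setNat_nat_ne _ _ _ _ (by decide), Store.setNat_nat_ne _ _ _ _ (by decide),
              h1]
          · rw [Store.setNat_nat_ne _ _ _ _ (by decide)]
            simp only [Store.setNat, IExpr.eval, var_eval, f1 100 (by decide), f1 101 (by decide),
              f1 11 (by decide), e100, e101, hI', bitAfter, hb, hx]
            grind
        · simp only [posE_holds, IExpr.eval, var_eval, f1 1 (by decide), f1 101 (by decide),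
            f1 102 (by decide), e101, e1, hv] at hx
          refine ⟨fun i k => ?_, fun i k => ?_⟩
          · rw [Store.setNat_nat_ne _ _ _ _ (by decide), Store.setNat_nat_ne _ _ _ _ (by decide),
              h1]
          · rw [Store.setNat_nat_ne _ _ _ _ (by decide), Store.setNat_nat_ne _ _ _ _ (by decide),
              f1 11 (by decide), hI']
            simp only [bitAfter, hx, and_false, if_false]
    · simp only [posE_holds, IExpr.eval, var_eval, e100, e10, hv] at hb
      refine ⟨fun i k => ?_, fun i k => ?_⟩ <;>
        rw [Store.setNat_nat_ne _ _ _ _ (by decide), Store.setNat_nat_ne _ _ _ _ (by decide)]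
      · rw [hI]; simp only [qubitPhase, Finset.sum_range_succ, hb, false_and, if_false, add_zero]
      · rw [hI']; simp only [bitAfter, hb, false_and, if_false]
  · rintro s' _ ⟨h, h'⟩
    refine ⟨h, fun i k hik => ?_⟩
    rw [h', if_neg]
    rintro ⟨rfl, rfl⟩
    exact hik rfl

/-- The phases of all relations, as powers of `i`, in array `12`. -/
def phases : Prog := .for 100 mE (.seq signPhases (.for 101 nE qubitPhases))

def phasesCost {R : Type*} [Semiring R] (n m : R) : R :=
  m * (((m * ((3 + 2) + 2) + 2) + (n * ((m * ((7 + 2) + 2) + 2) + 2) + 2)) + 2) + 2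

theorem phases_runs {s : Store} {n m : ℕ} (hn : s.nat 0 0 0 = n) (hm : s.nat 0 0 1 = m)
    (h12 : ∀ j, s.nat 12 j 0 = 0) (h11 : ∀ j l, s.nat 11 j l = 0)
    (hX : ∀ i l, s.nat 1 i l ≤ 1) :
    Runs phases s (phasesCost n m) fun s' => ∀ j < m, s'.nat 12 j 0 =
      totalPhase n m (s.nat 10 j) (s.nat 1) (s.nat 2) (fun i => s.nat 3 i 0) % 4 := by
  refine Runs.for_loop (fun k s' => (∀ j < k, s'.nat 12 j 0 =
      totalPhase n m (s.nat 10 j) (s.nat 1) (s.nat 2) (fun i => s.nat 3 i 0) % 4) ∧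
      ∀ j, k ≤ j → s'.nat 12 j 0 = 0 ∧ ∀ l, s'.nat 11 j l = 0) (by decide)
      (fun s' hf => by simp [mE, IExpr.eval, hf.nat 0 (by decide), hm]) ?_ ?_ |>.imp ?_
  · simp [Store.setNat, h11, h12]
  · rintro k s' hk hf hv ⟨hI, hI'⟩
    have e0 : s'.nat 0 = s.nat 0 := hf.nat 0 (by decide)
    have e1 : s'.nat 1 = s.nat 1 := hf.nat 1 (by decide)
    have e2 : s'.nat 2 = s.nat 2 := hf.nat 2 (by decide)
    have e3 : s'.nat 3 = s.nat 3 := hf.nat 3 (by decide)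
    have e10 : s'.nat 10 = s.nat 10 := hf.nat 10 (by decide)
    refine Runs.seq_of (signPhases_runs (m := m) (j := k) (by rw [e0, hm]) hv (hI' k le_rfl).1) ?_
    intro s1 hf1 h1
    rw [e10, e3] at h1
    have f1 : ∀ x, x ∈ [0, 1, 2, 10, 11, 100] → s1.nat x = s'.nat x := fun x hx =>
      hf1.nat x (by revert x; decide)
    refine Runs.for_loop (N := n) (fun r s2 => (∀ i, s2.nat 12 i 0 =
      if i = k then (signPhase (s.nat 10 k) (fun i => s.nat 3 i 0) m + ∑ l ∈ Finset.range r,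
        qubitPhase (s.nat 10 k) (fun i => s.nat 1 i l) (fun i => s.nat 2 i l) m) % 4
        else s'.nat 12 i 0) ∧ ∀ j l, k < j ∨ (j = k ∧ r ≤ l) → s2.nat 11 j l = 0) (by decide)
      (fun s2 hf2 => by simp [nE, IExpr.eval, hf2.nat 0 (by decide), f1, e0, hn]) ?_ ?_ |>.imp ?_
    · refine ⟨fun i => ?_, fun j l hjl => ?_⟩ <;> rw [Store.setNat_nat_ne _ _ _ _ (by decide)]
      · rw [h1]; simp
      · rw [f1 11 (by decide), (hI' j (by omega)).2]
    · rintro r s2 hr hf2 hv2 ⟨h12', h11'⟩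
      have f2 : ∀ x, x ∈ [0, 1, 2, 10, 100] → s2.nat x = s'.nat x := fun x hx => by
        rw [hf2.nat x (by revert x; decide), f1 x (by revert x; decide)]
      refine (qubitPhases_runs (j := k) (m := m) (l := r)
        (by rw [f2 0 (by decide), e0, hm]) (by rw [f2 100 (by decide), hv])
        hv2 (by rw [h12', if_pos rfl]) (h11' k r (by omega))
        (by rw [f2 1 (by decide), e1]; exact hX)).imp ?_
      rintro s3 _ ⟨h3, h3'⟩
      rw [f2 10 (by decide), f2 1 (by decide), f2 2 (by decide), e10, e1, e2] at h3
      refine ⟨fun i => ?_, fun j l hjl => ?_⟩ <;> rw [Store.setNat_nat_ne _ _ _ _ (by decide)]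
      · rw [h3, h12' i, Finset.sum_range_succ]
        grind
      · rw [h3' j l (by simp only [ne_eq, Prod.mk.injEq]; omega), h11' j l (by omega)]
    · rintro s2 _ ⟨h12', h11'⟩
      refine ⟨fun j hj => ?_, fun j hj => ⟨?_, fun l => ?_⟩⟩ <;>
        rw [Store.setNat_nat_ne _ _ _ _ (by decide)]
      · rw [h12']
        by_cases hjk : j = k
        · subst hjk; rw [if_pos rfl]; rfl
        · rw [if_neg hjk, hI j (by omega)]
      · rw [h12', if_neg (by omega), (hI' j (by omega)).1]
      · exact h11' j l (by omega)
  · exact fun s' _ h => h.1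

end Compiler

/-! ## The automaton that computes the energy of an eigenvector -/

/-- A finite automaton that reads the bits of `z` in any order; the state after reading `z` is
`cod z`, and a bit `0` does not change the state. In the final state, the weight `wt z` is known. -/
structure Trellis (m N : ℕ) (tr : ℕ → ℕ → ℕ) (off : ℕ → ℕ) (cod wt : (Fin m → ZMod 2) → ℕ) :
    Prop where
  tr_lt : ∀ i < m, ∀ q < N, tr i q < N
  cod_lt : ∀ z, cod z < N
  cod_zero : cod 0 = 0
  step : ∀ z (i : Fin m), z i = 0 → tr i (cod z) = cod (z + Pi.single i 1)
  off_cod : ∀ z, off (cod z) = wt z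

namespace Trellis

variable {m : ℕ}

theorem sum_val_add_single {z : Fin m → ZMod 2} {i : Fin m} (hz : z i = 0) :
    ∑ j, ((z + Pi.single i 1 : Fin m → ZMod 2) j).val = ∑ j, (z j).val + 1 := by
  rw [← Finset.add_sum_erase _ _ (Finset.mem_univ i), ← Finset.add_sum_erase (a := i) _
    (fun j => (z j).val) (Finset.mem_univ i)]
  have : ∑ j ∈ Finset.univ.erase i, ((z + Pi.single i 1 : Fin m → ZMod 2) j).val =
      ∑ j ∈ Finset.univ.erase i, (z j).val :=
    Finset.sum_congr rfl fun j hj => by simp [Finset.ne_of_mem_erase hj]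
  rw [this]
  simp [hz, ZMod.val_one]
  omega

theorem sum_val_le (z : Fin m → ZMod 2) : ∑ j, (z j).val ≤ m := by
  refine (Finset.sum_le_sum fun j _ => Nat.lt_succ_iff.1 (ZMod.val_lt (z j))).trans ?_
  simp

/-- The transition out of state `m` is an empty cell. `step` never uses it: as long as some bit is
`0`, fewer than `m` ones have been counted. -/
theorem init {tr : ℕ → ℕ → ℕ} {off : ℕ → ℕ} (h1 : ∀ i < m, ∀ q < m, tr i q = q + 1)
    (h2 : ∀ i < m, tr i m = 0) (h3 : ∀ q ≤ m, off q = q) :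
    Trellis m (m + 1) tr off (fun z => ∑ j, (z j).val) (fun z => ∑ j, (z j).val) where
  tr_lt i hi q hq := by
    rcases Nat.lt_succ_iff_lt_or_eq.1 hq with h | rfl
    · rw [h1 i hi q h]; omega
    · rw [h2 i hi]; omega
  cod_lt z := Nat.lt_succ_iff.2 (sum_val_le z)
  cod_zero := by simp
  step z i hz := by
    have := sum_val_le (z + Pi.single i 1)
    rw [sum_val_add_single hz] at this ⊢
    rw [h1 i i.2 _ (by omega)]
  off_cod z := h3 _ (sum_val_le z)

/-- This is the product with a parity bit: `q` stands for the old state with even parity, `q + N`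
for odd parity. The constant `ε` enters only the final weight, so the initial state is still `0`. -/
theorem double {N ε : ℕ} {tr tr' : ℕ → ℕ → ℕ} {off off' : ℕ → ℕ} {cod wt : (Fin m → ZMod 2) → ℕ}
    {d : ℕ → ℕ} (h : Trellis m N tr off cod wt) (hd : ∀ i < m, d i ≤ 1) (hε : ε ≤ 1)
    (h1 : ∀ i < m, ∀ q < N, tr' i q = if 0 < d i then tr i q + N else tr i q)
    (h2 : ∀ i < m, ∀ q < N, tr' i (q + N) = if 0 < d i then tr i q else tr i q + N)
    (h3 : ∀ q < N, off' q = if 0 < ε then off q + 1 else off q)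
    (h4 : ∀ q < N, off' (q + N) = if 0 < ε then off q else off q + 1) :
    Trellis m (N + N) tr' off' (fun z => cod z + (∑ i : Fin m, (d i : ZMod 2) * z i).val * N)
      (fun z => wt z + ((ε : ZMod 2) + ∑ i : Fin m, (d i : ZMod 2) * z i).val) where
  tr_lt i hi q hq := by
    by_cases hqN : q < N
    · have := h.tr_lt i hi q hqN
      rw [h1 i hi q hqN]; split_ifs <;> omega
    · obtain ⟨q, rfl⟩ := Nat.exists_eq_add_of_le' (not_lt.1 hqN)
      have := h.tr_lt i hi q (by omega)
      rw [h2 i hi q (by omega)]; split_ifs <;> omega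
  cod_lt z := by
    have h1 := h.cod_lt z
    have h2 : (∑ i : Fin m, (d i : ZMod 2) * z i).val < 2 := ZMod.val_lt _
    generalize (∑ i : Fin m, (d i : ZMod 2) * z i).val = b at h2
    interval_cases b <;> omega
  cod_zero := by simp [h.cod_zero]
  step z i hz := by
    have hs : ∑ j : Fin m, (d j : ZMod 2) * (z + Pi.single i 1 : Fin m → ZMod 2) j =
        ∑ j : Fin m, (d j : ZMod 2) * z j + d i := by
      simp [mul_add, Finset.sum_add_distrib, Pi.single_apply]
    have hst := h.step z i hz
    have hlt := h.cod_lt z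
    have hdi := hd i i.2
    have hb : ∀ b : ZMod 2, b = 0 ∨ b = 1 := by decide
    have e11 : (1 : ZMod 2) + 1 = 0 := by decide
    simp only [hs]
    rcases Nat.le_one_iff_eq_zero_or_eq_one.1 hdi with hd0 | hd0 <;>
      rcases hb (∑ j : Fin m, (d j : ZMod 2) * z j) with hp | hp <;>
      simp [hp, hd0, ZMod.val_one, h1 i i.2 _ hlt, h2 i i.2 _ hlt, hst, e11]
  off_cod z := by
    have hlt := h.cod_lt z
    have hb : ∀ b : ZMod 2, b = 0 ∨ b = 1 := by decide
    have e11 : (1 : ZMod 2) + 1 = 0 := by decide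
    rcases Nat.le_one_iff_eq_zero_or_eq_one.1 hε with hd0 | hd0 <;>
      rcases hb (∑ j : Fin m, (d j : ZMod 2) * z j) with hp | hp <;>
      simp [hp, hd0, ZMod.val_one, h3 _ hlt, h4 _ hlt, h.off_cod, e11]

end Trellis

/-! ### Tables of the automaton, weights of completions, and numbering of the workspace -/

namespace Compiler

/-- The weight of `z` under all relations. -/
def weight (m : ℕ) (piv : ℕ → ℕ) (ph : ℕ → ℕ) (D : ℕ → ℕ → ℕ) (k : ℕ) (z : Fin m → ZMod 2) : ℕ :=
  ∑ i, (z i).val + ∑ j ∈ Finset.range k, if piv j = 0 then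
    (((if 0 < ph j then 1 else 0 : ℕ) : ZMod 2) + ∑ i : Fin m, (D j i : ZMod 2) * z i).val else 0

/-- The number of states after the relations for the first `k` columns have been processed. -/
def states (m : ℕ) (piv : ℕ → ℕ) (k : ℕ) : ℕ :=
  (m + 1) * 2 ^ ((Finset.range k).filter fun j => piv j = 0).card

/-- The automaton that counts the nonzero bits. -/
def countTrellis : Prog :=
  .seq (.for 100 mE (.for 101 mE (.iset 7 (var 100) (var 101) (.add (var 101) (.lit 1)))))
    (.seq (.for 100 (.add mE (.lit 1)) (.iset 8 (var 100) (.lit 0) (var 100)))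
      (.iset 9 (.lit 0) (.lit 0) (.add mE (.lit 1))))

def countTrellisCost {R : Type*} [Semiring R] (m : R) : R :=
  (m * ((m * (1 + 2) + 2) + 2) + 2) + (((m + 1) * (1 + 2) + 2) + 1)

theorem countTrellis_runs {s : Store} {m : ℕ} (hm : s.nat 0 0 1 = m)
    (h7 : ∀ i q, s.nat 7 i q = 0) :
    Runs countTrellis s (countTrellisCost m) fun s' => s'.nat 9 0 0 = m + 1 ∧
      Trellis m (m + 1) (s'.nat 7) (fun q => s'.nat 8 q 0) (fun z => ∑ j, (z j).val)
        (fun z => ∑ j, (z j).val) := by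
  refine Runs.seq_of (R := fun s' => ∀ i q, s'.nat 7 i q = if i < m ∧ q < m then q + 1 else 0)
    ?_ ?_
  · refine Runs.for_loop (fun k s' => ∀ i q, s'.nat 7 i q = if i < k ∧ q < m then q + 1 else 0)
      (by decide) (fun s' hf => by simp [mE, IExpr.eval, hf.nat 0 (by decide), hm])
      (by simp [Store.setNat, h7]) ?_
    intro k s' hk hf hv hI
    refine Runs.for_loop (N := m) (fun l s' => ∀ i q, s'.nat 7 i q =
      if (i < k ∧ q < m) ∨ (i = k ∧ q < l) then q + 1 else 0)
      (by decide) (fun s' hf' => by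
        simp [mE, IExpr.eval, hf'.nat 0 (by decide), hf.nat 0 (by decide), hm])
      (by simp [Store.setNat, hI]) ?_ |>.imp ?_
    · intro l s'' hl hf' hv' hI'
      have e100 : s''.nat 100 0 0 = k := by rw [hf'.nat 100 (by decide), hv]
      refine Runs.iset ?_
      intro i q
      simp only [Store.setNat, IExpr.eval, var_eval, e100, hv', hI']
      grind
    · intro s'' _ h i q
      rw [Store.setNat_nat_ne _ _ _ _ (by decide), h]
      grind
  · intro s1 hf1 h1
    have e0 : s1.nat 0 = s.nat 0 := hf1.nat 0 (by decide)
    refine Runs.seq_of (R := fun s' => ∀ q < m + 1, s'.nat 8 q 0 = q) ?_ ?_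
    · refine Runs.for_loop (fun k s' => ∀ q < k, s'.nat 8 q 0 = q)
        (by decide) (fun s' hf => by simp [mE, IExpr.eval, hf.nat 0 (by decide), e0, hm])
        (by simp) ?_
      intro k s' hk hf hv hI
      refine Runs.iset ?_
      intro q hq
      simp only [Store.setNat, IExpr.eval, var_eval, hv]
      grind
    · intro s2 hf2 h2
      refine Runs.iset ⟨by simp [Store.setNat, IExpr.eval, mE, hf2.nat 0 (by decide), e0, hm], ?_⟩
      refine Trellis.init ?_ ?_ ?_ <;>
        simp only [Store.setNat_nat_ne _ _ _ _ (by decide : 7 ≠ 9),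
          Store.setNat_nat_ne _ _ _ _ (by decide : 8 ≠ 9), hf2.nat 7 (by decide), h1]
      · grind
      · grind
      · intro q hq; exact h2 q (by omega)

/-- Extend the automaton by the parity of relation `100`. -/
def doubleTrellis : Prog :=
  .seq (.for 101 mE (.for 102 (var 9) (.cond (posE (.get 10 (var 100) (var 101)))
      (.seq (.iset 7 (var 101) (.add (var 102) (var 9)) (.get 7 (var 101) (var 102)))
        (.iset 7 (var 101) (var 102) (.add (.get 7 (var 101) (var 102)) (var 9))))
      (.iset 7 (var 101) (.add (var 102) (var 9)) (.add (.get 7 (var 101) (var 102)) (var 9))))))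
    (.seq (.for 102 (var 9) (.cond (posE (.get 12 (var 100) (.lit 0)))
      (.seq (.iset 8 (.add (var 102) (var 9)) (.lit 0) (.get 8 (var 102) (.lit 0)))
        (.iset 8 (var 102) (.lit 0) (.add (.get 8 (var 102) (.lit 0)) (.lit 1))))
      (.iset 8 (.add (var 102) (var 9)) (.lit 0) (.add (.get 8 (var 102) (.lit 0)) (.lit 1)))))
      (.iset 9 (.lit 0) (.lit 0) (.add (var 9) (var 9))))

def doubleTrellisCost {R : Type*} [Semiring R] (m N : R) : R :=
  (m * ((N * ((1 + 1 + 1) + 2) + 2) + 2) + 2) + ((N * ((1 + 1 + 1) + 2) + 2) + 1)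

theorem doubleTrellis_runs {s : Store} {m N j : ℕ} {cod wt : (Fin m → ZMod 2) → ℕ}
    (hm : s.nat 0 0 1 = m) (hN : s.nat 9 0 0 = N) (hj : s.nat 100 0 0 = j)
    (hD : ∀ i < m, s.nat 10 j i ≤ 1)
    (h : Trellis m N (s.nat 7) (fun q => s.nat 8 q 0) cod wt) :
    Runs doubleTrellis s (doubleTrellisCost m N) fun s' => s'.nat 9 0 0 = N + N ∧
      Trellis m (N + N) (s'.nat 7) (fun q => s'.nat 8 q 0)
        (fun z => cod z + (∑ i : Fin m, (s.nat 10 j i : ZMod 2) * z i).val * N)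
        (fun z => wt z + (((if 0 < s.nat 12 j 0 then 1 else 0 : ℕ) : ZMod 2) +
          ∑ i : Fin m, (s.nat 10 j i : ZMod 2) * z i).val) := by
  refine Runs.seq_of (R := fun s' => ∀ i < m, ∀ q < N,
    (s'.nat 7 i q = if 0 < s.nat 10 j i then s.nat 7 i q + N else s.nat 7 i q) ∧
    (s'.nat 7 i (q + N) = if 0 < s.nat 10 j i then s.nat 7 i q else s.nat 7 i q + N)) ?_ ?_
  · refine Runs.for_loop (fun k s' => (∀ i < k, ∀ q < N,
      (s'.nat 7 i q = if 0 < s.nat 10 j i then s.nat 7 i q + N else s.nat 7 i q) ∧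
      (s'.nat 7 i (q + N) = if 0 < s.nat 10 j i then s.nat 7 i q else s.nat 7 i q + N)) ∧
      ∀ i, k ≤ i → ∀ q < N, s'.nat 7 i q = s.nat 7 i q)
      (by decide) (fun s' hf => by simp [mE, IExpr.eval, hf.nat 0 (by decide), hm])
      (by simp [Store.setNat]) ?_ |>.imp (fun _ _ h => h.1)
    rintro k s' hk hf hv ⟨hI, hI'⟩
    refine Runs.for_loop (N := N) (fun l s' => ∀ i, ∀ q < N,
      (i < k ∨ (i = k ∧ q < l) →
        (s'.nat 7 i q = if 0 < s.nat 10 j i then s.nat 7 i q + N else s.nat 7 i q) ∧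
        (s'.nat 7 i (q + N) = if 0 < s.nat 10 j i then s.nat 7 i q else s.nat 7 i q + N)) ∧
      (¬ (i < k ∨ (i = k ∧ q < l)) → s'.nat 7 i q = s.nat 7 i q))
      (by decide) (fun s' hf' => by
        simp [hf'.nat 9 (by decide), hf.nat 9 (by decide), hN]) ?_ ?_ |>.imp ?_
    · intro i q hq
      rw [Store.setNat_nat_ne _ _ _ _ (by decide)]
      exact ⟨fun hik => hI i (by omega) q hq, fun hik => hI' i (by omega) q hq⟩
    · intro l s'' hl hf' hv' hI2
      have e9 : s''.nat 9 0 0 = N := by rw [hf'.nat 9 (by decide), hf.nat 9 (by decide), hN]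
      have e10 : s''.nat 10 = s.nat 10 := by rw [hf'.nat 10 (by decide), hf.nat 10 (by decide)]
      have e100 : s''.nat 100 0 0 = j := by rw [hf'.nat 100 (by decide), hf.nat 100 (by decide), hj]
      have e101 : s''.nat 101 0 0 = k := by rw [hf'.nat 101 (by decide), hv]
      have hkl := (hI2 k l hl).2 (by omega)
      -- The table is doubled in place. Both new entries depend on the old entry at `q`, so cell `q
      -- + N` is written before cell `q` is overwritten.
      refine Runs.cond (fun hb => Runs.seq (Runs.iset (Runs.iset ?_)))
        (fun hb => (Runs.iset ?_).mono (by omega)) <;>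
        simp only [posE_holds, IExpr.eval, var_eval, e10, e100, e101] at hb <;>
        intro i q hq <;> have := hI2 i q hq <;>
        rw [Store.setNat_nat_ne _ _ _ _ (by decide)] <;>
        simp only [Store.setNat, IExpr.eval, var_eval, e9, e101, hv', hkl] <;> grind
    · intro s'' _ h
      refine ⟨fun i hi q hq => ?_, fun i hi q hq => ?_⟩ <;>
        rw [Store.setNat_nat_ne _ _ _ _ (by decide)]
      · exact (h i q hq).1 (by omega)
      · exact (h i q hq).2 (by omega)
  · intro s1 hf1 h1
    have f1 : ∀ x, x ∈ [0, 8, 9, 10, 12, 100] → s1.nat x = s.nat x := fun x hx =>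
      hf1.nat x (by revert x; decide)
    refine Runs.seq_of (R := fun s' => ∀ q < N,
      (s'.nat 8 q 0 = if 0 < s.nat 12 j 0 then s.nat 8 q 0 + 1 else s.nat 8 q 0) ∧
      (s'.nat 8 (q + N) 0 = if 0 < s.nat 12 j 0 then s.nat 8 q 0 else s.nat 8 q 0 + 1)) ?_ ?_
    · refine Runs.for_loop (N := N) (fun l s' => ∀ q < N,
        (q < l →
          (s'.nat 8 q 0 = if 0 < s.nat 12 j 0 then s.nat 8 q 0 + 1 else s.nat 8 q 0) ∧
          (s'.nat 8 (q + N) 0 = if 0 < s.nat 12 j 0 then s.nat 8 q 0 else s.nat 8 q 0 + 1)) ∧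
        (¬ q < l → s'.nat 8 q 0 = s.nat 8 q 0))
        (by decide) (fun s' hf' => by
          simp [hf'.nat 9 (by decide), f1, hN]) ?_ ?_ |>.imp ?_
      · intro q hq
        rw [Store.setNat_nat_ne _ _ _ _ (by decide), f1 8 (by decide)]
        simp
      · intro l s'' hl hf' hv' hI2
        have e9 : s''.nat 9 0 0 = N := by rw [hf'.nat 9 (by decide), f1 9 (by decide), hN]
        have e12 : s''.nat 12 = s.nat 12 := by rw [hf'.nat 12 (by decide), f1 12 (by decide)]
        have e100 : s''.nat 100 0 0 = j := by rw [hf'.nat 100 (by decide), f1 100 (by decide), hj]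
        have hkl := (hI2 l hl).2 (by omega)
        refine Runs.cond (fun hb => Runs.seq (Runs.iset (Runs.iset ?_)))
          (fun hb => (Runs.iset ?_).mono (by omega)) <;>
          simp only [posE_holds, IExpr.eval, var_eval, e12, e100] at hb <;>
          intro q hq <;> have := hI2 q hq <;>
          rw [Store.setNat_nat_ne _ _ _ _ (by decide)] <;>
          simp only [Store.setNat, IExpr.eval, var_eval, e9, hv', hkl] <;> grind
      · exact fun s'' _ h q hq => (h q hq).1 hq
    · intro s2 hf2 h2
      refine Runs.iset ⟨?_, ?_⟩
      · simp [Store.setNat, IExpr.eval, hf2.nat 9 (by decide), f1, hN]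
      · rw [Store.setNat_nat_ne _ _ _ _ (by decide), Store.setNat_nat_ne _ _ _ _ (by decide),
          hf2.nat 7 (by decide)]
        exact h.double hD (by split_ifs <;> simp) (fun i hi q hq => (h1 i hi q hq).1)
          (fun i hi q hq => (h1 i hi q hq).2)
          (fun q hq => by rw [(h2 q hq).1]; split_ifs <;> simp_all)
          (fun q hq => by rw [(h2 q hq).2]; split_ifs <;> simp_all)

/-- The automaton that computes the weight under all relations. -/
def trellis : Prog :=
  .seq countTrellis (.for 100 mE (.when (.neg (posE (.get 5 (var 100) (.lit 0)))) doubleTrellis))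

def trellisCost {R : Type*} [Semiring R] (m N : R) : R :=
  countTrellisCost m + (m * ((doubleTrellisCost m N + 2) + 2) + 2)

theorem states_mono (m : ℕ) (piv : ℕ → ℕ) {k k' : ℕ} (h : k ≤ k') :
    states m piv k ≤ states m piv k' := by
  unfold states
  gcongr
  omega

theorem trellis_runs {s : Store} {m : ℕ} (hm : s.nat 0 0 1 = m) (h7 : ∀ i q, s.nat 7 i q = 0)
    (hD : ∀ j < m, ∀ i < m, s.nat 10 j i ≤ 1) :
    Runs trellis s (trellisCost m (states m (fun j => s.nat 5 j 0) m)) fun s' =>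
      s'.nat 9 0 0 = states m (fun j => s.nat 5 j 0) m ∧
      ∃ cod, Trellis m (states m (fun j => s.nat 5 j 0) m) (s'.nat 7) (fun q => s'.nat 8 q 0) cod
        (weight m (fun j => s.nat 5 j 0) (fun j => s.nat 12 j 0) (s.nat 10) m) := by
  refine Runs.seq_of (countTrellis_runs hm h7) ?_
  rintro s1 hf1 ⟨h9, h1⟩
  have f1 : ∀ x, x ∈ [0, 5, 10, 12] → s1.nat x = s.nat x := fun x hx =>
    hf1.nat x (by revert x; decide)
  refine Runs.for_loop (fun k s' => s'.nat 9 0 0 = states m (fun j => s.nat 5 j 0) k ∧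
      ∃ cod, Trellis m (states m (fun j => s.nat 5 j 0) k) (s'.nat 7) (fun q => s'.nat 8 q 0) cod
        (weight m (fun j => s.nat 5 j 0) (fun j => s.nat 12 j 0) (s.nat 10) k)) (by decide)
      (fun s' hf => by simp [mE, IExpr.eval, hf.nat 0 (by decide), f1, hm]) ?_ ?_
  · rw [Store.setNat_nat_ne _ _ _ _ (by decide), Store.setNat_nat_ne _ _ _ _ (by decide),
      Store.setNat_nat_ne _ _ _ _ (by decide), h9]
    refine ⟨by simp [states], fun z => ∑ j, (z j).val, ?_⟩
    convert h1 using 1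
    · simp [states]
    · funext z; simp [weight]
  · rintro k s' hk hf hv ⟨h9', cod, hI⟩
    have f2 : ∀ x, x ∈ [0, 5, 10, 12] → s'.nat x = s.nat x := fun x hx => by
      rw [hf.nat x (by revert x; decide), f1 x hx]
    refine Runs.when (fun hb => ?_) (fun hb => ?_)
    · simp only [Test.Holds, posE_holds, IExpr.eval, var_eval, hv, f2 5 (by decide)] at hb
      have hp : s.nat 5 k 0 = 0 := by omega
      have hst : states m (fun j => s.nat 5 j 0) (k + 1) =
          states m (fun j => s.nat 5 j 0) k + states m (fun j => s.nat 5 j 0) k := by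
        simp only [states, Finset.range_add_one, Finset.filter_insert, hp, if_true]
        rw [Finset.card_insert_of_notMem (by simp)]
        ring
      have hle : states m (fun j => s.nat 5 j 0) k ≤ states m (fun j => s.nat 5 j 0) m :=
        states_mono _ _ hk.le
      refine ((doubleTrellis_runs (j := k) (by rw [f2 0 (by decide), hm]) h9' hv
        (by rw [f2 10 (by decide)]; exact hD k hk) hI).mono ?_).imp ?_
      -- The cost of a doubling grows with the table, so each one is charged at the final number of
      -- states.
      · refine (Nat.le_succ _).trans (Nat.succ_le_succ ?_)
        unfold doubleTrellisCost
        gcongr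
      · rintro s2 _ ⟨h2, h2'⟩
        rw [f2 10 (by decide), f2 12 (by decide)] at h2'
        rw [Store.setNat_nat_ne _ _ _ _ (by decide), Store.setNat_nat_ne _ _ _ _ (by decide),
          Store.setNat_nat_ne _ _ _ _ (by decide), hst]
        refine ⟨h2, fun z => cod z + (∑ i : Fin m, (s.nat 10 k i : ZMod 2) * z i).val *
          states m (fun j => s.nat 5 j 0) k, ?_⟩
        convert h2' using 1
        funext z
        simp only [weight, Finset.sum_range_succ, hp, if_true]
        ring
    · simp only [Test.Holds, posE_holds, IExpr.eval, var_eval, hv, f2 5 (by decide)] at hb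
      have hp : s.nat 5 k 0 ≠ 0 := by omega
      have hst : states m (fun j => s.nat 5 j 0) (k + 1) = states m (fun j => s.nat 5 j 0) k := by
        simp only [states, Finset.range_add_one, Finset.filter_insert, hp, if_false]
      rw [hst]
      simp only [Store.setNat_nat_ne _ _ _ _ (by decide : 9 ≠ 100),
        Store.setNat_nat_ne _ _ _ _ (by decide : 9 ≠ 99),
        Store.setNat_nat_ne _ _ _ _ (by decide : 8 ≠ 100),
        Store.setNat_nat_ne _ _ _ _ (by decide : 8 ≠ 99),
        Store.setNat_nat_ne _ _ _ _ (by decide : 7 ≠ 100),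
        Store.setNat_nat_ne _ _ _ _ (by decide : 7 ≠ 99)]
      refine ⟨h9', cod, ?_⟩
      convert hI using 1
      funext z
      simp only [weight, Finset.sum_range_succ, hp, if_false, add_zero]

/-- Total weights of the completions, by dynamic programming, in the real array `1`. -/
def completions : Prog :=
  .seq (.for 100 (var 9) (.rset 1 (.lit 0) (var 100)
      (.sqrt (.mul (.get 0 (.get 8 (var 100) (.lit 0)) (.lit 0))
        (.get 0 (.get 8 (var 100) (.lit 0)) (.lit 0))))))
    (.for 100 mE (.for 101 (var 9) (.cond (posE (.get 5 (var 100) (.lit 0)))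
      (.rset 1 (.add (var 100) (.lit 1)) (var 101) (.add (.get 1 (var 100) (var 101))
        (.get 1 (var 100) (.get 7 (var 100) (var 101)))))
      (.rset 1 (.add (var 100) (.lit 1)) (var 101) (.get 1 (var 100) (var 101))))))

def completionsCost {R : Type*} [Semiring R] (m N : R) : R :=
  (N * (1 + 2) + 2) + (m * ((N * ((1 + 1) + 2) + 2) + 2) + 2)

/-- `sqrt (x * x)` is `|x|`. Where `m - 2w` is not an eigenvalue the supplied value is arbitrary,
but the rotations need nonnegative weights in all states. The recursion sums over both values of bit
`i` if column `i` is a pivot, and otherwise keeps the bit at `0`. -/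
theorem completions_runs {s : Store} {m N : ℕ} (hm : s.nat 0 0 1 = m) (hN : s.nat 9 0 0 = N) :
    Runs completions s (completionsCost m N) fun s' =>
      (∀ q < N, s'.real 1 0 q = |s.real 0 (s.nat 8 q 0) 0|) ∧
      ∀ i < m, ∀ q < N, s'.real 1 (i + 1) q =
        s'.real 1 i q + if 0 < s.nat 5 i 0 then s'.real 1 i (s.nat 7 i q) else 0 := by
  refine Runs.seq_of (R := fun s' => ∀ q < N, s'.real 1 0 q = |s.real 0 (s.nat 8 q 0) 0|) ?_ ?_
  · refine Runs.for_loop (fun k s' => ∀ q < k, s'.real 1 0 q = |s.real 0 (s.nat 8 q 0) 0|)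
      (by decide) (fun s' hf => by simp [hf.nat 9 (by decide), hN]) (by simp) ?_
    intro k s' hk hf hv hI
    refine Runs.rset ?_
    intro q hq
    simp only [Store.setNat, Store.setReal, IExpr.eval, RExpr.eval, var_eval, hv,
      hf.nat 8 (by decide), hf.real 0 (by decide), Real.sqrt_mul_self_eq_abs]
    grind
  · intro s1 hf1 h1
    have f1 : ∀ x, x ∈ [0, 5, 7, 9] → s1.nat x = s.nat x := fun x hx =>
      hf1.nat x (by revert x; decide)
    refine Runs.for_loop (fun k s' => (∀ q < N, s'.real 1 0 q = |s.real 0 (s.nat 8 q 0) 0|) ∧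
      ∀ i < k, ∀ q < N, s'.real 1 (i + 1) q =
        s'.real 1 i q + if 0 < s.nat 5 i 0 then s'.real 1 i (s.nat 7 i q) else 0) (by decide)
      (fun s' hf => by simp [mE, IExpr.eval, hf.nat 0 (by decide), f1, hm])
      ⟨by simpa [Store.setNat] using h1, by simp⟩ ?_
    rintro k s' hk hf hv ⟨hI0, hI⟩
    have f2 : ∀ x, x ∈ [0, 5, 7, 9] → s'.nat x = s.nat x := fun x hx => by
      rw [hf.nat x (by revert x; decide), f1 x hx]
    refine Runs.for_loop (N := N) (fun l s2 => (∀ i ≤ k, s2.real 1 i = s'.real 1 i) ∧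
      ∀ q < l, s2.real 1 (k + 1) q =
        s'.real 1 k q + if 0 < s.nat 5 k 0 then s'.real 1 k (s.nat 7 k q) else 0) (by decide)
      (fun s' hf' => by simp [hf'.nat 9 (by decide), f2, hN])
      ⟨by simp [Store.setNat], by simp⟩ ?_ |>.imp ?_
    · rintro l s2 hl hf2 hv2 ⟨h2, h2'⟩
      have e5 : s2.nat 5 = s.nat 5 := by rw [hf2.nat 5 (by decide), f2 5 (by decide)]
      have e7 : s2.nat 7 = s.nat 7 := by rw [hf2.nat 7 (by decide), f2 7 (by decide)]
      have e100 : s2.nat 100 0 0 = k := by rw [hf2.nat 100 (by decide), hv]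
      refine Runs.cond (fun hb => Runs.rset ?_) (fun hb => Runs.rset ?_) <;>
        simp only [posE_holds, IExpr.eval, var_eval, e5, e100] at hb <;>
        (refine ⟨fun i hi => ?_, fun q hq => ?_⟩
         · rw [← h2 i hi]
           funext q
           simp only [Store.setNat, Store.setReal, IExpr.eval, var_eval, e100]
           rw [if_neg (by omega)]
         · simp only [Store.setNat, Store.setReal, IExpr.eval, RExpr.eval, var_eval, e100, hv2, e7,
             h2 k le_rfl, hb]
           grind)
    · rintro s2 _ ⟨h2, h2'⟩
      refine ⟨fun q hq => ?_, fun i hi q hq => ?_⟩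
      · simp only [Store.setNat]
        rw [h2 0 (by omega), hI0 q hq]
      · simp only [Store.setNat]
        by_cases hik : i = k
        · subst hik
          rw [h2' q hq, h2 i le_rfl]
        · rw [h2 (i + 1) (by omega), h2 i (by omega), hI i (by omega) q hq]

/-- The numbers of the first workspace qubits of all levels, in array `13`. -/
def bases : Prog :=
  .seq (.iset 13 (.lit 0) (.lit 0) wE)
    (.for 100 mE (.iset 13 (.add (var 100) (.lit 1)) (.lit 0)
      (.add (.get 13 (var 100) (.lit 0)) (var 9))))

/-- Integer expressions have no products, so the multiples of `N` are accumulated by addition. -/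
theorem bases_runs {s : Store} {n m N : ℕ} (hn : s.nat 0 0 0 = n) (hm : s.nat 0 0 1 = m)
    (hN : s.nat 9 0 0 = N) :
    Runs bases s (1 + (m * (1 + 2) + 2)) fun s' =>
      ∀ i ≤ m, s'.nat 13 i 0 = m + 2 * n + N * i := by
  refine Runs.seq_of (R := fun s' => s'.nat 13 0 0 = m + 2 * n) (Runs.iset ?_) ?_
  · simp [Store.setNat, IExpr.eval, wE, rE, nE, mE, hn, hm]; omega
  · intro s1 hf1 h1
    refine Runs.for_loop (fun k s' => ∀ i ≤ k, s'.nat 13 i 0 = m + 2 * n + N * i) (by decide)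
      (fun s' hf => by
        simp [mE, IExpr.eval, hf.nat 0 (by decide), hf1.nat 0 (by decide), hm]) ?_ ?_
    · intro i hi
      obtain rfl : i = 0 := by omega
      simpa [Store.setNat] using h1
    · intro k s' hk hf hv hI
      refine Runs.iset ?_
      intro i hi
      simp only [Store.setNat, IExpr.eval, var_eval, hv, hf.nat 9 (by decide),
        hf1.nat 9 (by decide), hN]
      rcases Nat.le_succ_iff.1 hi with h | rfl
      · rw [if_neg (by omega), if_neg (by omega), hI i h]
      · rw [if_neg (by omega), if_pos (by simp), hI k le_rfl]
        simp only [Nat.succ_eq_add_one]; ring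

end Compiler

/-! ## Action of circuits on basis states -/

theorem ket_apply {Q : Type} (x y : Q → ZMod 2) [Decidable (y = x)] :
    ket x y = if y = x then 1 else 0 := by
  unfold ket; split_ifs <;> rfl

section Circuits

variable {Q : Type} [DecidableEq Q]

theorem zmod_two_cases (b : ZMod 2) : b = 0 ∨ b = 1 := by revert b; decide

theorem sum_zmod_two {M : Type*} [AddCommMonoid M] (f : ZMod 2 → M) : ∑ b, f b = f 0 + f 1 :=
  Fin.sum_univ_two f

namespace Gate

theorem applyAt_add (u : Matrix (ZMod 2) (ZMod 2) ℂ) (t : Q) (ψ φ : (Q → ZMod 2) → ℂ) :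
    applyAt u t (ψ + φ) = applyAt u t ψ + applyAt u t φ := by
  funext x; simp [applyAt, mul_add, Finset.sum_add_distrib]

theorem applyAt_smul (u : Matrix (ZMod 2) (ZMod 2) ℂ) (t : Q) (c : ℂ) (ψ : (Q → ZMod 2) → ℂ) :
    applyAt u t (c • ψ) = c • applyAt u t ψ := by
  funext x; simp only [applyAt, Pi.smul_apply, smul_eq_mul, Finset.mul_sum]
  exact Finset.sum_congr rfl fun b _ => by ring

/-- The action of a gate as a linear map. -/
noncomputable def applyLin (g : Gate Q ℝ) : ((Q → ZMod 2) → ℂ) →ₗ[ℂ] ((Q → ZMod 2) → ℂ) where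
  toFun ψ := g.apply ψ
  map_add' ψ φ := by
    cases g <;> funext x <;> simp only [apply, applyAt_add, Pi.add_apply] <;> split_ifs <;> rfl
  map_smul' c ψ := by
    cases g <;> funext x <;>
      simp only [apply, applyAt_smul, Pi.smul_apply, RingHom.id_apply] <;> split_ifs <;> rfl

end Gate

@[simp] theorem runCircuit_nil (ψ : (Q → ZMod 2) → ℂ) : runCircuit [] ψ = ψ := rfl

theorem runCircuit_cons (g : Gate Q ℝ) (C : List (Gate Q ℝ)) (ψ : (Q → ZMod 2) → ℂ) :
    runCircuit (g :: C) ψ = runCircuit C (g.apply ψ) := rfl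

theorem runCircuit_append (C C' : List (Gate Q ℝ)) (ψ : (Q → ZMod 2) → ℂ) :
    runCircuit (C ++ C') ψ = runCircuit C' (runCircuit C ψ) := by
  simp [runCircuit, List.foldl_append]

/-- The action of a circuit as a linear map. -/
noncomputable def runLin : List (Gate Q ℝ) → ((Q → ZMod 2) → ℂ) →ₗ[ℂ] ((Q → ZMod 2) → ℂ)
  | [] => LinearMap.id
  | g :: C => (runLin C).comp g.applyLin

theorem runLin_apply (C : List (Gate Q ℝ)) (ψ : (Q → ZMod 2) → ℂ) :
    runLin C ψ = runCircuit C ψ := by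
  induction C generalizing ψ with
  | nil => rfl
  | cons g C ih => rw [runCircuit_cons, ← ih]; rfl

theorem runCircuit_sum {ι : Type*} (C : List (Gate Q ℝ)) (s : Finset ι) (c : ι → ℂ)
    (ψ : ι → (Q → ZMod 2) → ℂ) :
    runCircuit C (∑ i ∈ s, c i • ψ i) = ∑ i ∈ s, c i • runCircuit C (ψ i) := by
  simp only [← runLin_apply, map_sum, map_smul]

theorem runCircuit_smul (C : List (Gate Q ℝ)) (c : ℂ) (ψ : (Q → ZMod 2) → ℂ) :
    runCircuit C (c • ψ) = c • runCircuit C ψ := by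
  simp only [← runLin_apply, map_smul]

theorem runCircuit_add (C : List (Gate Q ℝ)) (ψ φ : (Q → ZMod 2) → ℂ) :
    runCircuit C (ψ + φ) = runCircuit C ψ + runCircuit C φ := by
  simp only [← runLin_apply, map_add]

/-- If one block of a circuit maps `ψ` to `ψ'` and all others fix both, so does the circuit. -/
theorem runCircuit_flatMap_single {ι : Type*} {l : List ι} {G : ι → List (Gate Q ℝ)} {i : ι}
    {ψ ψ' : (Q → ZMod 2) → ℂ} (hl : l.Nodup) (hi : i ∈ l)
    (h : ∀ j ∈ l, j ≠ i → runCircuit (G j) ψ = ψ ∧ runCircuit (G j) ψ' = ψ')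
    (h' : runCircuit (G i) ψ = ψ') : runCircuit (l.flatMap G) ψ = ψ' := by
  have hfix : ∀ l' : List ι, (∀ j ∈ l', runCircuit (G j) ψ' = ψ') →
      runCircuit (l'.flatMap G) ψ' = ψ' := by
    intro l' hl'
    induction l' with
    | nil => rfl
    | cons j l' ih =>
      rw [List.flatMap_cons, runCircuit_append, hl' j (by simp), ih fun k hk => hl' k (by simp [hk])]
  induction l with
  | nil => simp at hi
  | cons j l ih =>
    rw [List.flatMap_cons, runCircuit_append]
    rw [List.nodup_cons] at hl
    by_cases hji : j = i
    · subst hji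
      rw [h']
      exact hfix l fun k hk => (h k (by simp [hk]) fun hkj => hl.1 (hkj ▸ hk)).2
    · rw [(h j (by simp) hji).1]
      exact ih hl.2 (by simpa [Ne.symm hji] using hi) fun k hk => h k (by simp [hk])

theorem applyAt_ket (u : Matrix (ZMod 2) (ZMod 2) ℂ) (t : Q) (x : Q → ZMod 2) :
    Gate.applyAt u t (ket x) = ∑ b, u b (x t) • ket (Function.update x t b) := by
  classical
  funext y
  have key : ∀ b, ket x (Function.update y t b) =
      if b = x t ∧ Function.update y t (x t) = x then 1 else 0 := by
    intro b
    rw [ket_apply]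
    congr 1
    refine propext ⟨fun h => ?_, fun h => by rw [h.1, h.2]⟩
    have : b = x t := by rw [← h]; simp
    exact ⟨this, this ▸ h⟩
  have key' : ∀ b, ket (Function.update x t b) y =
      if b = y t ∧ Function.update y t (x t) = x then 1 else 0 := by
    intro b
    rw [ket_apply]
    congr 1
    refine propext ⟨fun h => ?_, fun h => ?_⟩
    · subst h; simp
    · rw [h.1]; conv_rhs => rw [← h.2]
      simp
  simp only [Gate.applyAt, key, Finset.sum_apply, Pi.smul_apply, key', smul_eq_mul]
  by_cases h : Function.update y t (x t) = x <;> simp [h]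

theorem update_eq_add_single (x : Q → ZMod 2) (t : Q) (b : ZMod 2) :
    Function.update x t (x t + b) = x + Pi.single t b := by
  funext q
  by_cases h : q = t
  · subst h; simp
  · simp [h]

theorem applyAt_X_ket (t : Q) (x : Q → ZMod 2) :
    Gate.applyAt Pauli.X.mat t (ket x) = ket (x + Pi.single t 1) := by
  rw [applyAt_ket, ← update_eq_add_single, sum_zmod_two]
  have e11 : (1 : ZMod 2) + 1 = 0 := by decide
  rcases zmod_two_cases (x t) with h | h <;> simp [Pauli.mat, h, e11]

theorem apply_X_ket (t : Q) (x : Q → ZMod 2) :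
    Gate.apply (ket x) (.one .X t) = ket (x + Pi.single t 1) := applyAt_X_ket t x

theorem apply_ctrl_ket_of_one (u : OneQubit ℝ) {c t : Q} (hct : c ≠ t) {x : Q → ZMod 2}
    (hx : x c = 1) : Gate.apply (ket x) (.ctrl u c t) = Gate.applyAt u.mat t (ket x) := by
  classical
  funext y
  simp only [Gate.apply]
  split_ifs with h
  · rfl
  · have hyx : ∀ b, Function.update y t b ≠ x := fun b hb => h (by rw [← hx, ← hb]; simp [hct])
    have : y ≠ x := fun hb => h (hb ▸ hx)
    simp [Gate.applyAt, ket_apply, hyx, this]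

theorem apply_ctrl_ket_of_zero (u : OneQubit ℝ) {c t : Q} (hct : c ≠ t) {x : Q → ZMod 2}
    (hx : x c = 0) : Gate.apply (ket x) (.ctrl u c t) = ket x := by
  classical
  funext y
  simp only [Gate.apply]
  split_ifs with h
  · have hyx : ∀ b, Function.update y t b ≠ x := fun b hb => by
      have : x c = y c := by rw [← hb]; simp [hct]
      rw [hx, h] at this
      exact absurd this (by decide)
    have : y ≠ x := fun hb => by rw [hb, hx] at h; exact absurd h (by decide)
    simp [Gate.applyAt, ket_apply, hyx, this]
  · rfl

theorem apply_cnot_ket {c t : Q} (hct : c ≠ t) (x : Q → ZMod 2) :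
    Gate.apply (ket x) (.ctrl .X c t) = ket (x + Pi.single t (x c)) := by
  rcases zmod_two_cases (x c) with h | h
  · rw [apply_ctrl_ket_of_zero _ hct h, h]; simp
  · rw [apply_ctrl_ket_of_one _ hct h, h]; exact applyAt_X_ket t x

theorem apply_toffoli_ket {a b t : Q} (ha : a ≠ t) (hb : b ≠ t) (x : Q → ZMod 2) :
    Gate.apply (ket x) (.toffoli a b t) = ket (x + Pi.single t (x a * x b)) := by
  classical
  funext y
  simp only [Gate.apply, applyAt_X_ket]
  by_cases hab : x a = 1 ∧ x b = 1
  · rw [hab.1, hab.2, mul_one]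
    split_ifs with h
    · rfl
    · rw [ket_apply, ket_apply, if_neg, if_neg]
      · rintro rfl; exact h (by simpa [ha, hb] using hab)
      · rintro rfl; exact h hab
  · have h0 : x a * x b = 0 := by
      rcases zmod_two_cases (x a) with h1 | h1 <;> rcases zmod_two_cases (x b) with h2 | h2 <;>
        simp_all
    rw [h0, Pi.single_zero, add_zero]
    split_ifs with h
    · rw [ket_apply, ket_apply, if_neg, if_neg]
      · rintro rfl; exact hab h
      · rintro rfl; exact hab (by simpa [ha, hb] using h)
    · rfl

/-- A relabelled gate acts on the relabelled qubits only. -/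
theorem apply_relabel {Q' : Type} [DecidableEq Q'] {h : Q → Q'} (hh : Function.Injective h)
    (g : Gate Q ℝ) (ψ : (Q → ZMod 2) → ℂ) (φ : (Q' → ZMod 2) → ℂ)
    (hφ : ∀ x q b, φ (Function.update x (h q) b) = φ x) :
    (g.relabel h).apply (fun x => ψ (x ∘ h) * φ x) = fun x => g.apply ψ (x ∘ h) * φ x := by
  have hat : ∀ u t, Gate.applyAt u (h t) (fun x => ψ (x ∘ h) * φ x) =
      fun x => Gate.applyAt u t ψ (x ∘ h) * φ x := by
    intro u t
    funext x
    simp only [Gate.applyAt, hφ, Finset.sum_mul, Function.comp_apply]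
    refine Finset.sum_congr rfl fun b _ => ?_
    rw [Function.update_comp_eq_of_injective _ hh, mul_assoc]
  have hid : ∀ u : OneQubit ℝ, u.map id = u := by intro u; cases u <;> rfl
  cases g <;> funext x <;> simp only [Gate.relabel, Gate.map, Gate.apply, hat, hid,
    Function.comp_apply] <;> split_ifs <;> rfl

/-- The factor `φ` is a spectator: it does not depend on the relabelled qubits, so every gate passes
through it. It carries registers `B` and `C` during the preparation of the pilot state. -/
theorem runCircuit_relabel {Q' : Type} [DecidableEq Q'] {h : Q → Q'} (hh : Function.Injective h)
    (C : List (Gate Q ℝ)) (ψ : (Q → ZMod 2) → ℂ) (φ : (Q' → ZMod 2) → ℂ)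
    (hφ : ∀ x q b, φ (Function.update x (h q) b) = φ x) :
    runCircuit (C.map (Gate.relabel h)) (fun x => ψ (x ∘ h) * φ x) =
      fun x => runCircuit C ψ (x ∘ h) * φ x := by
  induction C generalizing ψ with
  | nil => rfl
  | cons g C ih =>
    rw [List.map_cons, runCircuit_cons, apply_relabel hh g ψ φ hφ, ih, runCircuit_cons]

/-- Blocks that act locally on the factors of a family of product states. -/
theorem runCircuit_flatMap_local {ι α : Type*} [DecidableEq ι] {l : List ι}
    {G : ι → List (Gate Q ℝ)} (F : (ι → α) → (Q → ZMod 2) → ℂ) (T : ι → α → α) (hl : l.Nodup)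
    (h : ∀ i ∈ l, ∀ φ, runCircuit (G i) (F φ) = F (Function.update φ i (T i (φ i)))) (φ : ι → α) :
    runCircuit (l.flatMap G) (F φ) = F fun i => if i ∈ l then T i (φ i) else φ i := by
  induction l generalizing φ with
  | nil => simp
  | cons i l ih =>
    rw [List.nodup_cons] at hl
    rw [List.flatMap_cons, runCircuit_append, h i (by simp),
      ih hl.2 fun j hj => h j (by simp [hj])]
    congr 1
    funext j
    by_cases hji : j = i
    · subst hji; simp [hl.1]
    · simp [hji]

end Circuits

/-! ### Signs and characters -/

/-- The character `b ↦ (-1)^b`. -/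
def sgn (b : ZMod 2) : ℂ := if b = 1 then -1 else 1

@[simp] theorem sgn_zero : sgn 0 = 1 := by simp [sgn]

@[simp] theorem sgn_one : sgn 1 = -1 := by simp [sgn]

theorem sgn_add (a b : ZMod 2) : sgn (a + b) = sgn a * sgn b := by
  have e11 : (1 : ZMod 2) + 1 = 0 := by decide
  rcases zmod_two_cases a with rfl | rfl <;> rcases zmod_two_cases b with rfl | rfl <;> simp [e11]

theorem sgn_sum {ι : Type*} (s : Finset ι) (f : ι → ZMod 2) :
    sgn (∑ i ∈ s, f i) = ∏ i ∈ s, sgn (f i) := by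
  classical
  induction s using Finset.induction_on with
  | empty => simp
  | insert i s hi ih => rw [Finset.sum_insert hi, Finset.prod_insert hi, sgn_add, ih]

theorem sgn_mul_self (a : ZMod 2) : sgn a * sgn a = 1 := by
  rcases zmod_two_cases a with rfl | rfl <;> simp

/-- The characters of `𝔽₂ᵐ`. -/
def chi {m : ℕ} (z y : Fin m → ZMod 2) : ℂ := sgn (∑ i, z i * y i)

/-! ## Preparation of the pilot state -/

/-- Vectors supported on the elements of `S` that are at least `i`. -/
def supported {m : ℕ} (S : Finset (Fin m)) (i : ℕ) : Finset (Fin m → ZMod 2) :=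
  Fintype.piFinset fun j => if j ∈ S ∧ i ≤ j then Finset.univ else {0}

theorem mem_supported {m : ℕ} {S : Finset (Fin m)} {i : ℕ} {z : Fin m → ZMod 2} :
    z ∈ supported S i ↔ ∀ j, z j ≠ 0 → j ∈ S ∧ i ≤ j := by
  simp only [supported, Fintype.mem_piFinset]
  refine forall_congr' fun j => ?_
  split_ifs with h <;> simp [h]

/-- Bit `i` is free exactly if `i ∈ S`, so each vector supported from `i + 1` on has one or two
extensions. The recursion for the weights and the rotations of the circuit follow the same
splitting. -/
theorem sum_supported {m : ℕ} {M : Type*} [AddCommMonoid M] (S : Finset (Fin m)) (i : Fin m)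
    (g : (Fin m → ZMod 2) → M) : ∑ z ∈ supported S i, g z =
      ∑ z ∈ supported S (i + 1), (g z + if i ∈ S then g (z + Pi.single i 1) else 0) := by
  by_cases hi : i ∈ S
  · simp only [hi, if_true]
    have e11 : (1 : ZMod 2) + 1 = 0 := by decide
    rw [Finset.sum_add_distrib, ← Finset.sum_filter_add_sum_filter_not _ (fun z => z i = 0)]
    congr 1
    · refine Finset.sum_congr ?_ fun _ _ => rfl
      ext z
      simp only [Finset.mem_filter, mem_supported]
      constructor
      · rintro ⟨h, h0⟩ j hj
        have := h j hj
        refine ⟨this.1, ?_⟩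
        have hne : j ≠ i := by rintro rfl; exact hj h0
        have : (j : ℕ) ≠ i := fun hh => hne (Fin.ext hh)
        omega
      · intro h
        refine ⟨fun j hj => ⟨(h j hj).1, by have := (h j hj).2; omega⟩, ?_⟩
        by_contra hne
        have := (h i hne).2
        omega
    · refine Finset.sum_nbij' (fun z => z + Pi.single i 1) (fun z => z + Pi.single i 1) ?_ ?_ ?_ ?_ ?_
      · intro z hz
        simp only [Finset.mem_filter, mem_supported] at hz ⊢
        have h1 : z i = 1 := (zmod_two_cases _).resolve_left hz.2
        intro j hj
        have hne : j ≠ i := by rintro rfl; simp [h1, e11] at hj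
        simp only [Pi.add_apply, Pi.single_eq_of_ne hne, add_zero] at hj
        have h2 := hz.1 j hj
        have : (j : ℕ) ≠ i := fun hh => hne (Fin.ext hh)
        exact ⟨h2.1, by omega⟩
      · intro z hz
        simp only [Finset.mem_filter, mem_supported] at hz ⊢
        have h0 : z i = 0 := by
          by_contra hne
          have := (hz i hne).2
          omega
        refine ⟨fun j hj => ?_, by simp [h0]⟩
        by_cases hne : j = i
        · subst hne; exact ⟨hi, le_rfl⟩
        · simp only [Pi.add_apply, Pi.single_eq_of_ne hne, add_zero] at hj
          exact ⟨(hz j hj).1, by have := (hz j hj).2; omega⟩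
      · intro z _
        rw [add_assoc, ← Pi.single_add, e11, Pi.single_zero, add_zero]
      · intro z _
        rw [add_assoc, ← Pi.single_add, e11, Pi.single_zero, add_zero]
      · intro z _
        rw [add_assoc, ← Pi.single_add, e11, Pi.single_zero, add_zero]
  · simp only [hi, if_false, add_zero]
    refine Finset.sum_congr ?_ fun _ _ => rfl
    ext z
    simp only [mem_supported]
    refine forall_congr' fun j => imp_congr_right fun _ => and_congr_right fun hj => ?_
    have : (j : ℕ) ≠ i := fun hh => hi (Fin.ext hh ▸ hj)
    omega

namespace Pilot

variable {m N : ℕ}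

/-- The labels of the qubits used in the preparation of the pilot state. -/
abbrev Label (m N : ℕ) : Type := Fin m ⊕ Fin ((m + 1) * N)

/-- The workspace qubit that stands for the automaton being in state `q` at level `i`. -/
def wire (i : Fin (m + 1)) (q : Fin N) : Label m N := Sum.inr (finProdFinEquiv (i, q))

theorem wire_inj {i i' : Fin (m + 1)} {q q' : Fin N} : wire i q = wire i' q' ↔ i = i' ∧ q = q' := by
  simp [wire]

/-- Controlled on the state of the automaton, rotate qubit `i` to the right superposition. -/
noncomputable def rotLayer (S : Finset (Fin m)) (tr : Fin m → Fin N → Fin N) (V : ℕ → Fin N → ℝ)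
    (i : Fin m) : List (Gate (Label m N) ℝ) :=
  (List.finRange N).flatMap fun q => if i ∈ S ∧ 0 < V (i + 1) q then
    [.ctrl (.rot (Real.sqrt (V i q / V (i + 1) q)) (Real.sqrt (V i (tr i q) / V (i + 1) q)))
      (wire i.succ q) (Sum.inl i)] else []

/-- Compute, or uncompute, the state of the automaton at level `i` from level `i + 1`. -/
def moveLayer (tr : Fin m → Fin N → Fin N) (i : Fin m) : List (Gate (Label m N) ℝ) :=
  (List.finRange N).flatMap fun q => [.ctrl .X (wire i.succ q) (wire i.castSucc q),
    .toffoli (wire i.succ q) (Sum.inl i) (wire i.castSucc q),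
    .toffoli (wire i.succ q) (Sum.inl i) (wire i.castSucc (tr i q))]

/-- The preparation of the pilot state. -/
noncomputable def circuit (S : Finset (Fin m)) (tr : Fin m → Fin N → Fin N) (V : ℕ → Fin N → ℝ)
    (q₀ : Fin N) : List (Gate (Label m N) ℝ) :=
  [.one .X (wire (Fin.last m) q₀)] ++
    ((List.finRange m).reverse.flatMap (fun i => rotLayer S tr V i ++ moveLayer tr i) ++
    ((List.finRange m).flatMap (moveLayer tr) ++ ([.one .X (wire (Fin.last m) q₀)] ++
    (List.finRange m).flatMap fun i => if i ∈ S then [.one .had (Sum.inl i)] else [])))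

/-- Level `i + 1` is one-hot, so only the block of state `q` acts. It puts a mark at `q` and, if bit
`i` is set, erases it and puts one at `tr i q`; this is correct also when `tr i q = q`. -/
theorem moveLayer_ket (tr : Fin m → Fin N → Fin N) (i : Fin m) {x : Label m N → ZMod 2} {q : Fin N}
    (hx : ∀ q', x (wire i.succ q') = if q' = q then 1 else 0) :
    runCircuit (moveLayer tr i) (ket x) =
      ket (x + Pi.single (wire i.castSucc (if x (Sum.inl i) = 1 then tr i q else q)) 1) := by
  have e11 : (1 : ZMod 2) + 1 = 0 := by decide
  have hne : ∀ q q' : Fin N, wire i.succ q ≠ wire i.castSucc q' := fun q q' h =>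
    absurd (congrArg Fin.val (wire_inj.1 h).1) (by simp)
  have hinl : ∀ l (q' : Fin N), (Sum.inl i : Label m N) ≠ wire l q' := fun l q' => by simp [wire]
  have hgate : ∀ (x : Label m N → ZMod 2) q', runCircuit
      [.ctrl .X (wire i.succ q') (wire i.castSucc q'),
        .toffoli (wire i.succ q') (Sum.inl i) (wire i.castSucc q'),
        .toffoli (wire i.succ q') (Sum.inl i) (wire i.castSucc (tr i q'))] (ket x) =
      ket (x + Pi.single (wire i.castSucc q') (x (wire i.succ q')) +
        Pi.single (wire i.castSucc q') (x (wire i.succ q') * x (Sum.inl i)) +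
        Pi.single (wire i.castSucc (tr i q')) (x (wire i.succ q') * x (Sum.inl i))) := by
    intro x q'
    rw [runCircuit_cons, apply_cnot_ket (hne _ _), runCircuit_cons,
      apply_toffoli_ket (hne _ _) (hinl _ _), runCircuit_cons,
      apply_toffoli_ket (hne _ _) (hinl _ _), runCircuit_nil]
    simp [hne, hinl]
  refine runCircuit_flatMap_single (i := q) (List.nodup_finRange N) (List.mem_finRange q) ?_ ?_
  · intro q' _ hq'
    rw [hgate, hgate]
    simp [hx, hq', hne]
  · rw [hgate, hx]
    congr 1
    rcases zmod_two_cases (x (Sum.inl i)) with h | h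
    · simp [h]
    · simp only [h, if_true, mul_one]
      rw [add_assoc x, ← Pi.single_add, e11, Pi.single_zero, add_zero]

/-- The bits of `z` from position `i` on. -/
def trunc (i : ℕ) (z : Fin m → ZMod 2) : Fin m → ZMod 2 := fun j => if i ≤ j then z j else 0

/-- The basis state in which register `A` contains `z` and the levels from `i` on of the workspace
contain the states of the automaton. -/
def config (cod : (Fin m → ZMod 2) → Fin N) (i : ℕ) (z : Fin m → ZMod 2) : Label m N → ZMod 2 :=
  Sum.elim z fun l => if i ≤ (finProdFinEquiv.symm l).1.val ∧
    (finProdFinEquiv.symm l).2 = cod (trunc (finProdFinEquiv.symm l).1.val z) then 1 else 0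

theorem config_inl (cod : (Fin m → ZMod 2) → Fin N) (i : ℕ) (z : Fin m → ZMod 2) (j : Fin m) :
    config cod i z (Sum.inl j) = z j := rfl

theorem config_wire (cod : (Fin m → ZMod 2) → Fin N) (i : ℕ) (z : Fin m → ZMod 2) (l : Fin (m + 1))
    (q : Fin N) : config cod i z (wire l q) =
      if i ≤ l.val ∧ q = cod (trunc l z) then 1 else 0 := by
  simp only [config, wire, Sum.elim_inr, Equiv.symm_apply_apply]

theorem label_cases (x : Label m N) : (∃ j, x = Sum.inl j) ∨ ∃ l q, x = wire l q := by
  rcases x with j | l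
  · exact .inl ⟨j, rfl⟩
  · exact .inr ⟨(finProdFinEquiv.symm l).1, (finProdFinEquiv.symm l).2, by
      rw [wire, Prod.mk.eta, Equiv.apply_symm_apply]⟩

theorem config_succ (cod : (Fin m → ZMod 2) → Fin N) (i : Fin (m + 1)) (z : Fin m → ZMod 2) :
    config cod i z = config cod (i + 1) z + Pi.single (wire i (cod (trunc i z))) 1 := by
  funext x
  rcases label_cases x with ⟨j, rfl⟩ | ⟨l, q, rfl⟩
  · rw [Pi.add_apply, config_inl, config_inl, Pi.single_eq_of_ne (by simp [wire]), add_zero]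
  · rw [Pi.add_apply, config_wire, config_wire]
    by_cases hl : l = i
    · subst hl
      by_cases hq : q = cod (trunc l z)
      · subst hq; simp
      · rw [Pi.single_eq_of_ne (by simp [wire_inj, hq])]; simp [hq]
    · have : (l : ℕ) ≠ i := fun hh => hl (Fin.ext hh)
      rw [Pi.single_eq_of_ne (by simp [wire_inj, hl]), add_zero]
      congr 1
      refine propext (and_congr_left fun _ => ?_)
      omega

theorem trunc_succ (i : Fin m) (z : Fin m → ZMod 2) (hz : z i = 1) :
    trunc i z = trunc (i + 1) z + Pi.single i 1 := by
  funext j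
  by_cases hj : j = i
  · subst hj; simp [trunc, hz]
  · have : (j : ℕ) ≠ i := fun hh => hj (Fin.ext hh)
    rw [Pi.add_apply, Pi.single_eq_of_ne hj, add_zero]
    simp only [trunc]
    congr 1
    apply propext; omega

theorem trunc_succ_of_zero (i : Fin m) (z : Fin m → ZMod 2) (hz : z i = 0) :
    trunc i z = trunc (i + 1) z := by
  funext j
  by_cases hj : j = i
  · subst hj; simp [trunc, hz]
  · have : (j : ℕ) ≠ i := fun hh => hj (Fin.ext hh)
    simp only [trunc]
    congr 1
    apply propext; omega

theorem trunc_of_mem {S : Finset (Fin m)} {i : ℕ} {z : Fin m → ZMod 2} (hz : z ∈ supported S i) :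
    trunc i z = z := by
  funext j
  rw [mem_supported] at hz
  by_cases h : z j = 0
  · simp [trunc, h]
  · simp [trunc, (hz j h).2]

variable {S : Finset (Fin m)} {tr : Fin m → Fin N → Fin N} {V : ℕ → Fin N → ℝ}
  {cod : (Fin m → ZMod 2) → Fin N}

theorem cod_trunc (hstep : ∀ z i, z i = 0 → tr i (cod z) = cod (z + Pi.single i 1)) (i : Fin m)
    (z : Fin m → ZMod 2) : cod (trunc i z) =
      if z i = 1 then tr i (cod (trunc (i + 1) z)) else cod (trunc (i + 1) z) := by
  rcases zmod_two_cases (z i) with h | h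
  · rw [trunc_succ_of_zero i z h, h]; simp
  · rw [trunc_succ i z h, if_pos h, hstep]
    simp [trunc]

/-- Level `i` is a function of level `i + 1` and bit `i`, and it is added modulo two. The same layer
therefore computes and uncomputes it. -/
theorem moveLayer_config (hstep : ∀ z i, z i = 0 → tr i (cod z) = cod (z + Pi.single i 1))
    (i : Fin m) (z : Fin m → ZMod 2) :
    runCircuit (moveLayer tr i) (ket (config cod (i + 1) z)) = ket (config cod i z) ∧
      runCircuit (moveLayer tr i) (ket (config cod i z)) = ket (config cod (i + 1) z) := by
  have hs := config_succ cod i.castSucc z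
  have e11 : (1 : ZMod 2) + 1 = 0 := by decide
  simp only [Fin.val_castSucc] at hs
  constructor
  · rw [moveLayer_ket (q := cod (trunc (i + 1) z)), config_inl, ← cod_trunc hstep, hs]
    intro q'
    simp [config_wire]
  · rw [moveLayer_ket (q := cod (trunc (i + 1) z)), config_inl, ← cod_trunc hstep, hs, add_assoc,
      ← Pi.single_add, e11, Pi.single_zero, add_zero]
    intro q'
    simp [config_wire]

/-- The levels from `i + 1` on depend only on the bits from `i + 1` on, so qubit `i` can still be
rotated after they have been computed. -/
theorem config_flip (i : Fin m) (z : Fin m → ZMod 2) :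
    config cod (i + 1) z + Pi.single (Sum.inl i) 1 = config cod (i + 1) (z + Pi.single i 1) := by
  funext x
  rcases label_cases x with ⟨j, rfl⟩ | ⟨l, q, rfl⟩
  · rw [Pi.add_apply, config_inl, config_inl, Pi.add_apply]
    by_cases hj : j = i
    · subst hj; simp
    · rw [Pi.single_eq_of_ne hj, Pi.single_eq_of_ne (by simpa using hj)]
  · rw [Pi.add_apply, Pi.single_eq_of_ne (by simp [wire]), add_zero, config_wire, config_wire]
    by_cases hl : i.val + 1 ≤ l
    · have : trunc l (z + Pi.single i 1) = trunc l z := by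
        funext j
        simp only [trunc]
        split_ifs with h
        · rw [Pi.add_apply, Pi.single_eq_of_ne, add_zero]
          rintro rfl; omega
        · rfl
      rw [this]
    · simp [hl]

/-- Only the rotation controlled on `cod z` fires, and it acts on `|0⟩` because bit `i` of `z` is
still zero. States of total weight zero get no gate, since their ratios would be `0 / 0`. -/
theorem rotLayer_config (i : Fin m) {z : Fin m → ZMod 2} (hz : z ∈ supported S (i + 1)) :
    runCircuit (rotLayer S tr V i) (ket (config cod (i + 1) z)) =
      if i ∈ S ∧ 0 < V (i + 1) (cod z) then
        ((Real.sqrt (V i (cod z) / V (i + 1) (cod z)) : ℝ) : ℂ) • ket (config cod (i + 1) z) +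
        ((Real.sqrt (V i (tr i (cod z)) / V (i + 1) (cod z)) : ℝ) : ℂ) •
          ket (config cod (i + 1) (z + Pi.single i 1))
      else ket (config cod (i + 1) z) := by
  have hinl : ∀ l (q' : Fin N), wire l q' ≠ (Sum.inl i : Label m N) := fun l q' => by simp [wire]
  have hcod : ∀ q, config cod (i + 1) z (wire i.succ q) = if q = cod z then 1 else 0 := fun q => by
    rw [config_wire]
    simp only [Fin.val_succ, le_refl, true_and]
    rw [trunc_of_mem hz]
  have hcod' : ∀ q, config cod (i + 1) (z + Pi.single i 1) (wire i.succ q) =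
      if q = cod z then 1 else 0 := fun q => by
    rw [← config_flip, Pi.add_apply, Pi.single_eq_of_ne (hinl _ _), add_zero, hcod]
  have hzi : z i = 0 := by
    by_contra h
    have := (mem_supported.1 hz i h).2
    omega
  refine runCircuit_flatMap_single (i := cod z) (List.nodup_finRange N) (List.mem_finRange _) ?_ ?_
  · intro q _ hq
    have h1 : ∀ u : OneQubit ℝ, Gate.apply (ket (config cod (i + 1) z))
        (.ctrl u (wire i.succ q) (Sum.inl i)) = ket (config cod (i + 1) z) := fun u =>
      apply_ctrl_ket_of_zero u (hinl _ _) (by simp [hcod, hq])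
    have h2 : ∀ u : OneQubit ℝ, Gate.apply (ket (config cod (i + 1) (z + Pi.single i 1)))
        (.ctrl u (wire i.succ q) (Sum.inl i)) = ket (config cod (i + 1) (z + Pi.single i 1)) :=
      fun u => apply_ctrl_ket_of_zero u (hinl _ _) (by simp [hcod', hq])
    split_ifs
    · simp only [runCircuit_add, runCircuit_smul, runCircuit_cons, runCircuit_nil, h1, h2, and_self]
    · simp only [runCircuit_cons, runCircuit_nil, h1, and_self]
    · simp
    · simp
  · split_ifs with h
    · have hflip : ∀ b, Function.update (config cod (i + 1) z) (Sum.inl i) b =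
          config cod (i + 1) z + Pi.single (Sum.inl i) b := fun b => by
        rw [← update_eq_add_single, config_inl, hzi, zero_add]
      rw [runCircuit_cons, runCircuit_nil, apply_ctrl_ket_of_one _ (hinl _ _) (by simp [hcod]),
        applyAt_ket, sum_zmod_two, config_inl, hzi, hflip, hflip, config_flip, Pi.single_zero,
        add_zero]
      simp [OneQubit.mat]
    · simp

/-- The state of the qubits after the bits from `i` on have been prepared. -/
noncomputable def partialState (S : Finset (Fin m)) (V : ℕ → Fin N → ℝ)
    (cod : (Fin m → ZMod 2) → Fin N) (i : ℕ) : (Label m N → ZMod 2) → ℂ :=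
  ∑ z ∈ supported S i, ((Real.sqrt (V i (cod z) / V m (cod 0)) : ℝ) : ℂ) • ket (config cod i z)

/-- The amplitudes telescope: `√(V i / V (i+1)) · √(V (i+1) / V m) = √(V i / V m)` for either value
of bit `i`. A state of weight zero has only completions of weight zero, all weights being
nonnegative, so the missing rotation does no harm. -/
theorem layer_partialState (hstep : ∀ z i, z i = 0 → tr i (cod z) = cod (z + Pi.single i 1))
    (hV0 : ∀ i q, 0 ≤ V i q)
    (hV : ∀ (i : Fin m) q, V (i + 1) q = V i q + if i ∈ S then V i (tr i q) else 0) (i : Fin m) :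
    runCircuit (rotLayer S tr V i ++ moveLayer tr i) (partialState S V cod (i + 1)) =
      partialState S V cod i := by
  unfold partialState
  rw [sum_supported, runCircuit_sum]
  refine Finset.sum_congr rfl fun z hz => ?_
  have hzi : z i = 0 := by
    by_contra h
    have := (mem_supported.1 hz i h).2
    omega
  rw [runCircuit_append, rotLayer_config i hz]
  by_cases hi : i ∈ S
  · have hVi := hV i (cod z)
    rw [if_pos hi] at hVi
    have h1 := hV0 i (cod z)
    have h2 := hV0 i (tr i (cod z))
    by_cases hpos : 0 < V (i + 1) (cod z)
    · rw [if_pos ⟨hi, hpos⟩, runCircuit_add, runCircuit_smul, runCircuit_smul,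
        (moveLayer_config hstep i _).1, (moveLayer_config hstep i _).1, smul_add, smul_smul,
        smul_smul, if_pos hi, ← hstep z i hzi, ← Complex.ofReal_mul, ← Complex.ofReal_mul,
        ← Real.sqrt_mul (div_nonneg (hV0 _ _) (hV0 _ _)),
        ← Real.sqrt_mul (div_nonneg (hV0 _ _) (hV0 _ _)), div_mul_div_comm, div_mul_div_comm,
        mul_comm (V m (cod 0)), mul_div_mul_left _ _ hpos.ne', mul_div_mul_left _ _ hpos.ne']
    · have h3 : V (i + 1) (cod z) = 0 := le_antisymm (not_lt.1 hpos) (hV0 _ _)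
      have h4 : V i (cod z) = 0 := by linarith
      have h5 : V i (tr i (cod z)) = 0 := by linarith
      simp [h3, h4, h5, hi, ← hstep z i hzi]
  · rw [if_neg (by tauto), if_neg hi, (moveLayer_config hstep i _).1, add_zero, hV, if_neg hi,
      add_zero]

theorem drop_finRange (i : Fin m) : (List.finRange m).drop i = i :: (List.finRange m).drop (i + 1) := by
  rw [List.drop_eq_getElem_cons (by simp)]
  simp

theorem layers_partialState (hstep : ∀ z i, z i = 0 → tr i (cod z) = cod (z + Pi.single i 1))
    (hV0 : ∀ i q, 0 ≤ V i q)
    (hV : ∀ (i : Fin m) q, V (i + 1) q = V i q + if i ∈ S then V i (tr i q) else 0) (k : ℕ)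
    (hk : k ≤ m) :
    runCircuit (((List.finRange m).drop k).reverse.flatMap
      fun i => rotLayer S tr V i ++ moveLayer tr i) (partialState S V cod m) =
      partialState S V cod k := by
  induction hk using Nat.decreasingInduction with
  | self => rw [List.drop_eq_nil_of_le (by simp)]; rfl
  | of_succ k hk ih =>
    rw [drop_finRange ⟨k, hk⟩, List.reverse_cons, List.flatMap_append, runCircuit_append, ih,
      List.flatMap_cons, List.flatMap_nil, List.append_nil]
    exact layer_partialState hstep hV0 hV ⟨k, hk⟩

theorem moveLayers_config (hstep : ∀ z i, z i = 0 → tr i (cod z) = cod (z + Pi.single i 1))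
    (z : Fin m → ZMod 2) (k : ℕ) (hk : k ≤ m) :
    runCircuit (((List.finRange m).drop k).flatMap (moveLayer tr)) (ket (config cod k z)) =
      ket (config cod m z) := by
  induction hk using Nat.decreasingInduction with
  | self => rw [List.drop_eq_nil_of_le (by simp)]; rfl
  | of_succ k hk ih =>
    rw [drop_finRange ⟨k, hk⟩, List.flatMap_cons, runCircuit_append]
    exact (congrArg _ (moveLayer_config hstep ⟨k, hk⟩ z).2).trans ih

theorem config_last (z : Fin m → ZMod 2) :
    config cod m z = Sum.elim z 0 + Pi.single (wire (Fin.last m) (cod 0)) 1 := by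
  funext x
  rcases label_cases x with ⟨j, rfl⟩ | ⟨l, q, rfl⟩
  · rw [Pi.add_apply, config_inl, Pi.single_eq_of_ne (by simp [wire])]; simp
  · have h0 : trunc m z = 0 := by
      funext j
      have := j.2
      simp [trunc, Nat.not_le.2 this]
    rw [config_wire, Pi.add_apply]
    by_cases hl : l = Fin.last m
    · subst hl
      by_cases hq : q = cod 0
      · subst hq; simp [h0, wire]
      · rw [Pi.single_eq_of_ne (by simp [wire_inj, hq])]; simp [h0, hq, wire]
    · have : ¬ m ≤ (l : ℕ) := fun hh => hl (Fin.ext (by simp; omega))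
      rw [Pi.single_eq_of_ne (by simp [wire_inj, hl])]; simp [this, wire]

/-- A product state on register `A`. -/
noncomputable def productA (N : ℕ) (φ : Fin m → ZMod 2 → ℂ) : (Label m N → ZMod 2) → ℂ :=
  fun x => if (fun l => x (Sum.inr l)) = 0 then ∏ i, φ i (x (Sum.inl i)) else 0

theorem apply_had_productA (φ : Fin m → ZMod 2 → ℂ) (i : Fin m) :
    Gate.apply (productA N φ) (.one .had (Sum.inl i)) = productA N (Function.update φ i
      fun b => ∑ b', OneQubit.had.mat b b' * φ i b') := by
  funext x
  simp only [Gate.apply, Gate.applyAt, productA]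
  have h0 : ∀ b, (fun l => Function.update x (Sum.inl i) b (Sum.inr l)) =
      fun l => x (Sum.inr l) := fun b => by funext l; simp
  simp only [h0]
  split_ifs with h
  · rw [← Finset.mul_prod_erase _ _ (Finset.mem_univ i), Function.update_self, Finset.sum_mul]
    refine Finset.sum_congr rfl fun b _ => ?_
    rw [← Finset.mul_prod_erase _ _ (Finset.mem_univ i), mul_assoc]
    congr 1
    simp only [Function.update_self]
    congr 1
    refine Finset.prod_congr rfl fun j hj => ?_
    have hji := Finset.ne_of_mem_erase hj
    rw [Function.update_of_ne hji, Function.update_of_ne (by simpa using hji)]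
  · simp

theorem ket_eq_productA (z : Fin m → ZMod 2) :
    ket (Sum.elim z 0 : Label m N → ZMod 2) =
      productA N fun i b => if b = z i then 1 else 0 := by
  funext x
  have h : x = Sum.elim z 0 ↔ (fun l => x (Sum.inr l)) = 0 ∧ ∀ i, x (Sum.inl i) = z i := by
    constructor
    · rintro rfl; exact ⟨rfl, fun _ => rfl⟩
    · rintro ⟨h1, h2⟩
      funext q
      rcases q with i | l
      · exact h2 i
      · exact congrFun h1 l
  rw [ket_apply, productA]
  simp only [h, Finset.prod_boole, Finset.mem_univ, true_imp_iff]
  split_ifs <;> simp_all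

/-- On `S` each Hadamard gate contributes `(-1)^(zᵢ yᵢ) / √2`. Outside `S` the bits of `z` vanish
and no gate acts, so the result is again supported on `S`. -/
theorem had_ket {z : Fin m → ZMod 2} (hz : z ∈ supported S 0) :
    runCircuit ((List.finRange m).flatMap fun i => if i ∈ S then [.one .had (Sum.inl i)] else [])
      (ket (Sum.elim z 0 : Label m N → ZMod 2)) = fun x =>
      if (fun l => x (Sum.inr l)) = 0 then
        (if (fun i => x (Sum.inl i)) ∈ supported S 0 then
          ((Real.sqrt 2 : ℝ) : ℂ)⁻¹ ^ S.card * chi z (fun i => x (Sum.inl i)) else 0) else 0 := by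
  rw [ket_eq_productA, runCircuit_flatMap_local (productA N)
    (fun i φ => if i ∈ S then fun b => ∑ b', OneQubit.had.mat b b' * φ b' else φ)
    (List.nodup_finRange m)]
  · funext x
    simp only [productA, List.mem_finRange, if_true]
    congr 1
    have hfac : ∀ i, (if i ∈ S then fun b => ∑ b', OneQubit.had.mat b b' *
        (if b' = z i then 1 else 0) else fun b => if b = z i then 1 else 0 : ZMod 2 → ℂ)
        (x (Sum.inl i)) = (if x (Sum.inl i) ≠ 0 → i ∈ S then 1 else 0) *
        ((if i ∈ S then ((Real.sqrt 2 : ℝ) : ℂ)⁻¹ else 1) * sgn (z i * x (Sum.inl i))) := by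
      intro i
      have hzi := mem_supported.1 hz i
      by_cases hi : i ∈ S
      · simp only [hi, if_true, implies_true, one_mul, mul_ite, mul_one, mul_zero,
          Finset.sum_ite_eq', Finset.mem_univ, OneQubit.mat, Matrix.of_apply]
        rcases zmod_two_cases (z i) with h | h <;>
          rcases zmod_two_cases (x (Sum.inl i)) with h' | h' <;> simp [h, h']
      · have h0 : z i = 0 := by
          by_contra h; exact hi (hzi h).1
        simp only [hi, if_false, h0, zero_mul, sgn_zero, mul_one]
        rcases zmod_two_cases (x (Sum.inl i)) with h' | h' <;> simp [h']
    simp only [hfac, Finset.prod_mul_distrib, Finset.prod_boole, Finset.mem_univ, true_imp_iff]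
    rw [Finset.prod_ite_mem, Finset.univ_inter, Finset.prod_const, chi, sgn_sum]
    simp only [mem_supported, Nat.zero_le, and_true]
    split_ifs <;> simp
  · intro i _ φ
    by_cases hi : i ∈ S
    · simp only [hi, if_true, runCircuit_cons, runCircuit_nil, apply_had_productA]
    · simp [hi]

/-- The amplitudes of the pilot state. -/
noncomputable def amplitude (S : Finset (Fin m)) (w : (Fin m → ZMod 2) → ℝ) (y : Fin m → ZMod 2) :
    ℂ :=
  if y ∈ supported S 0 then ((Real.sqrt 2 : ℝ) : ℂ)⁻¹ ^ S.card * ∑ z ∈ supported S 0,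
    ((Real.sqrt (w z / ∑ z ∈ supported S 0, w z) : ℝ) : ℂ) * chi z y else 0

/-- `V k (cod z)` is the weight of all completions of `z` below position `k`, so the sum over `z` is
the same at every level; at level `m` only `z = 0` is left. -/
theorem total_weight (hstep : ∀ z i, z i = 0 → tr i (cod z) = cod (z + Pi.single i 1))
    (hV : ∀ (i : Fin m) q, V (i + 1) q = V i q + if i ∈ S then V i (tr i q) else 0) (k : ℕ)
    (hk : k ≤ m) : ∑ z ∈ supported S k, V k (cod z) = V m (cod 0) := by
  induction hk using Nat.decreasingInduction with
  | self =>
    have : supported S m = {0} := by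
      ext z
      rw [mem_supported, Finset.mem_singleton]
      constructor
      · intro h
        funext j
        by_contra hj
        have := (h j hj).2
        omega
      · rintro rfl j hj
        exact absurd rfl hj
    rw [this, Finset.sum_singleton]
  | of_succ k hk ih =>
    rw [← ih]
    have := sum_supported S ⟨k, hk⟩ fun z => V k (cod z)
    simp only at this
    rw [this]
    refine Finset.sum_congr rfl fun z hz => ?_
    have hzi : z ⟨k, hk⟩ = 0 := by
      by_contra h
      have := (mem_supported.1 hz _ h).2
      simp at this
    have := hV ⟨k, hk⟩ (cod z)
    simp only at this
    rw [this, hstep z _ hzi]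

/-- After the rotations the workspace contains the run of the automaton on `z`. It depends on `z`
alone, so the layers in opposite order erase it in every branch, and this has to happen before the
Hadamard gates mix the branches. -/
theorem circuit_run (hstep : ∀ z i, z i = 0 → tr i (cod z) = cod (z + Pi.single i 1))
    (hV0 : ∀ i q, 0 ≤ V i q)
    (hV : ∀ (i : Fin m) q, V (i + 1) q = V i q + if i ∈ S then V i (tr i q) else 0)
    (hpos : 0 < ∑ z ∈ supported S 0, V 0 (cod z)) :
    runCircuit (circuit S tr V (cod 0)) (ket 0) = fun x => if (fun l => x (Sum.inr l)) = 0 then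
      amplitude S (fun z => V 0 (cod z)) (fun i => x (Sum.inl i)) else 0 := by
  have e11 : (1 : ZMod 2) + 1 = 0 := by decide
  have htot := total_weight hstep hV 0 (Nat.zero_le _)
  have hsupp : supported S m = {0} := by
    ext z
    rw [mem_supported, Finset.mem_singleton]
    constructor
    · intro h
      funext j
      by_contra hj
      have := (h j hj).2
      omega
    · rintro rfl j hj
      exact absurd rfl hj
  have h0 : (Sum.elim 0 0 : Label m N → ZMod 2) = 0 := by funext q; rcases q with i | l <;> rfl
  have hstart : Gate.apply (ket 0) (.one .X (wire (Fin.last m) (cod 0))) =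
      partialState S V cod m := by
    rw [apply_X_ket, partialState, hsupp, Finset.sum_singleton, config_last, h0,
      div_self (htot ▸ hpos).ne']
    simp
  have hlay := layers_partialState hstep hV0 hV 0 (Nat.zero_le _)
  have hmv := fun z => moveLayers_config hstep z 0 (Nat.zero_le _)
  simp only [List.drop_zero] at hlay hmv
  rw [circuit, runCircuit_append, runCircuit_cons, runCircuit_nil, hstart, runCircuit_append, hlay,
    partialState, runCircuit_sum]
  simp only [runCircuit_append, hmv, config_last, runCircuit_cons, runCircuit_nil, apply_X_ket,
    add_assoc, ← Pi.single_add, e11, Pi.single_zero, add_zero]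
  funext x
  rw [Finset.sum_apply]
  have : ∀ z ∈ supported S 0, (((Real.sqrt (V 0 (cod z) / V m (cod 0)) : ℝ) : ℂ) • runCircuit
      ((List.finRange m).flatMap fun i => if i ∈ S then [.one .had (Sum.inl i)] else [])
      (ket (Sum.elim z 0 : Label m N → ZMod 2))) x = _ := fun z hz => by
    rw [had_ket hz, Pi.smul_apply]
  rw [Finset.sum_congr rfl this]
  simp only [amplitude, htot]
  split_ifs
  · rw [Finset.mul_sum]
    refine Finset.sum_congr rfl fun z _ => ?_
    simp only [smul_eq_mul]; ring
  · simp
  · simp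

theorem circuit_valid (hV0 : ∀ i q, 0 ≤ V i q)
    (hV : ∀ (i : Fin m) q, V (i + 1) q = V i q + if i ∈ S then V i (tr i q) else 0) (q₀ : Fin N) :
    ∀ g ∈ circuit S tr V q₀, g.Valid := by
  have hne : ∀ (i : Fin m) (q q' : Fin N), wire i.succ q ≠ wire i.castSucc q' := fun i q q' h =>
    absurd (congrArg Fin.val (wire_inj.1 h).1) (by simp)
  have hinl : ∀ (i : Fin m) l (q' : Fin N), wire l q' ≠ (Sum.inl i : Label m N) :=
    fun i l q' => by simp [wire]
  have hmove : ∀ i, ∀ g ∈ moveLayer tr i, g.Valid := by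
    intro i g hg
    simp only [moveLayer, List.mem_flatMap, List.mem_finRange, true_and, List.mem_cons,
      List.not_mem_nil, or_false] at hg
    obtain ⟨q, rfl | rfl | rfl⟩ := hg
    · exact ⟨trivial, hne _ _ _⟩
    · exact ⟨hinl _ _ _, hne _ _ _, (hinl _ _ _).symm⟩
    · exact ⟨hinl _ _ _, hne _ _ _, (hinl _ _ _).symm⟩
  intro g hg
  simp only [circuit, List.mem_append, List.mem_cons, List.not_mem_nil, or_false,
    List.mem_flatMap, List.mem_reverse, List.mem_finRange, true_and] at hg
  rcases hg with rfl | ⟨i, hg | hg⟩ | ⟨i, hg⟩ | rfl | ⟨i, hg⟩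
  · trivial
  · simp only [rotLayer, List.mem_flatMap, List.mem_finRange, true_and] at hg
    obtain ⟨q, hg⟩ := hg
    split_ifs at hg with h
    · rw [List.mem_singleton] at hg
      subst hg
      refine ⟨?_, hinl _ _ _⟩
      -- The recursion for `V` says exactly that the squares of the two rotation parameters add up
      -- to one.
      have := hV i q
      rw [if_pos h.1] at this
      simp only [OneQubit.Valid]
      rw [Real.sq_sqrt (div_nonneg (hV0 _ _) (hV0 _ _)),
        Real.sq_sqrt (div_nonneg (hV0 _ _) (hV0 _ _)), ← add_div, ← this, div_self h.2.ne']
    · simp at hg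
  · exact hmove i g hg
  · exact hmove i g hg
  · trivial
  · split_ifs at hg
    · rw [List.mem_singleton] at hg; subst hg; trivial
    · simp at hg

end Pilot

/-! ## The circuit of Hamiltonian Decoded Quantum Interferometry -/

/-- The tensor product of one-qubit operators. -/
noncomputable def tensor {n : ℕ} (A : Fin n → Matrix (ZMod 2) (ZMod 2) ℂ) :
    Matrix (Fin n → ZMod 2) (Fin n → ZMod 2) ℂ :=
  Matrix.of fun x y => ∏ j, A j (x j) (y j)

theorem tensor_mul {n : ℕ} (A A' : Fin n → Matrix (ZMod 2) (ZMod 2) ℂ) :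
    tensor A * tensor A' = tensor fun j => A j * A' j := by
  ext x y
  simp only [tensor, Matrix.mul_apply, Matrix.of_apply, ← Finset.prod_mul_distrib]
  exact (Fintype.prod_sum fun j c => A j (x j) c * A' j c (y j)).symm

theorem tensor_smul {n : ℕ} (c : Fin n → ℂ) (A : Fin n → Matrix (ZMod 2) (ZMod 2) ℂ) :
    tensor (fun j => c j • A j) = (∏ j, c j) • tensor A := by
  ext x y
  simp [tensor, Finset.prod_mul_distrib]

theorem tensor_one {n : ℕ} : tensor (fun _ : Fin n => 1) = 1 := by
  ext x y
  simp only [tensor, Matrix.of_apply, Matrix.one_apply, Finset.prod_boole, Finset.mem_univ,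
    true_imp_iff, funext_iff]

theorem trace_tensor {n : ℕ} (A : Fin n → Matrix (ZMod 2) (ZMod 2) ℂ) :
    (tensor A).trace = ∏ j, (A j).trace := by
  simp only [Matrix.trace, tensor, Matrix.diag_apply, Matrix.of_apply]
  exact (Fintype.prod_sum fun j c => A j c c).symm

/-! ### Weyl and Pauli operators -/

/-- The operator `XˣZᶻ` on one qubit. -/
noncomputable def weyl (x z : ZMod 2) : Matrix (ZMod 2) (ZMod 2) ℂ :=
  Matrix.of fun b c => if b = c + x then sgn (z * c) else 0

theorem weyl_zero : weyl 0 0 = 1 := by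
  ext b c; simp [weyl, Matrix.one_apply]

theorem weyl_mul (x z x' z' : ZMod 2) :
    weyl x z * weyl x' z' = sgn (z * x') • weyl (x + x') (z + z') := by
  ext b c
  simp only [weyl, Matrix.mul_apply, Matrix.of_apply, Matrix.smul_apply, smul_eq_mul, mul_ite,
    mul_zero, Finset.sum_ite_eq', Finset.mem_univ, if_true]
  by_cases h : b = c + x' + x
  · rw [if_pos h, if_pos (by rw [h]; ring), ← sgn_add, ← sgn_add]
    congr 1; ring
  · rw [if_neg h, if_neg (by rw [add_comm x, ← add_assoc]; exact h), zero_mul]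

theorem trace_weyl {x z : ZMod 2} (h : ¬ (x = 0 ∧ z = 0)) : (weyl x z).trace = 0 := by
  rcases zmod_two_cases x with rfl | rfl <;> rcases zmod_two_cases z with rfl | rfl <;>
    simp_all [weyl, Matrix.trace, sum_zmod_two]

namespace Pauli

open Classical in
theorem mat_eq_weyl (P : Pauli) : ∃ θ : ℂ, P.mat = θ • weyl P.xBit P.zBit := by
  have e11 : (1 : ZMod 2) + 1 = 0 := by decide
  refine ⟨if P = .Y then Complex.I else 1, ?_⟩
  ext b c
  cases P <;> rcases zmod_two_cases b with rfl | rfl <;> rcases zmod_two_cases c with rfl | rfl <;>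
    simp [mat, weyl, xBit, zBit, e11]

theorem mat_mul_self (P : Pauli) : P.mat * P.mat = 1 := by
  ext b c
  cases P <;> rcases zmod_two_cases b with rfl | rfl <;> rcases zmod_two_cases c with rfl | rfl <;>
    simp [mat, Matrix.mul_apply, sum_zmod_two]

theorem mat_conjTranspose (P : Pauli) : P.matᴴ = P.mat := by
  ext b c
  cases P <;> rcases zmod_two_cases b with rfl | rfl <;> rcases zmod_two_cases c with rfl | rfl <;>
    simp [mat, Matrix.conjTranspose_apply]

theorem mat_I : Pauli.I.mat = 1 := by
  ext b c; simp [mat, Matrix.one_apply]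

end Pauli

theorem pauliString_eq_tensor {n : ℕ} (P : Fin n → Pauli) :
    pauliString P = tensor fun j => (P j).mat := rfl

theorem pauliString_mul_self {n : ℕ} (P : Fin n → Pauli) :
    pauliString P * pauliString P = 1 := by
  simp only [pauliString_eq_tensor, tensor_mul, Pauli.mat_mul_self, tensor_one]

theorem pauliString_conjTranspose {n : ℕ} (P : Fin n → Pauli) :
    (pauliString P)ᴴ = pauliString P := by
  ext x y
  rw [Matrix.conjTranspose_apply]
  simp only [pauliString, Matrix.of_apply, star_prod]
  refine Finset.prod_congr rfl fun j _ => ?_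
  rw [← Matrix.conjTranspose_apply, Pauli.mat_conjTranspose]

namespace PauliHamiltonian

variable {n m : ℕ} (H : PauliHamiltonian n m)

/-- The product of the operators at qubit `j` of the terms selected by `y`. -/
noncomputable def qubitProd (y : Fin m → ZMod 2) (l : List (Fin m)) (j : Fin n) :
    Matrix (ZMod 2) (ZMod 2) ℂ :=
  (l.map fun i => if y i = 1 then (H.term i j).mat else 1).reverse.prod

/-- The product of the signs of the terms selected by `y`. -/
noncomputable def signProd (y : Fin m → ZMod 2) : ℂ :=
  ∏ i, if y i = 1 then (((H.sign i : ℤˣ) : ℤ) : ℂ) else 1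

/-- The product of the signed terms selected by `y`. -/
noncomputable def termProd (y : Fin m → ZMod 2) : Matrix (Fin n → ZMod 2) (Fin n → ZMod 2) ℂ :=
  H.signProd y • tensor (H.qubitProd y (List.finRange m))

/-- Products of Weyl operators are Weyl operators up to a scalar, with exponents added modulo two;
adding the bits of the selected terms gives the entries of `Bᵀy` at qubit `j`. -/
theorem qubitProd_eq_weyl (y : Fin m → ZMod 2) (j : Fin n) :
    ∃ θ : ℂ, H.qubitProd y (List.finRange m) j =
      θ • weyl ((H.checkMatrix *ᵥ y) (Sum.inl j)) ((H.checkMatrix *ᵥ y) (Sum.inr j)) := by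
  have key : ∀ l : List (Fin m), ∃ θ : ℂ, H.qubitProd y l j =
      θ • weyl (l.map fun i => (H.term i j).xBit * y i).sum
        (l.map fun i => (H.term i j).zBit * y i).sum := by
    intro l
    induction l with
    | nil => exact ⟨1, by simp [qubitProd, weyl_zero]⟩
    | cons i l ih =>
      obtain ⟨θ, hθ⟩ := ih
      rcases zmod_two_cases (y i) with h | h
      · refine ⟨θ, ?_⟩
        rw [qubitProd] at hθ ⊢
        simp [h, hθ]
      · obtain ⟨θ', hθ'⟩ := (H.term i j).mat_eq_weyl
        rw [qubitProd] at hθ ⊢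
        simp only [List.map_cons, h, if_true, List.reverse_cons, List.prod_append,
          List.prod_singleton, hθ, hθ', smul_mul_smul_comm, weyl_mul, smul_smul, List.sum_cons,
          mul_one]
        rw [add_comm (H.term i j).xBit, add_comm (H.term i j).zBit]
        exact ⟨_, rfl⟩
  obtain ⟨θ, hθ⟩ := key (List.finRange m)
  refine ⟨θ, ?_⟩
  rw [hθ]
  simp [checkMatrix, symp, Matrix.mulVec, dotProduct, Fin.sum_univ_def]

end PauliHamiltonian

/-! ### Amplitudes on pairs of qubits as matrices, and the action of the circuit on them -/

namespace HDQI

variable {n m a : ℕ}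

/-- The state in which register `A` contains `y`, the workspace is zero, and the amplitudes on the
registers `B` and `C` are the entries of a tensor product. -/
noncomputable def bellState (a : ℕ) (y : Fin m → ZMod 2) (A : Fin n → Matrix (ZMod 2) (ZMod 2) ℂ) :
    (Qubit m n a → ZMod 2) → ℂ :=
  fun x => if (fun i => x (Qubit.A i)) = y ∧ (fun l => x (Qubit.W l)) = 0 then
    ∏ j, A j (x (Qubit.B j)) (x (Qubit.C j)) else 0

theorem bellState_smul (y : Fin m → ZMod 2) (c : Fin n → ℂ)
    (A : Fin n → Matrix (ZMod 2) (ZMod 2) ℂ) :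
    bellState a y (fun j => c j • A j) = (∏ j, c j) • bellState a y A := by
  funext x
  simp only [bellState, Pi.smul_apply, Matrix.smul_apply, smul_eq_mul, Finset.prod_mul_distrib,
    mul_ite, mul_zero]

/-- The other pairs contribute a factor `r` that does not see pair `j`. Gates on this pair thus
become operations on the `2 × 2` matrix `M`. -/
theorem bellState_factor (y : Fin m → ZMod 2) (A : Fin n → Matrix (ZMod 2) (ZMod 2) ℂ)
    (j : Fin n) : ∃ r : (Qubit m n a → ZMod 2) → ℂ,
      (∀ M, bellState a y (Function.update A j M) =
        fun x => r x * M (x (Qubit.B j)) (x (Qubit.C j))) ∧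
      (∀ x b, r (Function.update x (Qubit.B j) b) = r x) ∧
      (∀ x b, r (Function.update x (Qubit.C j) b) = r x) ∧
      ∀ x, r x ≠ 0 → ∀ i, x (Qubit.A i) = y i := by
  refine ⟨fun x => if (fun i => x (Qubit.A i)) = y ∧ (fun l => x (Qubit.W l)) = 0 then
    ∏ k ∈ Finset.univ.erase j, A k (x (Qubit.B k)) (x (Qubit.C k)) else 0, ?_, ?_, ?_, ?_⟩
  · intro M
    funext x
    simp only [bellState]
    split_ifs
    · rw [← Finset.mul_prod_erase _ _ (Finset.mem_univ j), Function.update_self, mul_comm]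
      congr 1
      exact Finset.prod_congr rfl fun k hk => by
        rw [Function.update_of_ne (Finset.ne_of_mem_erase hk)]
    · simp
  · intro x b
    have h1 : ∀ i, Function.update x (Qubit.B j) b (Qubit.A i) = x (Qubit.A i) := fun i => by
      simp [Qubit.A, Qubit.B]
    have h2 : ∀ i, Function.update x (Qubit.B j) b (Qubit.W i) = x (Qubit.W i) := fun i => by
      simp [Qubit.W, Qubit.B]
    have h3 : ∀ i, Function.update x (Qubit.B j) b (Qubit.C i) = x (Qubit.C i) := fun i => by
      simp [Qubit.C, Qubit.B]
    simp only [h1, h2, h3]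
    congr 1
    refine Finset.prod_congr rfl fun k hk => ?_
    have := Finset.ne_of_mem_erase hk
    rw [Function.update_of_ne]
    simpa [Qubit.B] using this
  · intro x b
    have h1 : ∀ i, Function.update x (Qubit.C j) b (Qubit.A i) = x (Qubit.A i) := fun i => by
      simp [Qubit.A, Qubit.C]
    have h2 : ∀ i, Function.update x (Qubit.C j) b (Qubit.W i) = x (Qubit.W i) := fun i => by
      simp [Qubit.W, Qubit.C]
    have h3 : ∀ i, Function.update x (Qubit.C j) b (Qubit.B i) = x (Qubit.B i) := fun i => by
      simp [Qubit.C, Qubit.B]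
    simp only [h1, h2, h3]
    congr 1
    refine Finset.prod_congr rfl fun k hk => ?_
    have := Finset.ne_of_mem_erase hk
    rw [Function.update_of_ne (a := Qubit.C k)]
    simpa [Qubit.C] using this
  · intro x hx i
    by_contra h
    refine hx (if_neg fun h' => h ?_)
    rw [← h'.1]

theorem apply_one_factor {r : (Qubit m n a → ZMod 2) → ℂ} {j : Fin n}
    (hr : ∀ x b, r (Function.update x (Qubit.B j) b) = r x) (u : Matrix (ZMod 2) (ZMod 2) ℂ)
    (M : Matrix (ZMod 2) (ZMod 2) ℂ) :
    Gate.applyAt u (Qubit.B j) (fun x => r x * M (x (Qubit.B j)) (x (Qubit.C j))) =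
      fun x => r x * (u * M) (x (Qubit.B j)) (x (Qubit.C j)) := by
  funext x
  have h3 : ∀ b, Function.update x (Qubit.B j) b (Qubit.C j) = x (Qubit.C j) := fun b => by
    simp [Qubit.C, Qubit.B]
  simp only [Gate.applyAt, hr, Function.update_self, h3, Matrix.mul_apply, Finset.mul_sum]
  exact Finset.sum_congr rfl fun b _ => by ring

theorem apply_cnot_factor {r : (Qubit m n a → ZMod 2) → ℂ} {j : Fin n}
    (hr : ∀ x b, r (Function.update x (Qubit.C j) b) = r x) (M : Matrix (ZMod 2) (ZMod 2) ℂ) :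
    Gate.apply (fun x => r x * M (x (Qubit.B j)) (x (Qubit.C j)))
      (.ctrl .X (Qubit.B j) (Qubit.C j)) =
      fun x => r x * (Matrix.of fun b c => M b (c + b)) (x (Qubit.B j)) (x (Qubit.C j)) := by
  funext x
  have h3 : ∀ b, Function.update x (Qubit.C j) b (Qubit.B j) = x (Qubit.B j) := fun b => by
    simp [Qubit.C, Qubit.B]
  have e11 : (1 : ZMod 2) + 1 = 0 := by decide
  simp only [Gate.apply, Gate.applyAt, hr, Function.update_self, h3, Matrix.of_apply,
    sum_zmod_two, OneQubit.mat, Pauli.mat]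
  rcases zmod_two_cases (x (Qubit.B j)) with h | h <;>
    rcases zmod_two_cases (x (Qubit.C j)) with h' | h' <;> simp [h, h', e11]

/-- The effect of the preparation of a Bell pair. -/
noncomputable def prepMap (M : Matrix (ZMod 2) (ZMod 2) ℂ) : Matrix (ZMod 2) (ZMod 2) ℂ :=
  Matrix.of fun b c => (OneQubit.had.mat * M) b (c + b)

/-- The effect of the coherent Bell measurement of a pair. -/
noncomputable def measureMap (M : Matrix (ZMod 2) (ZMod 2) ℂ) : Matrix (ZMod 2) (ZMod 2) ℂ :=
  OneQubit.had.mat * Matrix.of fun b c => M b (c + b)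

theorem bellPrep_run (y : Fin m → ZMod 2) (A : Fin n → Matrix (ZMod 2) (ZMod 2) ℂ) :
    runCircuit (bellPrep m n a) (bellState a y A) = bellState a y fun j => prepMap (A j) := by
  rw [bellPrep, runCircuit_flatMap_local (bellState a y) (fun _ => prepMap) (List.nodup_finRange n)]
  · simp
  · intro j _ A
    obtain ⟨r, h1, h2, h3, -⟩ := bellState_factor (a := a) y A j
    conv_lhs => rw [← Function.update_eq_self j A]
    rw [h1, h1, runCircuit_cons, runCircuit_cons, runCircuit_nil]
    rw [show Gate.apply (fun x => r x * A j (x (Qubit.B j)) (x (Qubit.C j)))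
      (.one .had (Qubit.B j)) = _ from apply_one_factor h2 _ _, apply_cnot_factor h3]
    rfl

theorem bellMeasure_run (y : Fin m → ZMod 2) (A : Fin n → Matrix (ZMod 2) (ZMod 2) ℂ) :
    runCircuit (bellMeasure m n a) (bellState a y A) = bellState a y fun j => measureMap (A j) := by
  rw [bellMeasure, runCircuit_flatMap_local (bellState a y) (fun _ => measureMap)
    (List.nodup_finRange n)]
  · simp
  · intro j _ A
    obtain ⟨r, h1, h2, h3, -⟩ := bellState_factor (a := a) y A j
    conv_lhs => rw [← Function.update_eq_self j A]
    rw [h1, h1, runCircuit_cons, runCircuit_cons, runCircuit_nil, apply_cnot_factor h3]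
    exact apply_one_factor h2 _ _

/-- The matrix with the single entry `1` in place `(z, x)`. -/
noncomputable def unit (z x : ZMod 2) : Matrix (ZMod 2) (ZMod 2) ℂ :=
  Matrix.of fun b c => if b = z ∧ c = x then 1 else 0

/-- The Bell basis consists of the Weyl operators, read as amplitudes, up to the factor `1/√2` and
signs. -/
theorem prepMap_unit (z x : ZMod 2) :
    prepMap (unit z x) = (((Real.sqrt 2 : ℝ) : ℂ)⁻¹ * sgn (z * x)) • weyl x z := by
  have e11 : (1 : ZMod 2) + 1 = 0 := by decide
  ext b c
  simp only [prepMap, unit, weyl, OneQubit.mat, Matrix.mul_apply, Matrix.of_apply, sum_zmod_two,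
    Matrix.smul_apply, smul_eq_mul]
  rcases zmod_two_cases z with rfl | rfl <;> rcases zmod_two_cases x with rfl | rfl <;>
    rcases zmod_two_cases b with rfl | rfl <;> rcases zmod_two_cases c with rfl | rfl <;>
    simp [e11]

theorem sqrt_two_ne_zero : ((Real.sqrt 2 : ℝ) : ℂ) ≠ 0 := by
  rw [Complex.ofReal_ne_zero]; positivity

theorem sqrt_two_mul_self : ((Real.sqrt 2 : ℝ) : ℂ) * ((Real.sqrt 2 : ℝ) : ℂ) = 2 := by
  rw [← Complex.ofReal_mul, Real.mul_self_sqrt (by norm_num)]; norm_num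

theorem measureMap_weyl (z x : ZMod 2) :
    measureMap (weyl x z) = (((Real.sqrt 2 : ℝ) : ℂ) * sgn (z * x)) • unit z x := by
  have e11 : (1 : ZMod 2) + 1 = 0 := by decide
  have h2 : ((Real.sqrt 2 : ℝ) : ℂ)⁻¹ + ((Real.sqrt 2 : ℝ) : ℂ)⁻¹ = ((Real.sqrt 2 : ℝ) : ℂ) := by
    have := sqrt_two_ne_zero
    field_simp
    rw [pow_two, sqrt_two_mul_self]; norm_num
  ext b c
  simp only [measureMap, unit, weyl, OneQubit.mat, Matrix.mul_apply, Matrix.of_apply, sum_zmod_two,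
    Matrix.smul_apply, smul_eq_mul]
  rcases zmod_two_cases z with rfl | rfl <;> rcases zmod_two_cases x with rfl | rfl <;>
    rcases zmod_two_cases b with rfl | rfl <;> rcases zmod_two_cases c with rfl | rfl <;>
    simp [e11, h2]
  linear_combination (-1 : ℂ) * h2

theorem bellState_unit (y : Fin m → ZMod 2) (z x : Fin n → ZMod 2) :
    bellState a y (fun j => unit (z j) (x j)) = ket (Qubit.join y z x 0) := by
  funext q
  have h : q = Qubit.join y z x 0 ↔ ((fun i => q (Qubit.A i)) = y ∧ (fun l => q (Qubit.W l)) = 0) ∧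
      ∀ j, q (Qubit.B j) = z j ∧ q (Qubit.C j) = x j := by
    constructor
    · rintro rfl; exact ⟨⟨rfl, rfl⟩, fun _ => ⟨rfl, rfl⟩⟩
    · rintro ⟨⟨h1, h2⟩, h3⟩
      funext i
      rcases i with i | i | i | i
      · exact congrFun h1 i
      · exact (h3 i).1
      · exact (h3 i).2
      · exact congrFun h2 i
  rw [ket_apply, bellState]
  simp only [h, unit, Matrix.of_apply, Finset.prod_boole, Finset.mem_univ, true_imp_iff]
  split_ifs <;> simp_all

theorem signPhases_run (H : PauliHamiltonian n m) (y : Fin m → ZMod 2)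
    (A : Fin n → Matrix (ZMod 2) (ZMod 2) ℂ) :
    runCircuit (signPhases a H) (bellState a y A) = H.signProd y • bellState a y A := by
  have hgate : ∀ i, runCircuit (if H.sign i = -1 then [.one .Z (Qubit.A i)] else [])
      (bellState a y A) = (if y i = 1 then (((H.sign i : ℤˣ) : ℤ) : ℂ) else 1) •
        bellState a y A := by
    intro i
    rcases Int.units_eq_one_or (H.sign i) with h | h
    · have : ¬ (1 : ℤˣ) = -1 := by decide
      simp [h, this]
    · simp only [h, if_true, runCircuit_cons, runCircuit_nil, Gate.apply]
      funext x
      have hd : ∑ b, OneQubit.Z.mat (x (Qubit.A i)) b *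
          bellState a y A (Function.update x (Qubit.A i) b) =
          sgn (x (Qubit.A i)) * bellState a y A x := by
        rw [Finset.sum_eq_single (x (Qubit.A i))]
        · rw [Function.update_eq_self]
          rcases zmod_two_cases (x (Qubit.A i)) with h' | h' <;>
            simp [OneQubit.mat, Pauli.mat, h']
        · intro b _ hb
          simp [OneQubit.mat, Pauli.mat, Ne.symm hb]
        · simp
      refine (show Gate.applyAt OneQubit.Z.mat (Qubit.A i) (bellState a y A) x = _ from hd).trans ?_
      rw [Pi.smul_apply, smul_eq_mul]
      by_cases hx : x (Qubit.A i) = y i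
      · rw [hx]
        rcases zmod_two_cases (y i) with h' | h' <;> simp [h']
      · have : bellState a y A x = 0 := if_neg fun h' => hx (by rw [← h'.1])
        simp [this]
  have key : ∀ l : List (Fin m), runCircuit (l.flatMap fun i =>
      if H.sign i = -1 then [.one .Z (Qubit.A i)] else []) (bellState a y A) =
      (l.map fun i => if y i = 1 then (((H.sign i : ℤˣ) : ℤ) : ℂ) else 1).prod •
        bellState a y A := by
    intro l
    induction l with
    | nil => simp
    | cons i l ih =>
      rw [List.flatMap_cons, runCircuit_append, hgate, runCircuit_smul, ih, smul_smul,
        List.map_cons, List.prod_cons]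
  rw [signPhases, key, PauliHamiltonian.signProd, Fin.prod_univ_def]

theorem controlledPauli_run (P : Pauli) (i : Fin m) (j : Fin n) (y : Fin m → ZMod 2)
    (A : Fin n → Matrix (ZMod 2) (ZMod 2) ℂ) :
    runCircuit (controlledPauli (Qubit.A i) (Qubit.B j) P) (bellState a y A) =
      bellState a y (Function.update A j (if y i = 1 then P.mat * A j else A j)) := by
  obtain ⟨r, h1, h2, -, h4⟩ := bellState_factor (a := a) y A j
  have hgate : ∀ u : OneQubit ℝ, u.mat = P.mat →
      Gate.apply (bellState a y A) (.ctrl u (Qubit.A i) (Qubit.B j)) =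
      bellState a y (Function.update A j (if y i = 1 then P.mat * A j else A j)) := by
    intro u hu
    conv_lhs => rw [← Function.update_eq_self j A]
    rw [h1, h1]
    funext x
    simp only [Gate.apply, apply_one_factor h2, hu]
    by_cases hr : r x = 0
    · simp [hr]
    · rw [h4 x hr i]
      split_ifs <;> rfl
  cases P
  · simp [controlledPauli, Pauli.mat_I]
  · exact hgate .X rfl
  · exact hgate .Y rfl
  · exact hgate .Z rfl

theorem controlledTerms_run (H : PauliHamiltonian n m) (y : Fin m → ZMod 2)
    (A : Fin n → Matrix (ZMod 2) (ZMod 2) ℂ) :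
    runCircuit (controlledTerms a H) (bellState a y A) =
      bellState a y fun j => H.qubitProd y (List.finRange m) j * A j := by
  have key : ∀ (l : List (Fin m)) (A : Fin n → Matrix (ZMod 2) (ZMod 2) ℂ),
      runCircuit (l.flatMap fun i => (List.finRange n).flatMap fun j =>
        controlledPauli (Qubit.A i) (Qubit.B j) (H.term i j)) (bellState a y A) =
      bellState a y fun j => H.qubitProd y l j * A j := by
    intro l
    induction l with
    | nil => intro A; simp [PauliHamiltonian.qubitProd]
    | cons i l ih =>
      intro A
      rw [List.flatMap_cons, runCircuit_append, runCircuit_flatMap_local (bellState a y)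
        (fun j M => if y i = 1 then (H.term i j).mat * M else M) (List.nodup_finRange n)
        (fun j _ A => controlledPauli_run _ _ _ _ _), ih]
      congr 1
      funext j
      simp only [List.mem_finRange, if_true, PauliHamiltonian.qubitProd, List.map_cons,
        List.reverse_cons, List.prod_append, List.prod_singleton, mul_assoc]
      split_ifs <;> simp
  exact key _ A

/-- The circuit after the preparation of the pilot state, on a basis state of register `A`. -/
theorem tail_run (H : PauliHamiltonian n m) (decoder : List (Gate (Qubit m n a) ℝ))
    {y : Fin m → ZMod 2} (hdec : Decodes H decoder {y}) :
    runCircuit (bellPrep m n a ++ signPhases a H ++ controlledTerms a H ++ bellMeasure m n a ++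
      decoder ++ bellPrep m n a) (ket (Qubit.join y 0 0 0)) =
    (((Real.sqrt 2 : ℝ) : ℂ)⁻¹ ^ n * H.signProd y) •
      bellState a 0 (H.qubitProd y (List.finRange m)) := by
  choose θ hθ using H.qubitProd_eq_weyl y
  have hA : H.qubitProd y (List.finRange m) = fun j => θ j •
      weyl ((H.checkMatrix *ᵥ y) (Sum.inl j)) ((H.checkMatrix *ᵥ y) (Sum.inr j)) := funext hθ
  have h0 : ket (Qubit.join y 0 0 0) = bellState a y (fun _ : Fin n => unit 0 0) :=
    (bellState_unit y 0 0).symm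
  have hone : (weyl 0 0) = 1 := weyl_zero
  simp only [runCircuit_append, h0, bellPrep_run, prepMap_unit, signPhases_run, runCircuit_smul,
    controlledTerms_run, hone, mul_zero, sgn_zero, mul_one, Matrix.mul_smul]
  rw [hA]
  simp only [bellState_smul, runCircuit_smul, bellMeasure_run, measureMap_weyl, bellState_unit,
    smul_smul]
  -- The measurement has left the pairs in the basis state `Bᵀy`, so the decoder clears register
  -- `A`; undoing the measurement restores the product of terms on `BC`.
  rw [hdec y rfl, ← bellState_unit]
  simp only [bellPrep_run, prepMap_unit, bellState_smul, smul_smul]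
  congr 1
  -- The scalars of the measurement and of its reversal cancel pair by pair. The phases `θ j` occur
  -- on both sides.
  have hprod : (∏ j, ((Real.sqrt 2 : ℝ) : ℂ) * sgn ((H.checkMatrix *ᵥ y) (Sum.inr j) *
      (H.checkMatrix *ᵥ y) (Sum.inl j))) * (∏ j, ((Real.sqrt 2 : ℝ) : ℂ)⁻¹ *
      sgn ((H.checkMatrix *ᵥ y) (Sum.inr j) * (H.checkMatrix *ᵥ y) (Sum.inl j))) = 1 := by
    rw [← Finset.prod_mul_distrib]
    refine Finset.prod_eq_one fun j _ => ?_
    rw [mul_mul_mul_comm, sgn_mul_self, mul_inv_cancel₀ sqrt_two_ne_zero, one_mul]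
  have hθ' : ∏ j, ((Real.sqrt 2 : ℝ) : ℂ)⁻¹ * θ j = ((Real.sqrt 2 : ℝ) : ℂ)⁻¹ ^ n * ∏ j, θ j := by
    simp [Finset.prod_mul_distrib]
  linear_combination (H.signProd y * ∏ j, ((Real.sqrt 2 : ℝ) : ℂ)⁻¹ * θ j) * hprod +
    H.signProd y * hθ'

/-- Linearity reduces everything to single `y`. The decoder is used only where the amplitude may be
nonzero, so errors outside `Y` do not matter. -/
theorem circuit_run (H : PauliHamiltonian n m) (pilot : List (Gate (Fin m ⊕ Fin a) ℝ))
    (decoder : List (Gate (Qubit m n a) ℝ)) (Y : Set (Fin m → ZMod 2)) (c : (Fin m → ZMod 2) → ℂ)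
    (hc : ∀ y, y ∉ Y → c y = 0)
    (hpilot : runCircuit pilot (ket 0) = fun x => if (fun l => x (Sum.inr l)) = 0 then
      c (fun i => x (Sum.inl i)) else 0) (hdec : Decodes H decoder Y) :
    runCircuit (circuit H pilot decoder) (ket 0) = ∑ y, c y •
      ((((Real.sqrt 2 : ℝ) : ℂ)⁻¹ ^ n * H.signProd y) •
        bellState a 0 (H.qubitProd y (List.finRange m))) := by
  classical
  have hinj : Function.Injective (Sum.elim Qubit.A Qubit.W : Fin m ⊕ Fin a → Qubit m n a) := by
    rintro (i | i) (j | j) h <;> simp_all [Qubit.A, Qubit.W]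
  let φ : (Qubit m n a → ZMod 2) → ℂ := fun x =>
    if (fun j => x (Qubit.B j)) = 0 ∧ (fun j => x (Qubit.C j)) = 0 then 1 else 0
  have hφ : ∀ x q b, φ (Function.update x ((Sum.elim Qubit.A Qubit.W : Fin m ⊕ Fin a → _) q) b) =
      φ x := by
    rintro x (i | i) b <;> refine if_congr ?_ rfl rfl <;>
      simp [Qubit.A, Qubit.B, Qubit.C, Qubit.W]
  have hket : (ket 0 : (Qubit m n a → ZMod 2) → ℂ) =
      fun x => ket 0 (x ∘ Sum.elim Qubit.A Qubit.W) * φ x := by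
    funext x
    have h : x = 0 ↔ x ∘ Sum.elim Qubit.A Qubit.W = 0 ∧ (fun j => x (Qubit.B j)) = 0 ∧
        (fun j => x (Qubit.C j)) = 0 := by
      constructor
      · rintro rfl; exact ⟨rfl, rfl, rfl⟩
      · rintro ⟨h1, h2, h3⟩
        funext i
        rcases i with i | i | i | i
        · exact congrFun h1 (Sum.inl i)
        · exact congrFun h2 i
        · exact congrFun h3 i
        · exact congrFun h1 (Sum.inr i)
    rw [ket_apply, ket_apply]
    simp only [h, φ]
    split_ifs <;> simp_all
  have hstart : runCircuit (pilot.map (Gate.relabel (Sum.elim Qubit.A Qubit.W))) (ket 0) =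
      ∑ y, c y • ket (Qubit.join y 0 0 0 : Qubit m n a → ZMod 2) := by
    rw [hket, runCircuit_relabel hinj _ _ _ hφ, hpilot]
    funext x
    rw [Finset.sum_apply, Finset.sum_eq_single (fun i => x (Qubit.A i))]
    · rw [Pi.smul_apply, ← bellState_unit]
      simp only [bellState, unit, Pi.zero_apply, Matrix.of_apply, Finset.prod_boole,
        Finset.mem_univ, true_imp_iff, φ, Function.comp_apply, Sum.elim_inl, Sum.elim_inr,
        true_and, smul_eq_mul, funext_iff, forall_and]
      split_ifs <;> simp_all
    · intro y _ hy
      rw [Pi.smul_apply, ← bellState_unit, bellState, if_neg, smul_zero]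
      exact fun h => hy h.1.symm
    · simp
  have hassoc : circuit H pilot decoder = pilot.map (Gate.relabel (Sum.elim Qubit.A Qubit.W)) ++
      (bellPrep m n a ++ signPhases a H ++ controlledTerms a H ++ bellMeasure m n a ++
      decoder ++ bellPrep m n a) := by
    simp [circuit]
  rw [hassoc, runCircuit_append, hstart, runCircuit_sum]
  refine Finset.sum_congr rfl fun y _ => ?_
  by_cases hy : y ∈ Y
  · rw [tail_run H decoder]
    rintro _ rfl
    exact hdec _ hy
  · rw [hc y hy, zero_smul, zero_smul]

/-- Up to the factor `2^(-n/2)` the final amplitudes on `BC` are the entries of `∑ c_y termProd y`,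
and the other registers are `0`. Tracing out `C` sums over the column index. -/
theorem reducedB_circuit (H : PauliHamiltonian n m) (pilot : List (Gate (Fin m ⊕ Fin a) ℝ))
    (decoder : List (Gate (Qubit m n a) ℝ)) (Y : Set (Fin m → ZMod 2)) (c : (Fin m → ZMod 2) → ℂ)
    (hc : ∀ y, y ∉ Y → c y = 0)
    (hpilot : runCircuit pilot (ket 0) = fun x => if (fun l => x (Sum.inr l)) = 0 then
      c (fun i => x (Sum.inl i)) else 0) (hdec : Decodes H decoder Y) :
    reducedB (runCircuit (circuit H pilot decoder) (ket 0)) =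
      ((2 : ℂ)⁻¹ ^ n) • ((∑ y, c y • H.termProd y) * (∑ y, c y • H.termProd y)ᴴ) := by
  rw [circuit_run H pilot decoder Y c hc hpilot hdec]
  set M := ∑ y, c y • H.termProd y with hM
  have hval : ∀ (xA : Fin m → ZMod 2) (b xC : Fin n → ZMod 2) (xW : Fin a → ZMod 2), (∑ y, c y •
      ((((Real.sqrt 2 : ℝ) : ℂ)⁻¹ ^ n * H.signProd y) •
        bellState a 0 (H.qubitProd y (List.finRange m)))) (Qubit.join xA b xC xW) =
      if xA = 0 ∧ xW = 0 then ((Real.sqrt 2 : ℝ) : ℂ)⁻¹ ^ n * M b xC else 0 := by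
    intro xA b xC xW
    have hb : ∀ A : Fin n → Matrix (ZMod 2) (ZMod 2) ℂ,
        bellState a 0 A (Qubit.join xA b xC xW) = if xA = 0 ∧ xW = 0 then tensor A b xC else 0 :=
      fun A => rfl
    simp only [Finset.sum_apply, Pi.smul_apply, hb, smul_eq_mul, hM, Matrix.sum_apply,
      Matrix.smul_apply, PauliHamiltonian.termProd]
    split_ifs
    · rw [Finset.mul_sum]
      exact Finset.sum_congr rfl fun y _ => by ring
    · simp
  ext b b'
  simp only [reducedB, Matrix.of_apply, hval, Matrix.smul_apply, Matrix.mul_apply,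
    Matrix.conjTranspose_apply, smul_eq_mul]
  rw [Finset.sum_eq_single 0, Finset.mul_sum]
  · refine Finset.sum_congr rfl fun x _ => ?_
    rw [Finset.sum_eq_single 0]
    · simp only [and_self, if_true, star_mul', star_pow, star_inv₀]
      have h2 : star ((Real.sqrt 2 : ℝ) : ℂ) = ((Real.sqrt 2 : ℝ) : ℂ) := Complex.conj_ofReal _
      rw [h2]
      have h3 : (2 : ℂ)⁻¹ = ((Real.sqrt 2 : ℝ) : ℂ)⁻¹ * ((Real.sqrt 2 : ℝ) : ℂ)⁻¹ := by
        rw [← mul_inv, sqrt_two_mul_self]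
      rw [h3, mul_pow]
      ring
    · intro w _ hw; simp [hw]
    · simp
  · intro x _ hx; simp [hx]
  · simp

end HDQI

/-! ## Products of commuting terms -/

namespace PauliHamiltonian

variable {n m : ℕ} {H : PauliHamiltonian n m}

theorem list_prod_mul_list_prod {ι M : Type*} [Monoid M] (l : List ι) (f g : ι → M)
    (h : ∀ i j, Commute (f i) (g j)) :
    (l.map f).reverse.prod * (l.map g).reverse.prod = (l.map fun i => f i * g i).reverse.prod := by
  induction l with
  | nil => simp
  | cons i l ih =>
    have hc : Commute (f i) (l.map g).reverse.prod := by
      refine Commute.list_prod_right _ _ fun x hx => ?_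
      simp only [List.mem_reverse, List.mem_map] at hx
      obtain ⟨j, -, rfl⟩ := hx
      exact h i j
    simp only [List.map_cons, List.reverse_cons, List.prod_append, List.prod_singleton, ← ih]
    rw [mul_assoc, ← mul_assoc (f i), hc.eq]
    simp only [mul_assoc]

/-- A signed term of the Hamiltonian. -/
noncomputable def signedTerm (H : PauliHamiltonian n m) (i : Fin m) :
    Matrix (Fin n → ZMod 2) (Fin n → ZMod 2) ℂ :=
  (((H.sign i : ℤˣ) : ℤ) : ℂ) • pauliString (H.term i)

theorem op_eq_sum (H : PauliHamiltonian n m) : H.op = ∑ i, H.signedTerm i := rfl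

theorem signedTerm_mul_self (i : Fin m) : H.signedTerm i * H.signedTerm i = 1 := by
  rw [signedTerm, smul_mul_smul_comm, pauliString_mul_self]
  rcases Int.units_eq_one_or (H.sign i) with h | h <;> simp [h]

theorem signedTerm_conjTranspose (i : Fin m) : (H.signedTerm i)ᴴ = H.signedTerm i := by
  rw [signedTerm, Matrix.conjTranspose_smul, pauliString_conjTranspose]
  simp

/-- `termProd` separates signs and qubits, as the circuit produces them. Grouping the factors by
terms instead makes the commutation relations applicable. -/
theorem termProd_eq_list (H : PauliHamiltonian n m) (y : Fin m → ZMod 2) : H.termProd y =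
    ((List.finRange m).map fun i => if y i = 1 then H.signedTerm i else 1).reverse.prod := by
  have key : ∀ l : List (Fin m),
      (l.map fun i => if y i = 1 then (((H.sign i : ℤˣ) : ℤ) : ℂ) else 1).prod •
        tensor (H.qubitProd y l) =
      (l.map fun i => if y i = 1 then H.signedTerm i else 1).reverse.prod := by
    intro l
    induction l with
    | nil =>
      have : H.qubitProd y [] = fun _ => 1 := by funext j; simp [qubitProd]
      simp [this, tensor_one]
    | cons i l ih =>
      have h : tensor (H.qubitProd y (i :: l)) = tensor (H.qubitProd y l) *
          if y i = 1 then pauliString (H.term i) else 1 := by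
        have : (if y i = 1 then pauliString (H.term i) else 1) =
            tensor fun j => if y i = 1 then (H.term i j).mat else 1 := by
          split_ifs
          · rfl
          · exact tensor_one.symm
        rw [this, tensor_mul]
        congr 1
        funext j
        simp [qubitProd]
      rw [h, List.map_cons, List.prod_cons, List.map_cons, List.reverse_cons, List.prod_append,
        ← ih, List.prod_cons, List.prod_nil, mul_one, smul_mul_assoc]
      split_ifs
      · rw [signedTerm, Matrix.mul_smul, smul_smul, mul_comm]
      · simp
  rw [termProd, signProd, Fin.prod_univ_def, key]

theorem signedTerm_commute (hH : H.IsCommuting) (i j : Fin m) :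
    Commute (H.signedTerm i) (H.signedTerm j) :=
  ((hH i j).smul_left _).smul_right _

theorem termProd_zero : H.termProd 0 = 1 := by
  rw [termProd_eq_list]
  refine List.prod_eq_one fun x hx => ?_
  simp only [List.mem_reverse, List.mem_map] at hx
  obtain ⟨i, -, rfl⟩ := hx
  simp

/-- The two ordered products can be interleaved because the terms commute, and a term selected twice
squares to one. -/
theorem termProd_add (hH : H.IsCommuting) (y y' : Fin m → ZMod 2) :
    H.termProd (y + y') = H.termProd y * H.termProd y' := by
  have e11 : (1 : ZMod 2) + 1 = 0 := by decide
  rw [termProd_eq_list, termProd_eq_list, termProd_eq_list, list_prod_mul_list_prod]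
  · congr 3
    funext i
    rcases zmod_two_cases (y i) with h | h <;> rcases zmod_two_cases (y' i) with h' | h' <;>
      simp [h, h', e11, signedTerm_mul_self]
  · intro i j
    split_ifs
    · exact signedTerm_commute hH i j
    · exact Commute.one_right _
    · exact Commute.one_left _
    · exact Commute.one_left _

theorem termProd_single (i : Fin m) : H.termProd (Pi.single i 1) = H.signedTerm i := by
  have key : ∀ l : List (Fin m), l.Nodup →
      (l.map fun j => if (Pi.single i 1 : Fin m → ZMod 2) j = 1 then H.signedTerm j
        else 1).reverse.prod = if i ∈ l then H.signedTerm i else 1 := by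
    intro l hl
    induction l with
    | nil => simp
    | cons j l ih =>
      rw [List.nodup_cons] at hl
      simp only [List.map_cons, List.reverse_cons, List.prod_append, List.prod_singleton, ih hl.2]
      by_cases hj : j = i
      · subst hj; simp [hl.1]
      · simp [hj, Ne.symm hj]
  rw [termProd_eq_list, key _ (List.nodup_finRange m), if_pos (List.mem_finRange i)]

theorem termProd_conjTranspose (hH : H.IsCommuting) (y : Fin m → ZMod 2) :
    (H.termProd y)ᴴ = H.termProd y := by
  have key : ∀ l : List (Fin m),
      ((l.map fun i => if y i = 1 then H.signedTerm i else 1).reverse.prod)ᴴ =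
      (l.map fun i => if y i = 1 then H.signedTerm i else 1).reverse.prod := by
    intro l
    induction l with
    | nil => simp
    | cons i l ih =>
      have hc : Commute (if y i = 1 then H.signedTerm i else 1)
          (l.map fun i => if y i = 1 then H.signedTerm i else 1).reverse.prod := by
        refine Commute.list_prod_right _ _ fun x hx => ?_
        simp only [List.mem_reverse, List.mem_map] at hx
        obtain ⟨j, -, rfl⟩ := hx
        split_ifs
        · exact signedTerm_commute hH i j
        · exact Commute.one_right _
        · exact Commute.one_left _
        · exact Commute.one_left _
      simp only [List.map_cons, List.reverse_cons, List.prod_append, List.prod_singleton]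
      rw [Matrix.conjTranspose_mul, ih, ← hc.eq]
      congr 1
      split_ifs
      · exact signedTerm_conjTranspose i
      · simp
  rw [termProd_eq_list, key]

/-- A nonzero syndrome is nonzero at some qubit, where the tensor factor is a multiple of a
traceless Weyl operator. -/
theorem trace_termProd {y : Fin m → ZMod 2} (hy : H.checkMatrix *ᵥ y ≠ 0) :
    (H.termProd y).trace = 0 := by
  have : ∃ j, ¬ ((H.checkMatrix *ᵥ y) (Sum.inl j) = 0 ∧ (H.checkMatrix *ᵥ y) (Sum.inr j) = 0) := by
    by_contra h
    push Not at h
    refine hy (funext fun r => ?_)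
    rcases r with j | j
    · exact (h j).1
    · exact (h j).2
  obtain ⟨j, hj⟩ := this
  obtain ⟨θ, hθ⟩ := H.qubitProd_eq_weyl y j
  rw [termProd, Matrix.trace_smul, trace_tensor, Finset.prod_eq_zero (Finset.mem_univ j), smul_zero]
  rw [hθ, Matrix.trace_smul, trace_weyl hj, smul_zero]

/-- A relation between the terms: the product of the selected terms is `1` or `-1`, and the sign
is found by application to a basis state. -/
theorem termProd_of_relation (hH : H.IsCommuting) {d : Fin m → ZMod 2}
    (hd : H.checkMatrix *ᵥ d = 0) {D : ℕ → ℕ} {X Z : ℕ → ℕ → ℕ} {sg : ℕ → ℕ}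
    (hD : ∀ i : Fin m, 0 < D i ↔ d i = 1)
    (hX : ∀ (i : Fin m) (j : Fin n), X i j = (H.term i j).xBit.val)
    (hZ : ∀ (i : Fin m) (j : Fin n), Z i j = (H.term i j).zBit.val)
    (hsg : ∀ i : Fin m, 0 < sg i ↔ H.sign i = -1) :
    H.termProd d = sgn (if 0 < Compiler.totalPhase n m D X Z sg % 4 then 1 else 0) • 1 := by
  have hsign : H.signProd d = Complex.I ^ Compiler.signPhase D sg m := by
    rw [Compiler.signPhase, ← Fin.sum_univ_eq_sum_range
      (fun i => if 0 < D i ∧ 0 < sg i then 2 else 0), ← Finset.prod_pow_eq_pow_sum, signProd]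
    refine Finset.prod_congr rfl fun i _ => ?_
    simp only [hD, hsg]
    have hne : ¬ (1 : ℤˣ) = -1 := by decide
    rcases Int.units_eq_one_or (H.sign i) with h | h <;> by_cases h' : d i = 1 <;> simp [h, h', hne]
  have hpauli : ∀ (P : Pauli) (b c : ZMod 2), P.mat b c =
      if b = c + P.xBit then
        Complex.I ^ (if 0 < P.zBit.val then P.xBit.val + 2 * c.val else 0) else 0 := by
    intro P b c
    have e11 : (1 : ZMod 2) + 1 = 0 := by decide
    have hI3 : Complex.I ^ 3 = -Complex.I := Complex.I_pow_three
    cases P <;> rcases zmod_two_cases b with rfl | rfl <;>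
      rcases zmod_two_cases c with rfl | rfl <;>
      simp [Pauli.mat, Pauli.xBit, Pauli.zBit, e11, ZMod.val_one, hI3]
  -- Only the column of `|0⟩` is followed: at each qubit the partial product sends `|0⟩` to one
  -- basis state, with the phase that the program computes.
  have hcol : ∀ (j : Fin n) (k : ℕ), k ≤ m → ∀ b, H.qubitProd d ((List.finRange m).take k) j b 0 =
      if b = (Compiler.bitAfter D (fun i => X i j) k : ZMod 2) then
        Complex.I ^ Compiler.qubitPhase D (fun i => X i j) (fun i => Z i j) k else 0 := by
    intro j k
    induction k with
    | zero => intro _ b; simp [qubitProd, Compiler.bitAfter, Compiler.qubitPhase, Matrix.one_apply]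
    | succ k ih =>
      intro hk b
      have ih := ih (by omega)
      have hsucc : H.qubitProd d ((List.finRange m).take (k + 1)) j =
          (if d ⟨k, hk⟩ = 1 then (H.term ⟨k, hk⟩ j).mat else 1) *
            H.qubitProd d ((List.finRange m).take k) j := by
        rw [List.take_succ_eq_append_getElem (by simpa using hk)]
        simp [qubitProd]
      have hD' := hD ⟨k, hk⟩
      have hX' := hX ⟨k, hk⟩ j
      have hZ' := hZ ⟨k, hk⟩ j
      simp only at hD' hX' hZ'
      rw [hsucc]
      by_cases hdk : d ⟨k, hk⟩ = 1
      · rw [if_pos hdk, Matrix.mul_apply]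
        simp only [ih, mul_ite, mul_zero, Finset.sum_ite_eq', Finset.mem_univ, if_true, hpauli]
        have hbit := Compiler.bitAfter_le_one D (fun i => X i j) k
        simp only [Compiler.bitAfter, Compiler.qubitPhase, Finset.sum_range_succ, hD', hX', hZ',
          hdk, true_and]
        have hv : ((Compiler.bitAfter D (fun i => X i j) k : ℕ) : ZMod 2).val =
            Compiler.bitAfter D (fun i => X i j) k := ZMod.val_cast_of_lt (by omega)
        have hb : ((if 0 < (H.term ⟨k, hk⟩ j).xBit.val then
            1 - Compiler.bitAfter D (fun i => X i j) k
            else Compiler.bitAfter D (fun i => X i j) k : ℕ) : ZMod 2) =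
            Compiler.bitAfter D (fun i => X i j) k + (H.term ⟨k, hk⟩ j).xBit := by
          have e11 : (1 : ZMod 2) + 1 = 0 := by decide
          rcases Nat.le_one_iff_eq_zero_or_eq_one.1 hbit with h | h <;>
            rcases zmod_two_cases (H.term ⟨k, hk⟩ j).xBit with h' | h' <;>
            simp [h, h', e11, ZMod.val_one]
        rw [hb, hv]
        split_ifs <;> simp [pow_add, mul_comm]
      · rw [if_neg hdk, one_mul, ih]
        have hD0 : ¬ 0 < D k := fun h => hdk (hD'.1 h)
        simp only [Compiler.bitAfter, Compiler.qubitPhase, Finset.sum_range_succ, hD0, false_and,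
          if_false, add_zero]
  -- The syndrome vanishes, so each qubit carries a scalar; its value is the nonzero entry in column
  -- `0`.
  have hfac : ∀ j, H.qubitProd d (List.finRange m) j =
      (Complex.I ^ Compiler.qubitPhase D (fun i => X i j) (fun i => Z i j) m) • 1 := by
    intro j
    obtain ⟨θ, hθ⟩ := H.qubitProd_eq_weyl d j
    rw [hd, Pi.zero_apply, Pi.zero_apply, weyl_zero] at hθ
    have h := hcol j m le_rfl
    rw [List.take_of_length_le (by simp)] at h
    have h0 := h (Compiler.bitAfter D (fun i => X i j) m : ZMod 2)
    rw [if_pos rfl] at h0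
    rw [hθ, ← h0, hθ]
    have hne : θ • (1 : Matrix (ZMod 2) (ZMod 2) ℂ) (Compiler.bitAfter D (fun i => X i j) m) 0 ≠ 0 := by
      rw [← Matrix.smul_apply, ← hθ, h0]
      exact pow_ne_zero _ Complex.I_ne_zero
    congr 1
    rw [Matrix.smul_apply]
    by_cases hb : (Compiler.bitAfter D (fun i => X i j) m : ZMod 2) = 0
    · rw [hb]; simp
    · rw [Matrix.one_apply_ne hb] at hne
      simp at hne
  have hT : H.termProd d = Complex.I ^ Compiler.totalPhase n m D X Z sg •
      (1 : Matrix (Fin n → ZMod 2) (Fin n → ZMod 2) ℂ) := by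
    rw [termProd, funext hfac, tensor_smul, tensor_one, smul_smul, hsign,
      Finset.prod_pow_eq_pow_sum, ← pow_add, Compiler.totalPhase,
      ← Fin.sum_univ_eq_sum_range (fun l => Compiler.qubitPhase D (fun i => X i l)
        (fun i => Z i l) m)]
  -- The product squares to one, which excludes the phases `i` and `-i`. Testing the exponent for
  -- zero modulo `4` therefore finds the sign.
  have hsq : H.termProd d * H.termProd d = 1 := by
    rw [← termProd_add hH]
    have : d + d = 0 := by
      funext i
      have : ∀ b : ZMod 2, b + b = 0 := by decide
      exact this _
    rw [this, termProd_zero]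
  have hmod : Complex.I ^ Compiler.totalPhase n m D X Z sg =
      Complex.I ^ (Compiler.totalPhase n m D X Z sg % 4) := by
    conv_lhs => rw [← Nat.div_add_mod (Compiler.totalPhase n m D X Z sg) 4, pow_add, pow_mul,
      Complex.I_pow_four, one_pow, one_mul]
  rw [hmod] at hT
  rw [hT]
  rw [hT, smul_mul_smul_comm, one_mul, ← pow_add] at hsq
  have h00 := congrFun (congrFun hsq 0) 0
  simp only [Matrix.smul_apply, Matrix.one_apply_eq, smul_eq_mul, mul_one] at h00
  have hlt : Compiler.totalPhase n m D X Z sg % 4 < 4 := Nat.mod_lt _ (by norm_num)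
  generalize Compiler.totalPhase n m D X Z sg % 4 = t at hlt h00
  have hI6 : Complex.I ^ 6 = -1 := by
    rw [show 6 = 4 + 2 from rfl, pow_add, Complex.I_pow_four, Complex.I_sq, one_mul]
  interval_cases t
  · simp
  · norm_num at h00
  · simp
  · norm_num [hI6] at h00

end PauliHamiltonian

/-! ## Characters and spectral projections -/

section Characters

variable {m : ℕ} {S : Finset (Fin m)}

theorem chi_comm (z y : Fin m → ZMod 2) : chi z y = chi y z := by
  simp only [chi, mul_comm]

theorem chi_add_right (z y y' : Fin m → ZMod 2) : chi z (y + y') = chi z y * chi z y' := by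
  simp only [chi, Pi.add_apply, mul_add, Finset.sum_add_distrib, sgn_add]

theorem chi_add_left (z z' y : Fin m → ZMod 2) : chi (z + z') y = chi z y * chi z' y := by
  rw [chi_comm, chi_add_right, chi_comm z, chi_comm z']

@[simp] theorem chi_zero_right (z : Fin m → ZMod 2) : chi z 0 = 1 := by simp [chi]

@[simp] theorem chi_zero_left (y : Fin m → ZMod 2) : chi 0 y = 1 := by simp [chi]

theorem chi_mul_self (z y : Fin m → ZMod 2) : chi z y * chi z y = 1 := sgn_mul_self _

theorem star_sgn (b : ZMod 2) : star (sgn b) = sgn b := by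
  rcases zmod_two_cases b with rfl | rfl <;> simp

theorem add_self_zmod_two (y : Fin m → ZMod 2) : y + y = 0 := by
  funext i
  have : ∀ b : ZMod 2, b + b = 0 := by decide
  exact this _

theorem zero_mem_supported (S : Finset (Fin m)) (i : ℕ) : (0 : Fin m → ZMod 2) ∈ supported S i :=
  mem_supported.2 fun _ h => absurd rfl h

theorem add_mem_supported {i : ℕ} {y y' : Fin m → ZMod 2} (hy : y ∈ supported S i)
    (hy' : y' ∈ supported S i) : y + y' ∈ supported S i := by
  rw [mem_supported] at *
  intro j hj
  by_cases h : y j = 0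
  · exact hy' j fun h' => hj (by simp [h, h'])
  · exact hy j h

theorem single_mem_supported {i : Fin m} (hi : i ∈ S) : Pi.single i 1 ∈ supported S 0 := by
  rw [mem_supported]
  intro j hj
  by_cases h : j = i
  · subst h; exact ⟨hi, Nat.zero_le _⟩
  · simp [h] at hj

theorem card_supported (S : Finset (Fin m)) : (supported S 0).card = 2 ^ S.card := by
  rw [supported, Fintype.card_piFinset, ← Finset.prod_subset (Finset.subset_univ S)]
  · rw [Finset.prod_congr rfl fun i hi => by rw [if_pos ⟨hi, Nat.zero_le _⟩], Finset.prod_const]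
    simp [ZMod.card]
  · intro i _ hi
    simp [hi]

theorem sum_supported_add {M : Type*} [AddCommMonoid M] {w : Fin m → ZMod 2}
    (hw : w ∈ supported S 0) (g : (Fin m → ZMod 2) → M) :
    ∑ y ∈ supported S 0, g (y + w) = ∑ y ∈ supported S 0, g y := by
  refine Finset.sum_nbij' (· + w) (· + w) (fun y hy => add_mem_supported hy hw)
    (fun y hy => add_mem_supported hy hw) ?_ ?_ fun _ _ => rfl
  all_goals intro y _; simp only [add_assoc, add_self_zmod_two, add_zero]

/-- If `z i = 1`, translation by the unit vector at `i` permutes the domain and changes the sign of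
every summand. -/
theorem sum_chi {z : Fin m → ZMod 2} (hz : z ∈ supported S 0) :
    ∑ y ∈ supported S 0, chi z y = if z = 0 then (2 : ℂ) ^ S.card else 0 := by
  split_ifs with h
  · subst h
    simp [card_supported]
  · obtain ⟨i, hi⟩ := Function.ne_iff.1 h
    have hi1 : z i = 1 := (zmod_two_cases (z i)).resolve_left hi
    have hs := sum_supported_add (single_mem_supported (mem_supported.1 hz i hi).1) (chi z)
    have hc : chi z (Pi.single i 1) = -1 := by simp [chi, Pi.single_apply, hi1]
    simp only [chi_add_right, hc, mul_neg, mul_one, Finset.sum_neg_distrib] at hs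
    exact self_eq_neg.1 hs.symm

end Characters

/-! ### Spectral projections and functional calculus of a sign representation -/

/-- A representation of the group of vectors supported on `S` by Hermitian matrices, such that
only the identity has nonzero trace. -/
structure SignRep {m : ℕ} {ι : Type} [Fintype ι] [DecidableEq ι] (S : Finset (Fin m))
    (Q : (Fin m → ZMod 2) → Matrix ι ι ℂ) : Prop where
  zero : Q 0 = 1
  add : ∀ y y', Q (y + y') = Q y * Q y'
  conjTranspose : ∀ y, (Q y)ᴴ = Q y
  trace : ∀ y ∈ supported S 0, y ≠ 0 → (Q y).trace = 0

namespace SignRep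

variable {m : ℕ} {ι : Type} [Fintype ι] [DecidableEq ι] {S : Finset (Fin m)}
  {Q : (Fin m → ZMod 2) → Matrix ι ι ℂ}

/-- The projection onto the joint eigenspace with character `z`. -/
noncomputable def proj (S : Finset (Fin m)) (Q : (Fin m → ZMod 2) → Matrix ι ι ℂ)
    (z : Fin m → ZMod 2) : Matrix ι ι ℂ :=
  ((2 : ℂ) ^ S.card)⁻¹ • ∑ y ∈ supported S 0, chi z y • Q y

/-- Translation by `w` permutes the summands of the projection and multiplies the coefficients by
`chi z w`. -/
theorem mul_proj (h : SignRep S Q) {w : Fin m → ZMod 2} (hw : w ∈ supported S 0)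
    (z : Fin m → ZMod 2) : Q w * proj S Q z = chi z w • proj S Q z := by
  rw [proj, Matrix.mul_smul, smul_comm (chi z w), Finset.mul_sum, Finset.smul_sum (r := chi z w)]
  congr 1
  rw [← sum_supported_add hw fun y => chi z w • chi z y • Q y]
  refine Finset.sum_congr rfl fun y _ => ?_
  rw [Matrix.mul_smul, smul_smul, chi_add_right, ← h.add, add_comm w, mul_left_comm,
    chi_mul_self, mul_one]

theorem two_pow_ne_zero (k : ℕ) : (2 : ℂ) ^ k ≠ 0 := pow_ne_zero _ two_ne_zero

theorem sum_proj (h : SignRep S Q) : ∑ z ∈ supported S 0, proj S Q z = 1 := by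
  simp only [proj]
  rw [← Finset.smul_sum, Finset.sum_comm]
  simp only [← Finset.sum_smul]
  rw [Finset.sum_congr rfl fun y hy => by
    rw [Finset.sum_congr rfl fun z _ => chi_comm z y, sum_chi hy]]
  simp [ite_smul, zero_mem_supported, h.zero, smul_smul]

theorem proj_mul_proj (h : SignRep S Q) {z z' : Fin m → ZMod 2} (hz : z ∈ supported S 0)
    (hz' : z' ∈ supported S 0) : proj S Q z * proj S Q z' = if z = z' then proj S Q z else 0 := by
  have hzz : z + z' = 0 ↔ z = z' := by
    constructor
    · intro hh
      rw [← add_zero z, ← add_self_zmod_two z', ← add_assoc, hh, zero_add]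
    · rintro rfl
      exact add_self_zmod_two z
  have hs : (∑ y ∈ supported S 0, chi z y • Q y) * proj S Q z' =
      ∑ y ∈ supported S 0, chi (z + z') y • proj S Q z' := by
    rw [Finset.sum_mul]
    refine Finset.sum_congr rfl fun y hy => ?_
    rw [smul_mul_assoc, h.mul_proj hy, smul_smul, chi_add_left]
  conv_lhs => rw [proj.eq_def S Q z, smul_mul_assoc, hs, ← Finset.sum_smul,
    sum_chi (add_mem_supported hz hz')]
  simp only [hzz]
  split_ifs with hh
  · rw [smul_smul, inv_mul_cancel₀ (two_pow_ne_zero _), one_smul, hh]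
  · simp

theorem proj_conjTranspose (h : SignRep S Q) (z : Fin m → ZMod 2) :
    (proj S Q z)ᴴ = proj S Q z := by
  rw [proj, Matrix.conjTranspose_smul, Matrix.conjTranspose_sum]
  congr 1
  · simp
  · refine Finset.sum_congr rfl fun y _ => ?_
    rw [Matrix.conjTranspose_smul, h.conjTranspose, chi, star_sgn]

/-- Only `y = 0` contributes, so all joint eigenspaces have the same dimension. In particular none
is trivial, and every character occurs in the spectrum. -/
theorem trace_proj (h : SignRep S Q) (z : Fin m → ZMod 2) :
    (proj S Q z).trace = ((2 : ℂ) ^ S.card)⁻¹ * Fintype.card ι := by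
  rw [proj, Matrix.trace_smul, Matrix.trace_sum, Finset.sum_eq_single 0, smul_eq_mul]
  · simp [h.zero, Matrix.trace_one]
  · intro y hy hy0
    rw [Matrix.trace_smul, h.trace y hy hy0, smul_zero]
  · exact fun h0 => absurd (zero_mem_supported S 0) h0

theorem proj_ne_zero [Nonempty ι] (h : SignRep S Q) (z : Fin m → ZMod 2) : proj S Q z ≠ 0 := by
  intro h0
  have := h.trace_proj z
  rw [h0, Matrix.trace_zero] at this
  exact (mul_ne_zero (inv_ne_zero (two_pow_ne_zero _)) (Nat.cast_ne_zero.2 Fintype.card_ne_zero))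
    this.symm

/-- The functional calculus given by the spectral projections. -/
noncomputable def calculus (h : SignRep S Q) : ((Fin m → ZMod 2) → ℂ) →ₐ[ℂ] Matrix ι ι ℂ :=
  AlgHom.ofLinearMap
    { toFun := fun g => ∑ z ∈ supported S 0, g z • proj S Q z
      map_add' := fun g g' => by simp only [Pi.add_apply, add_smul, Finset.sum_add_distrib]
      map_smul' := fun c g => by
        simp only [Pi.smul_apply, smul_eq_mul, mul_smul, Finset.smul_sum, RingHom.id_apply] }
    (by simp [h.sum_proj])
    (fun g g' => by
      simp only [LinearMap.coe_mk, AddHom.coe_mk, Finset.sum_mul_sum, Pi.mul_apply]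
      refine Finset.sum_congr rfl fun z hz => ?_
      rw [Finset.sum_eq_single z]
      · rw [smul_mul_smul_comm, h.proj_mul_proj hz hz, if_pos rfl]
      · intro z' hz' hne
        rw [smul_mul_smul_comm, h.proj_mul_proj hz hz', if_neg hne.symm, smul_zero]
      · exact fun hh => absurd hz hh)

theorem calculus_apply (h : SignRep S Q) (g : (Fin m → ZMod 2) → ℂ) :
    h.calculus g = ∑ z ∈ supported S 0, g z • proj S Q z := rfl

theorem calculus_congr (h : SignRep S Q) {g g' : (Fin m → ZMod 2) → ℂ}
    (hg : ∀ z ∈ supported S 0, g z = g' z) : h.calculus g = h.calculus g' :=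
  Finset.sum_congr rfl fun z hz => by rw [hg z hz]

theorem calculus_conjTranspose (h : SignRep S Q) (g : (Fin m → ZMod 2) → ℂ) :
    (h.calculus g)ᴴ = h.calculus (star g) := by
  simp only [calculus_apply, Matrix.conjTranspose_sum, Matrix.conjTranspose_smul,
    h.proj_conjTranspose, Pi.star_apply]

theorem trace_calculus (h : SignRep S Q) (g : (Fin m → ZMod 2) → ℂ) : (h.calculus g).trace =
    ((2 : ℂ) ^ S.card)⁻¹ * Fintype.card ι * ∑ z ∈ supported S 0, g z := by
  simp only [calculus_apply, Matrix.trace_sum, Matrix.trace_smul, h.trace_proj, smul_eq_mul,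
    Finset.mul_sum]
  exact Finset.sum_congr rfl fun z _ => mul_comm _ _

/-- If `a` avoids all values `v z`, pointwise inverses give an inverse matrix. If `a = v z`, the
difference annihilates the nonzero projection of `z`. -/
theorem spectrum_calculus [Nonempty ι] (h : SignRep S Q) (v : (Fin m → ZMod 2) → ℝ) :
    spectrum ℝ (h.calculus fun z => (v z : ℂ)) = v '' (supported S 0 : Finset (Fin m → ZMod 2)) := by
  ext a
  rw [spectrum.mem_iff]
  have hsub : algebraMap ℝ (Matrix ι ι ℂ) a - (h.calculus fun z => (v z : ℂ)) =
      h.calculus fun z => ((a - v z : ℝ) : ℂ) := by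
    have : algebraMap ℝ (Matrix ι ι ℂ) a = h.calculus (fun _ => (a : ℂ)) := by
      rw [calculus_apply, ← Finset.smul_sum, h.sum_proj, Algebra.algebraMap_eq_smul_one]
      rfl
    rw [this, ← map_sub]
    congr 1
    funext z
    simp
  rw [hsub]
  constructor
  · intro hu
    by_contra hne
    refine hu ?_
    have hmul : ∀ g g' : (Fin m → ZMod 2) → ℂ, (∀ z ∈ supported S 0, g z * g' z = 1) →
        h.calculus g * h.calculus g' = 1 := fun g g' hg => by
      rw [← map_mul, ← map_one h.calculus]
      exact h.calculus_congr hg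
    have hz : ∀ z ∈ supported S 0, ((a - v z : ℝ) : ℂ) ≠ 0 := fun z hz h0 =>
      hne ⟨z, hz, by rw [Complex.ofReal_eq_zero] at h0; linarith⟩
    exact IsUnit.of_mul_eq_one (h.calculus fun z => ((a - v z : ℝ) : ℂ)⁻¹)
      (hmul _ _ fun z hzz => mul_inv_cancel₀ (hz z hzz))
  · rintro ⟨z, hz, rfl⟩ hu
    refine h.proj_ne_zero z (hu.mul_left_cancel ?_)
    rw [mul_zero, calculus_apply, Finset.sum_mul]
    refine Finset.sum_eq_zero fun z' hz' => ?_
    rw [smul_mul_assoc, h.proj_mul_proj hz' hz]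
    split_ifs with hh
    · simp [hh]
    · simp

theorem isSelfAdjoint_calculus (h : SignRep S Q) (v : (Fin m → ZMod 2) → ℝ) :
    IsSelfAdjoint (h.calculus fun z => (v z : ℂ)) := by
  rw [IsSelfAdjoint, Matrix.star_eq_conjTranspose, calculus_conjTranspose]
  congr 1
  funext z
  exact Complex.conj_ofReal _

/-- The spectrum is finite, so `f` agrees on it with an interpolation polynomial, and algebra
homomorphisms respect polynomials. No regularity of `f` is needed. -/
theorem cfc_calculus [Nonempty ι] (h : SignRep S Q) (v : (Fin m → ZMod 2) → ℝ) (f : ℝ → ℝ) :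
    cfc f (h.calculus fun z => (v z : ℂ)) = h.calculus fun z => (f (v z) : ℂ) := by
  classical
  set p : Polynomial ℝ := Lagrange.interpolate ((supported S 0).image v) id f
  have hp : ∀ z ∈ supported S 0, p.eval (v z) = f (v z) := fun z hz =>
    Lagrange.eval_interpolate_at_node f (Set.injOn_id _) (Finset.mem_image_of_mem v hz)
  have hcongr : (spectrum ℝ (h.calculus fun z => (v z : ℂ))).EqOn f p.eval := by
    rw [spectrum_calculus]
    rintro _ ⟨z, hz, rfl⟩
    exact (hp z hz).symm
  rw [cfc_congr hcongr, cfc_polynomial p _ (h.isSelfAdjoint_calculus v),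
    ← AlgHom.restrictScalars_apply ℝ h.calculus, Polynomial.aeval_algHom_apply]
  refine h.calculus_congr fun z hz => ?_
  rw [← hp z hz, Polynomial.aeval_pi_apply₂]
  exact (Polynomial.aeval_algebraMap_apply ℂ (v z) p)

/-- A continuous algebra homomorphism commutes with the exponential, which in the algebra of
functions is taken pointwise. -/
theorem exp_calculus (h : SignRep S Q) (g : (Fin m → ZMod 2) → ℂ) :
    NormedSpace.exp (h.calculus g) = h.calculus fun z => Complex.exp (g z) := by
  have hc : Continuous h.calculus := by
    have : (h.calculus : ((Fin m → ZMod 2) → ℂ) → Matrix ι ι ℂ) =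
      fun g => ∑ z ∈ supported S 0, g z • proj S Q z := rfl
    rw [this]
    fun_prop
  have he : NormedSpace.exp (h.calculus g) = h.calculus (NormedSpace.exp g) := by
    open scoped Matrix.Norms.Operator in
    exact (NormedSpace.map_exp h.calculus hc g).symm
  rw [he]
  congr 1
  funext z
  rw [Pi.coe_exp, Complex.exp_eq_exp_ℂ]

end SignRep

/-! ## The spectrum of a commuting Pauli Hamiltonian -/

/-- The arrays `X`, `Z` and `sg` contain the bits of the terms and the signs of `H`, and the
arrays `G` and `piv` the reduced form of its parity check matrix. -/
structure PauliHamiltonian.Reduction {n m : ℕ} (H : PauliHamiltonian n m) (X Z : ℕ → ℕ → ℕ)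
    (sg : ℕ → ℕ) (G : ℕ → ℕ → ℕ) (piv : ℕ → ℕ) : Prop where
  xBit : ∀ (i : Fin m) (j : Fin n), X i j = (H.term i j).xBit.val
  zBit : ∀ (i : Fin m) (j : Fin n), Z i j = (H.term i j).zBit.val
  sign : ∀ i : Fin m, 0 < sg i ↔ H.sign i = -1
  reduced : Gauss.Reduced (n + n) m (fun r c => if r < n then (X c r : ZMod 2) else Z c (r - n))
    (n + n) G piv

/-- The pivot columns. -/
def pivots (m : ℕ) (piv : ℕ → ℕ) : Finset (Fin m) := Finset.univ.filter fun i => 0 < piv i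

theorem mem_pivots {m : ℕ} {piv : ℕ → ℕ} {i : Fin m} : i ∈ pivots m piv ↔ 0 < piv i := by
  simp [pivots]

/-- The relation of a column outside the pivot columns, as a vector. -/
def relVec (m : ℕ) (G : ℕ → ℕ → ℕ) (piv : ℕ → ℕ) (j : ℕ) : Fin m → ZMod 2 :=
  fun i => Gauss.rel G piv j i

theorem relVec_eq_one {m : ℕ} {G : ℕ → ℕ → ℕ} {piv : ℕ → ℕ} {j : ℕ} {i : Fin m} :
    0 < Gauss.rel G piv j i ↔ relVec m G piv j i = 1 := by
  unfold relVec Gauss.rel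
  split_ifs <;> simp

theorem sum_range_add_self {M : Type*} [AddCommMonoid M] (n : ℕ) (f : ℕ → M) :
    ∑ r ∈ Finset.range (n + n), f r = ∑ l : Fin n, f l + ∑ l : Fin n, f (n + l) := by
  rw [Finset.sum_range, Fin.sum_univ_add]
  rfl

theorem sgn_eq (b : ZMod 2) : sgn b = 1 - 2 * (b.val : ℂ) := by
  rcases zmod_two_cases b with rfl | rfl
  · simp
  · rw [sgn_one, ZMod.val_one]; norm_num

namespace PauliHamiltonian.Reduction

variable {n m : ℕ} {H : PauliHamiltonian n m} {X Z : ℕ → ℕ → ℕ} {sg : ℕ → ℕ} {G : ℕ → ℕ → ℕ}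
  {piv : ℕ → ℕ}

theorem checkMatrix_inl (h : H.Reduction X Z sg G piv) (y : Fin m → ZMod 2) (l : Fin n) :
    (H.checkMatrix *ᵥ y) (Sum.inl l) = ∑ c : Fin m, (X c l : ZMod 2) * y c := by
  simp only [Matrix.mulVec, dotProduct, checkMatrix, Matrix.of_apply, symp, Sum.elim_inl, h.xBit,
    ZMod.natCast_val, ZMod.cast_id', id]

theorem checkMatrix_inr (h : H.Reduction X Z sg G piv) (y : Fin m → ZMod 2) (l : Fin n) :
    (H.checkMatrix *ᵥ y) (Sum.inr l) = ∑ c : Fin m, (Z c l : ZMod 2) * y c := by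
  simp only [Matrix.mulVec, dotProduct, checkMatrix, Matrix.of_apply, symp, Sum.elim_inr, h.zBit,
    ZMod.natCast_val, ZMod.cast_id', id]

/-- The syndrome determines the errors supported on the pivot columns. -/
theorem decode (h : H.Reduction X Z sg G piv) {y : Fin m → ZMod 2}
    (hy : y ∈ supported (pivots m piv) 0) {i : Fin m} (hi : 0 < piv i) :
    ∑ l : Fin n, (G (piv i - 1) (m + l) : ZMod 2) * (H.checkMatrix *ᵥ y) (Sum.inl l) +
      ∑ l : Fin n, (G (piv i - 1) (m + (n + l)) : ZMod 2) * (H.checkMatrix *ᵥ y) (Sum.inr l) =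
      y i := by
  have hinv := fun c : Fin m => fun hc => h.reduced.left_inverse i.2 c.2 hi hc
  simp only [sum_range_add_self] at hinv
  simp only [h.checkMatrix_inl, h.checkMatrix_inr, Finset.mul_sum]
  rw [Finset.sum_comm, Finset.sum_comm (s := Finset.univ (α := Fin n)), ← Finset.sum_add_distrib,
    Finset.sum_eq_single i]
  · have := hinv i hi
    simp only [Fin.is_lt, if_true, add_lt_iff_neg_left, not_lt_zero, if_false,
      add_tsub_cancel_left] at this
    simp only [← mul_assoc, ← Finset.sum_mul, ← add_mul, this, one_mul]
  · intro c _ hci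
    by_cases hc : 0 < piv c
    · have := hinv c hc
      simp only [Fin.is_lt, if_true, add_lt_iff_neg_left, not_lt_zero, if_false,
        add_tsub_cancel_left, Fin.val_inj, hci] at this
      simp only [← mul_assoc, ← Finset.sum_mul, ← add_mul, this, zero_mul]
    · have : y c = 0 := by
        by_contra hne
        exact hc (mem_pivots.1 (mem_supported.1 hy c hne).1)
      simp [this]
  · simp

theorem checkMatrix_injective (h : H.Reduction X Z sg G piv) {y : Fin m → ZMod 2}
    (hy : y ∈ supported (pivots m piv) 0) (h0 : H.checkMatrix *ᵥ y = 0) : y = 0 := by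
  funext i
  by_cases hi : 0 < piv i
  · rw [← h.decode hy hi, h0]; simp
  · by_contra hne
    exact hi (mem_pivots.1 (mem_supported.1 hy i hne).1)

theorem relVec_mem (h : H.Reduction X Z sg G piv) {j : ℕ} (hj : j < m) (hp : piv j = 0) :
    H.checkMatrix *ᵥ relVec m G piv j = 0 := by
  have hk := h.reduced.rel_mem_ker hj hp
  funext r
  rcases r with l | l
  · have := hk l (by omega)
    rw [Finset.sum_range] at this
    rw [h.checkMatrix_inl]
    simpa [relVec] using this
  · have := hk (n + l) (by omega)
    rw [Finset.sum_range] at this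
    rw [h.checkMatrix_inr]
    simpa [relVec] using this

/-- Injectivity of the check matrix on the pivot columns supplies the trace condition; this is where
the choice of `S` enters. -/
theorem signRep (h : H.Reduction X Z sg G piv) (hH : H.IsCommuting) :
    SignRep (pivots m piv) H.termProd where
  zero := termProd_zero
  add := termProd_add hH
  conjTranspose := termProd_conjTranspose hH
  trace _ hy hne := trace_termProd fun h0 => hne (h.checkMatrix_injective hy h0)

/-- The phase of the relation of column `j`. -/
def _root_.Compiler.relPhase (n m : ℕ) (X Z : ℕ → ℕ → ℕ) (sg : ℕ → ℕ) (G : ℕ → ℕ → ℕ)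
    (piv : ℕ → ℕ) (j : ℕ) : ℕ :=
  Compiler.totalPhase n m (Gauss.rel G piv j) X Z sg % 4

/-- The bit by which the eigenvalue of the `j`-th signed term is determined. -/
def bit (m : ℕ) (ph : ℕ → ℕ) (D : ℕ → ℕ → ℕ) (z : Fin m → ZMod 2) (j : ℕ) : ZMod 2 :=
  ((if 0 < ph j then 1 else 0 : ℕ) : ZMod 2) + ∑ i : Fin m, (D j i : ZMod 2) * z i

/-- A pivot term belongs to the group of `S` and acts by the character. Any other term is traded, by
its relation, for a product of pivot terms times the sign of the relation. -/
theorem signedTerm_mul_proj (h : H.Reduction X Z sg G piv) (hH : H.IsCommuting) (j : Fin m)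
    {z : Fin m → ZMod 2} (hz : z ∈ supported (pivots m piv) 0) :
    H.signedTerm j * SignRep.proj (pivots m piv) H.termProd z =
      sgn (if piv j = 0 then bit m (Compiler.relPhase n m X Z sg G piv) (Gauss.rel G piv) z j
        else z j) • SignRep.proj (pivots m piv) H.termProd z := by
  have hR := h.signRep hH
  by_cases hp : piv j = 0
  · rw [if_pos hp]
    have hzj : z j = 0 := by
      by_contra hne
      have := mem_pivots.1 (mem_supported.1 hz j hne).1
      omega
    have hd : relVec m G piv j j = 1 := by simp [relVec, Gauss.rel]
    -- Apart from `j` itself, `Gauss.rel` vanishes outside the pivots.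
    have hmem : relVec m G piv j + Pi.single j 1 ∈ supported (pivots m piv) 0 := by
      rw [mem_supported]
      intro i hi
      have hij : i ≠ j := by
        rintro rfl
        rw [Pi.add_apply, hd, Pi.single_eq_same] at hi
        exact hi (by decide)
      refine ⟨mem_pivots.2 ?_, Nat.zero_le _⟩
      rw [Pi.add_apply, Pi.single_eq_of_ne hij, add_zero] at hi
      by_contra hpi
      refine hi ?_
      have : ¬ (i : ℕ) = j := fun hh => hij (Fin.ext hh)
      simp [relVec, Gauss.rel, this, hpi]
    have hsplit : Pi.single j 1 = relVec m G piv j + (relVec m G piv j + Pi.single j 1) := by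
      rw [← add_assoc, add_self_zmod_two, zero_add]
    have hrel := termProd_of_relation hH (h.relVec_mem j.2 hp)
      (D := Gauss.rel G piv j) (fun i => relVec_eq_one) h.xBit h.zBit h.sign
    rw [← termProd_single, hsplit, termProd_add hH, hrel, Matrix.mul_assoc, hR.mul_proj hmem,
      Matrix.mul_smul, smul_mul_assoc, one_mul, smul_smul, mul_comm, bit, sgn_add]
    congr 2
    · unfold Compiler.relPhase
      split_ifs <;> simp
    · rw [chi_add_right]
      have : chi z (Pi.single j 1) = 1 := by simp [chi, Pi.single_apply, hzj]
      rw [this, mul_one, chi]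
      congr 1
      exact Finset.sum_congr rfl fun i _ => mul_comm _ _
  · rw [if_neg hp, ← termProd_single,
      hR.mul_proj (single_mem_supported (mem_pivots.2 (Nat.pos_of_ne_zero hp)))]
    congr 1
    simp [chi, Pi.single_apply]

/-- The number of negative signed terms in the joint eigenspace with character `z`. -/
def wt (n m : ℕ) (X Z : ℕ → ℕ → ℕ) (sg : ℕ → ℕ) (G : ℕ → ℕ → ℕ) (piv : ℕ → ℕ)
    (z : Fin m → ZMod 2) : ℕ :=
  Compiler.weight m piv (Compiler.relPhase n m X Z sg G piv) (Gauss.rel G piv) m z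

theorem wt_eq {z : Fin m → ZMod 2} (hz : z ∈ supported (pivots m piv) 0) :
    wt n m X Z sg G piv z = ∑ j : Fin m, (if piv j = 0 then
      bit m (Compiler.relPhase n m X Z sg G piv) (Gauss.rel G piv) z j else z j).val := by
  rw [wt, Compiler.weight, Finset.sum_range, ← Finset.sum_add_distrib]
  refine Finset.sum_congr rfl fun j _ => ?_
  by_cases hp : piv j = 0
  · have hzj : z j = 0 := by
      by_contra hne
      have := mem_pivots.1 (mem_supported.1 hz j hne).1
      omega
    rw [if_pos hp, if_pos hp, hzj, ZMod.val_zero, zero_add, bit]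
  · rw [if_neg hp, if_neg hp, add_zero]

theorem wt_le {z : Fin m → ZMod 2} (hz : z ∈ supported (pivots m piv) 0) :
    wt n m X Z sg G piv z ≤ m := by
  rw [wt_eq hz]
  exact Trellis.sum_val_le _

/-- The projections sum to one, and on each of them the `m` signed terms act by signs `1 - 2b`, so
their sum is `m` minus twice the number of negative ones. -/
theorem op_eq_calculus (h : H.Reduction X Z sg G piv) (hH : H.IsCommuting) :
    H.op = (h.signRep hH).calculus fun z =>
      (((m : ℝ) - 2 * (wt n m X Z sg G piv z : ℝ) : ℝ) : ℂ) := by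
  rw [← mul_one H.op, ← (h.signRep hH).sum_proj, SignRep.calculus_apply, Finset.mul_sum]
  refine Finset.sum_congr rfl fun z hz => ?_
  rw [op_eq_sum, Finset.sum_mul, Finset.sum_congr rfl fun j _ => h.signedTerm_mul_proj hH j hz,
    ← Finset.sum_smul]
  congr 1
  rw [wt_eq hz]
  simp only [sgn_eq, Finset.sum_sub_distrib, ← Finset.mul_sum]
  push_cast
  simp

end PauliHamiltonian.Reduction

/-! ## The states prepared from the pilot amplitudes -/

namespace SignRep

variable {m : ℕ} {ι : Type} [Fintype ι] [DecidableEq ι] {S : Finset (Fin m)}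
  {Q : (Fin m → ZMod 2) → Matrix ι ι ℂ}

/-- Exchanging the sums over `y` and `z` turns the character sums into projections: the Fourier
decomposition of `Q` undoes the Hadamard transform in the amplitudes. -/
theorem sum_amplitude (h : SignRep S Q) (w : (Fin m → ZMod 2) → ℝ) :
    ∑ y, Pilot.amplitude S w y • Q y = (((Real.sqrt 2 : ℝ) : ℂ)⁻¹ ^ S.card * 2 ^ S.card) •
      h.calculus fun z => ((Real.sqrt (w z / ∑ z ∈ supported S 0, w z) : ℝ) : ℂ) := by
  have hproj : ∀ z, (2 : ℂ) ^ S.card • proj S Q z = ∑ y ∈ supported S 0, chi z y • Q y := by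
    intro z
    rw [proj, smul_smul, mul_inv_cancel₀ (two_pow_ne_zero _), one_smul]
  simp only [calculus_apply, mul_smul, Finset.smul_sum (s := supported S 0),
    smul_comm ((2 : ℂ) ^ S.card), hproj]
  rw [Finset.sum_comm, ← Finset.sum_subset (Finset.subset_univ (supported S 0))]
  · refine Finset.sum_congr rfl fun y hy => ?_
    rw [Pilot.amplitude, if_pos hy, Finset.mul_sum, Finset.sum_smul]
    refine Finset.sum_congr rfl fun z _ => ?_
    simp only [mul_smul]
  · intro y _ hy
    rw [Pilot.amplitude, if_neg hy, zero_smul]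

/-- The calculus is multiplicative and the square roots are real, so multiplication by the adjoint
squares them. The scalar is `|2^(-s/2) * 2^s|² = 2^s` with `s = S.card`. -/
theorem amplitude_state (h : SignRep S Q) {w : (Fin m → ZMod 2) → ℝ}
    (hw : ∀ z ∈ supported S 0, 0 ≤ w z) :
    (∑ y, Pilot.amplitude S w y • Q y) * (∑ y, Pilot.amplitude S w y • Q y)ᴴ =
      ((2 : ℂ) ^ S.card * ((∑ z ∈ supported S 0, w z : ℝ) : ℂ)⁻¹) •
        h.calculus fun z => (w z : ℂ) := by
  have hsc : (((Real.sqrt 2 : ℝ) : ℂ)⁻¹ ^ S.card * 2 ^ S.card) *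
      star (((Real.sqrt 2 : ℝ) : ℂ)⁻¹ ^ S.card * 2 ^ S.card) = 2 ^ S.card := by
    have h2 : star ((Real.sqrt 2 : ℝ) : ℂ) = ((Real.sqrt 2 : ℝ) : ℂ) := Complex.conj_ofReal _
    have h3 : ((Real.sqrt 2 : ℝ) : ℂ)⁻¹ * ((Real.sqrt 2 : ℝ) : ℂ)⁻¹ = 2⁻¹ := by
      rw [← mul_inv, HDQI.sqrt_two_mul_self]
    simp only [star_mul', star_pow, star_inv₀, h2, star_ofNat]
    rw [← mul_pow, ← mul_pow]
    congr 1
    rw [mul_mul_mul_comm, h3]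
    norm_num
  rw [h.sum_amplitude, Matrix.conjTranspose_smul, smul_mul_smul_comm, hsc, mul_smul,
    h.calculus_conjTranspose, ← map_mul, ← map_smul h.calculus ((∑ z ∈ supported S 0, w z : ℝ) : ℂ)⁻¹]
  congr 1
  refine h.calculus_congr fun z hz => ?_
  simp only [Pi.mul_apply, Pi.star_apply, Pi.smul_apply, smul_eq_mul]
  have h2 : ∀ r : ℝ, star (r : ℂ) = (r : ℂ) := Complex.conj_ofReal
  rw [h2, ← Complex.ofReal_mul, Real.mul_self_sqrt (div_nonneg (hw z hz) (Finset.sum_nonneg hw)),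
    div_eq_inv_mul]
  push_cast
  ring

end SignRep

/-! ### States given by functions of the Hamiltonian, and Gibbs states -/

namespace PauliHamiltonian.Reduction

variable {n m : ℕ} {H : PauliHamiltonian n m} {X Z : ℕ → ℕ → ℕ} {sg : ℕ → ℕ} {G : ℕ → ℕ → ℕ}
  {piv : ℕ → ℕ}

/-- The eigenvalue on the joint eigenspace with character `z`. -/
noncomputable def energy (n m : ℕ) (X Z : ℕ → ℕ → ℕ) (sg : ℕ → ℕ) (G : ℕ → ℕ → ℕ) (piv : ℕ → ℕ)
    (z : Fin m → ZMod 2) : ℝ :=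
  (m : ℝ) - 2 * (wt n m X Z sg G piv z : ℝ)

theorem spec_eq (h : H.Reduction X Z sg G piv) (hH : H.IsCommuting) :
    H.Spec = energy n m X Z sg G piv ''
      (supported (pivots m piv) 0 : Finset (Fin m → ZMod 2)) := by
  rw [Spec, h.op_eq_calculus hH, (h.signRep hH).spectrum_calculus]
  rfl

theorem rho_eq (h : H.Reduction X Z sg G piv) (hH : H.IsCommuting) (f : ℝ → ℝ) :
    H.rho f = ((2 : ℂ)⁻¹ ^ n * 2 ^ (pivots m piv).card *
      ((∑ z ∈ supported (pivots m piv) 0, f (energy n m X Z sg G piv z) : ℝ) : ℂ)⁻¹) •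
      (h.signRep hH).calculus fun z => (f (energy n m X Z sg G piv z) : ℂ) := by
  rw [rho, h.op_eq_calculus hH, (h.signRep hH).cfc_calculus, SignRep.trace_calculus]
  congr 1
  simp only [Fintype.card_pi, ZMod.card, Finset.prod_const, Finset.card_univ, Fintype.card_fin]
  push_cast
  rw [mul_inv, mul_inv, inv_inv, inv_pow]
  simp only [energy]
  ring

theorem amplitude_state (h : H.Reduction X Z sg G piv) (hH : H.IsCommuting) {f : ℝ → ℝ}
    {w : (Fin m → ZMod 2) → ℝ}
    (hw : ∀ z ∈ supported (pivots m piv) 0, w z = f (energy n m X Z sg G piv z))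
    (hf : ∀ E ∈ H.Spec, 0 ≤ f E) :
    ((2 : ℂ)⁻¹ ^ n) • ((∑ y, Pilot.amplitude (pivots m piv) w y • H.termProd y) *
      (∑ y, Pilot.amplitude (pivots m piv) w y • H.termProd y)ᴴ) = H.rho f := by
  have hw0 : ∀ z ∈ supported (pivots m piv) 0, 0 ≤ w z := fun z hz => by
    rw [hw z hz]
    exact hf _ (by rw [h.spec_eq hH]; exact ⟨z, hz, rfl⟩)
  rw [(h.signRep hH).amplitude_state hw0, h.rho_eq hH, smul_smul, ← mul_assoc,
    Finset.sum_congr rfl hw]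
  congr 1
  exact (h.signRep hH).calculus_congr fun z hz => by rw [hw z hz]

theorem finiteGibbs_eq (h : H.Reduction X Z sg G piv) (hH : H.IsCommuting) (β : ℝ) :
    H.finiteGibbs β = H.rho fun E => Real.exp (-β * E) := by
  have hexp : NormedSpace.exp ((-β : ℂ) • H.op) = cfc (fun E => Real.exp (-β * E)) H.op := by
    rw [h.op_eq_calculus hH, (h.signRep hH).cfc_calculus, ← map_smul,
      (h.signRep hH).exp_calculus]
    congr 1
    funext z
    simp
  rw [finiteGibbs, rho, hexp]

theorem rho_const_mul (h : H.Reduction X Z sg G piv) (hH : H.IsCommuting) {c : ℝ} (hc : c ≠ 0)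
    (f : ℝ → ℝ) : H.rho (fun E => c * f E) = H.rho f := by
  have hc' : (c : ℂ) ≠ 0 := Complex.ofReal_ne_zero.2 hc
  rw [h.rho_eq hH, h.rho_eq hH]
  have : (fun z => ((c * f (energy n m X Z sg G piv z) : ℝ) : ℂ)) =
      (c : ℂ) • fun z : Fin m → ZMod 2 => (f (energy n m X Z sg G piv z) : ℂ) := by
    funext z
    simp
  rw [this, map_smul, smul_smul, ← Finset.mul_sum]
  congr 1
  push_cast
  rw [mul_inv]
  field_simp

/-- All states are combinations of the same finitely many projections, so convergence of the weights
on the spectrum suffices, provided that the limiting normalization does not vanish. -/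
theorem rho_tendsto (h : H.Reduction X Z sg G piv) (hH : H.IsCommuting) {f : ℝ → ℝ → ℝ}
    {g : ℝ → ℝ} (hg : ∑ z ∈ supported (pivots m piv) 0, g (energy n m X Z sg G piv z) ≠ 0)
    (hf : ∀ E ∈ H.Spec, Filter.Tendsto (fun β => f β E) Filter.atTop (nhds (g E))) :
    Filter.Tendsto (fun β => H.rho (f β)) Filter.atTop (nhds (H.rho g)) := by
  have hz : ∀ z ∈ supported (pivots m piv) 0,
      Filter.Tendsto (fun β => f β (energy n m X Z sg G piv z)) Filter.atTop
        (nhds (g (energy n m X Z sg G piv z))) :=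
    fun z hz => hf _ (by rw [h.spec_eq hH]; exact ⟨z, hz, rfl⟩)
  simp only [h.rho_eq hH]
  refine Filter.Tendsto.smul (Filter.Tendsto.const_mul _ (Filter.Tendsto.inv₀ ?_ ?_)) ?_
  · exact (Complex.continuous_ofReal.tendsto _).comp (tendsto_finsetSum _ hz)
  · exact Complex.ofReal_ne_zero.2 hg
  · simp only [SignRep.calculus_apply]
    exact tendsto_finsetSum _ fun z hzm =>
      ((Complex.continuous_ofReal.tendsto _).comp (hz z hzm)).smul_const _

theorem spec_least (h : H.Reduction X Z sg G piv) (hH : H.IsCommuting) :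
    ∃ E, IsLeast H.Spec E := by
  obtain ⟨z, hz, hmin⟩ := Finset.exists_min_image (supported (pivots m piv) 0)
    (energy n m X Z sg G piv) ⟨0, zero_mem_supported _ _⟩
  refine ⟨energy n m X Z sg G piv z, ?_⟩
  rw [h.spec_eq hH]
  refine ⟨⟨z, hz, rfl⟩, ?_⟩
  rintro _ ⟨z', hz', rfl⟩
  exact hmin z' hz'

theorem gibbsWeight_nonneg (H : PauliHamiltonian n m) (β : ℝ≥0∞) (E : ℝ) :
    0 ≤ H.gibbsWeight β E := by
  unfold gibbsWeight
  split_ifs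
  · exact zero_le_one
  · exact le_rfl
  · exact (Real.exp_pos _).le

theorem gibbsWeight_ne_zero (h : H.Reduction X Z sg G piv) (hH : H.IsCommuting) (β : ℝ≥0∞) :
    ∃ E ∈ H.Spec, H.gibbsWeight β E ≠ 0 := by
  obtain ⟨E, hE⟩ := h.spec_least hH
  refine ⟨E, hE.1, ?_⟩
  unfold gibbsWeight
  split_ifs
  · exact one_ne_zero
  · exact (Real.exp_pos _).ne'

theorem sum_pos (h : H.Reduction X Z sg G piv) (hH : H.IsCommuting) {f : ℝ → ℝ}
    (hf : ∀ E ∈ H.Spec, 0 ≤ f E) (hne : ∃ E ∈ H.Spec, f E ≠ 0) :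
    0 < ∑ z ∈ supported (pivots m piv) 0, f (energy n m X Z sg G piv z) := by
  have hmem : ∀ z ∈ supported (pivots m piv) 0, energy n m X Z sg G piv z ∈ H.Spec :=
    fun z hz => by rw [h.spec_eq hH]; exact ⟨z, hz, rfl⟩
  obtain ⟨E, hE, hE0⟩ := hne
  rw [h.spec_eq hH] at hE
  obtain ⟨z, hz, rfl⟩ := hE
  exact Finset.sum_pos' (fun z hz => hf _ (hmem z hz))
    ⟨z, hz, (hf _ (hmem z hz)).lt_of_ne' hE0⟩

theorem isGibbsState (h : H.Reduction X Z sg G piv) (hH : H.IsCommuting) (β : ℝ≥0∞) :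
    H.IsGibbsState β (H.rho (H.gibbsWeight β)) := by
  by_cases hβ : β = ⊤
  · refine .inr ⟨hβ, ?_⟩
    obtain ⟨E₀, hE₀⟩ := h.spec_least hH
    -- The factor `exp (β E₀)` cancels in the normalization. With the shifted energies, the smallest
    -- eigenvalue keeps weight one and all other weights decay.
    have hfun : H.finiteGibbs = fun β => H.rho fun E => Real.exp (-β * (E - E₀)) := by
      funext β
      rw [h.finiteGibbs_eq hH, ← h.rho_const_mul hH (Real.exp_pos (β * E₀)).ne']
      congr 1
      funext E
      rw [← Real.exp_add]
      congr 1
      ring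
    rw [hfun]
    refine h.rho_tendsto hH (h.sum_pos hH (fun E _ => gibbsWeight_nonneg H β E)
      (h.gibbsWeight_ne_zero hH β)).ne' fun E hE => ?_
    rw [gibbsWeight, if_pos hβ]
    split_ifs with hl
    · rw [hl.unique hE₀]
      simp
    · have hlt : 0 < E - E₀ := sub_pos.2 <| (hE₀.2 hE).lt_of_ne fun he => hl (he ▸ hE₀)
      simp only [neg_mul]
      exact Real.tendsto_exp_neg_atTop_nhds_zero.comp
        (Filter.tendsto_id.atTop_mul_const hlt)
  · refine .inl ⟨hβ, ?_⟩
    rw [h.finiteGibbs_eq hH]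
    congr 1
    funext E
    rw [gibbsWeight, if_neg hβ]

/-- A relation has entry `1` at its own column and `0` at all other non-pivot columns, so the
relations are linearly independent elements of the code. The dimension thus bounds the number of
parity bits of the automaton. -/
theorem card_relations_le (h : H.Reduction X Z sg G piv) :
    ((Finset.range m).filter fun j => piv j = 0).card ≤ Module.finrank (ZMod 2) H.sympCode := by
  let ι := {j : Fin m // piv j = 0}
  let b : ι → H.sympCode := fun j => ⟨relVec m G piv j.1, by
    rw [sympCode, LinearMap.mem_ker, Matrix.mulVecLin_apply]
    exact h.relVec_mem j.1.2 j.2⟩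
  have hb : LinearIndependent (ZMod 2) b := by
    rw [Fintype.linearIndependent_iff]
    intro g hg i
    have hi := congrFun (congrArg Subtype.val hg) i.1
    simp only [AddSubmonoidClass.coe_finsetSum, SetLike.val_smul, Finset.sum_apply, Pi.smul_apply,
      smul_eq_mul, ZeroMemClass.coe_zero, Pi.zero_apply, b] at hi
    rw [Finset.sum_eq_single i] at hi
    · simpa [relVec, Gauss.rel] using hi
    · intro j _ hji
      have hne : ¬ (i.1 : ℕ) = j.1 := fun hh => hji (Subtype.ext (Fin.ext hh.symm))
      simp [relVec, Gauss.rel, hne, i.2]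
    · simp
  have hcard := hb.fintype_card_le_finrank
  refine le_of_eq_of_le ?_ hcard
  rw [Fintype.card_subtype]
  rw [eq_comm]
  refine Finset.card_bij (fun (j : Fin m) _ => (j : ℕ)) ?_ ?_ ?_
  · intro j hj
    simpa using hj
  · intro j _ j' _ hh
    exact Fin.ext hh
  · intro j hj
    simp only [Finset.mem_filter, Finset.mem_range] at hj
    exact ⟨⟨j, hj.1⟩, by simpa using hj.2, rfl⟩

end PauliHamiltonian.Reduction

/-! ## The decoder -/

namespace HDQI

variable {n m a : ℕ}

/-- Add the preimage of the syndrome to register `A`. -/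
def decoder (n m a : ℕ) (G : ℕ → ℕ → ℕ) (piv : ℕ → ℕ) : List (Gate (Qubit m n a) ℝ) :=
  (List.finRange m).flatMap fun i : Fin m => (List.finRange n).flatMap fun l : Fin n =>
    (if 0 < piv i ∧ 0 < G (piv i - 1) (m + l) then [.ctrl .X (Qubit.C l) (Qubit.A i)] else []) ++
    if 0 < piv i ∧ 0 < G (piv i - 1) (m + (n + l)) then [.ctrl .X (Qubit.B l) (Qubit.A i)] else []

theorem decoder_valid (G : ℕ → ℕ → ℕ) (piv : ℕ → ℕ) : ∀ g ∈ decoder n m a G piv, g.Valid := by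
  intro g hg
  simp only [decoder, List.mem_flatMap, List.mem_finRange, true_and, List.mem_append] at hg
  obtain ⟨i, l, hg | hg⟩ := hg <;> split_ifs at hg <;> simp only [List.mem_singleton,
    List.not_mem_nil] at hg <;> subst hg <;> exact ⟨trivial, by simp [Qubit.A, Qubit.B, Qubit.C]⟩

theorem join_add_single (u : Fin m → ZMod 2) (z x : Fin n → ZMod 2) (w : Fin a → ZMod 2) (i : Fin m)
    (b : ZMod 2) : Qubit.join u z x w + Pi.single (Qubit.A i) b =
      Qubit.join (u + Pi.single i b) z x w := by
  funext q
  rcases q with j | j | j | j <;>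
    simp [Qubit.join, Qubit.A, Pi.single_apply]

/-- Each block adds a vector to the label of the basis state that does not depend on that label, so
only the sum of these vectors matters. -/
theorem runCircuit_flatMap_ket {ι α Q : Type} [DecidableEq Q] [AddCommMonoid α]
    (l : List ι) (C : ι → List (Gate Q ℝ)) (F : α → Q → ZMod 2) (d : ι → α)
    (h : ∀ i u, runCircuit (C i) (ket (F u)) = ket (F (u + d i))) (u : α) :
    runCircuit (l.flatMap C) (ket (F u)) = ket (F (u + (l.map d).sum)) := by
  induction l generalizing u with
  | nil => simp [runCircuit_nil]
  | cons i l ih =>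
    rw [List.flatMap_cons, runCircuit_append, h, ih, List.map_cons, List.sum_cons, add_assoc]

theorem decoder_run (G : ℕ → ℕ → ℕ) (piv : ℕ → ℕ) (u : Fin m → ZMod 2) (z x : Fin n → ZMod 2)
    (w : Fin a → ZMod 2) : runCircuit (decoder n m a G piv) (ket (Qubit.join u z x w)) =
      ket (Qubit.join (u + fun i : Fin m => ∑ l : Fin n,
        ((if 0 < piv i ∧ 0 < G (piv i - 1) (m + l) then x l else 0) +
          if 0 < piv i ∧ 0 < G (piv i - 1) (m + (n + l)) then z l else 0)) z x w) := by
  set g : Fin m → Fin n → ZMod 2 := fun i l =>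
    ((if 0 < piv i ∧ 0 < G (piv i - 1) (m + l) then x l else 0) +
      if 0 < piv i ∧ 0 < G (piv i - 1) (m + (n + l)) then z l else 0) with hg
  have hC : ∀ (u : Fin m → ZMod 2) (i : Fin m) (l : Fin n),
      Gate.apply (ket (Qubit.join u z x w)) (.ctrl .X (Qubit.C l) (Qubit.A i)) =
      ket (Qubit.join (u + Pi.single i (x l)) z x w) := by
    intro u i l
    rw [apply_cnot_ket (by simp [Qubit.A, Qubit.C]), ← join_add_single]
    rfl
  have hB : ∀ (u : Fin m → ZMod 2) (i : Fin m) (l : Fin n),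
      Gate.apply (ket (Qubit.join u z x w)) (.ctrl .X (Qubit.B l) (Qubit.A i)) =
      ket (Qubit.join (u + Pi.single i (z l)) z x w) := by
    intro u i l
    rw [apply_cnot_ket (by simp [Qubit.A, Qubit.B]), ← join_add_single]
    rfl
  rw [decoder, runCircuit_flatMap_ket _ _ (fun u => Qubit.join u z x w)
    (fun i => Pi.single i (∑ l, g i l))]
  · congr 3
    rw [← Fin.sum_univ_def]
    funext i
    rw [Finset.sum_apply, Finset.sum_eq_single i]
    · simp [hg]
    · intro j _ hj; simp [hj.symm]
    · simp
  · intro i u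
    rw [runCircuit_flatMap_ket _ _ (fun u => Qubit.join u z x w) (fun l => Pi.single i (g i l))]
    · congr 3
      rw [← Fin.sum_univ_def]
      funext j
      rw [Finset.sum_apply]
      by_cases hj : j = i
      · subst hj; simp
      · simp [hj]
    · intro l u
      rw [runCircuit_append, hg]
      simp only
      split_ifs <;> simp [runCircuit_cons, runCircuit_nil, hC, hB, Pi.single_add, add_assoc]

/-- On the pivots the recorded row operations recover `y` from the syndrome, and adding this to `y`
gives `0`. Elsewhere `y` vanishes and no gate acts. -/
theorem decodes {H : PauliHamiltonian n m} {X Z : ℕ → ℕ → ℕ} {sg : ℕ → ℕ} {G : ℕ → ℕ → ℕ}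
    {piv : ℕ → ℕ} (h : H.Reduction X Z sg G piv) :
    Decodes H (decoder n m a G piv) (supported (pivots m piv) 0 : Finset (Fin m → ZMod 2)) := by
  intro y hy
  rw [decoder_run]
  congr 2
  funext i
  have hcast : ∀ r c (b : ZMod 2), (if 0 < G r c then b else 0) = (G r c : ZMod 2) * b := by
    intro r c b
    rcases Nat.le_one_iff_eq_zero_or_eq_one.1 (h.reduced.le_one r c) with h | h <;> simp [h]
  rw [Pi.add_apply, Pi.zero_apply]
  by_cases hi : 0 < piv i
  · simp only [hi, true_and, hcast, Finset.sum_add_distrib]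
    rw [h.decode hy hi]
    have : ∀ b : ZMod 2, b + b = 0 := by decide
    exact this _
  · simp only [hi, false_and, if_false, add_zero, Finset.sum_const_zero]
    by_contra hne
    exact hi (mem_pivots.1 (mem_supported.1 hy i hne).1)

end HDQI

/-! ## Programs that emit gates -/

/-- Started on `s`, the program halts within `T` steps and emits the gates `l`. -/
def Emits (p : Prog) (s : Store) (T : ℕ) (l : List (Gate ℕ ℝ)) : Prop :=
  Runs p s T fun s' => s'.out = s.out ++ l

namespace Emits

variable {p q : Prog} {s : Store} {T T' : ℕ} {l l' : List (Gate ℕ ℝ)}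

theorem emit (g : Gate IExpr RExpr) :
    Emits (.emit g) s 1 [g.map (fun e => e.eval s) (fun e => e.eval s)] := Runs.emit rfl

theorem seq (h : Emits p s T l) (h' : ∀ s', p.Frame s s' → Emits q s' T' l') :
    Emits (.seq p q) s (T + T') (l ++ l') :=
  Runs.seq_of h fun s' hf hs => (h' s' hf).imp fun s'' _ hs' => by
    rw [hs', hs, List.append_assoc]

theorem when {b : Test} (h : b.Holds s → Emits p s (T + 1) l) (h' : ¬ b.Holds s → l = []) :
    Emits (.when b p) s (T + 2) l :=
  Runs.when h fun hb => by simp [Store.setNat, h' hb]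

theorem for_loop {v : ℕ} {e : IExpr} {N : ℕ} (g : Fin N → List (Gate ℕ ℝ)) (hv : v ∉ p.natWrites)
    (he : ∀ s', (Prog.for v e p).Frame s s' → e.eval s' = N)
    (hstep : ∀ i s', (Prog.for v e p).Frame s s' → s'.nat v 0 0 = (i : Fin N) →
      Emits p s' T (g i)) :
    Emits (.for v e p) s (N * (T + 2) + 2) ((List.finRange N).flatMap g) := by
  have h : ∀ i : Fin N, (fun k => if hk : k < N then g ⟨k, hk⟩ else []) i = g i := fun i => by
    simp
  have := Runs.for_emit (fun k => if hk : k < N then g ⟨k, hk⟩ else []) hv he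
    fun i s' hi hf hv' => by
      have := hstep ⟨i, hi⟩ s' hf hv'
      rw [← h ⟨i, hi⟩] at this
      exact this
  rw [← List.map_coe_finRange_eq_range, List.flatMap_map] at this
  simp only [h] at this
  exact this

/-- The counter runs upwards, so index `i` is served in the round with counter `N - (i + 1)`. -/
theorem for_loop_reverse {v : ℕ} {e : IExpr} {N : ℕ} (g : Fin N → List (Gate ℕ ℝ))
    (hv : v ∉ p.natWrites) (he : ∀ s', (Prog.for v e p).Frame s s' → e.eval s' = N)
    (hstep : ∀ i s', (Prog.for v e p).Frame s s' → s'.nat v 0 0 = N - ((i : Fin N) + 1) →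
      Emits p s' T (g i)) :
    Emits (.for v e p) s (N * (T + 2) + 2) ((List.finRange N).reverse.flatMap g) := by
  rw [List.finRange_reverse, List.flatMap_map]
  refine for_loop _ hv he fun i s' hf hi => hstep _ s' hf ?_
  rw [hi, Fin.val_rev]
  omega

end Emits

/-! ## Emission of the circuit -/

namespace Compiler

open Prog

/-- The program changes no data except for the counters. -/
def KeepsData (p : Prog) : Prop := (∀ x ∈ p.natWrites, 99 ≤ x) ∧ p.realWrites = []

/-- The store contains the Hamiltonian and everything that determines the circuit. -/
structure Loaded {n m : ℕ} (H : PauliHamiltonian n m) {N : ℕ} (G : ℕ → ℕ → ℕ) (piv : ℕ → ℕ)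
    (tr : Fin m → Fin N → Fin N) (V : ℕ → Fin N → ℝ) (s : Store) : Prop where
  n_eq : s.nat 0 0 0 = n
  m_eq : s.nat 0 0 1 = m
  xBit : ∀ (i : Fin m) (j : Fin n), s.nat 1 i j = (H.term i j).xBit.val
  zBit : ∀ (i : Fin m) (j : Fin n), s.nat 2 i j = (H.term i j).zBit.val
  sign : ∀ i : Fin m, 0 < s.nat 3 i 0 ↔ H.sign i = -1
  matrix : ∀ r c, s.nat 4 r c = G r c
  pivot : ∀ i, s.nat 5 i 0 = piv i
  tr_eq : ∀ (i : Fin m) (q : Fin N), s.nat 7 i q = tr i q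
  states_eq : s.nat 9 0 0 = N
  base : ∀ i ≤ m, s.nat 13 i 0 = m + 2 * n + N * i
  value : ∀ i ≤ m, ∀ q : Fin N, s.real 1 i q = V i q

theorem KeepsData.emit (g : Gate IExpr RExpr) : KeepsData (.emit g) := by
  simp [KeepsData, natWrites, realWrites]

theorem KeepsData.seq {p q : Prog} (hp : KeepsData p) (hq : KeepsData q) : KeepsData (.seq p q) := by
  refine ⟨fun x hx => ?_, by rw [realWrites, hp.2, hq.2]; rfl⟩
  rw [natWrites, List.mem_append] at hx
  exact hx.elim (hp.1 x) (hq.1 x)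

theorem KeepsData.when {b : Test} {p : Prog} (hp : KeepsData p) : KeepsData (.when b p) := by
  refine ⟨fun x hx => ?_, by rw [Prog.when, realWrites, hp.2]; rfl⟩
  rw [Prog.when, natWrites, List.mem_append] at hx
  exact hx.elim (hp.1 x) fun hx => by
    simp only [skip, natWrites, List.mem_singleton] at hx; omega

theorem KeepsData.for {v : ℕ} (hv : 99 ≤ v) {e : IExpr} {p : Prog} (hp : KeepsData p) :
    KeepsData (.for v e p) := by
  refine ⟨fun x hx => ?_, by simp only [Prog.for, realWrites, hp.2, List.append_nil]⟩
  simp only [Prog.for, natWrites, List.mem_append, List.mem_singleton] at hx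
  rcases hx with rfl | hx | rfl
  · exact hv
  · exact hp.1 x hx
  · exact hv

section

variable {n m : ℕ} {H : PauliHamiltonian n m} {N : ℕ} {G : ℕ → ℕ → ℕ} {piv : ℕ → ℕ}
  {tr : Fin m → Fin N → Fin N} {V : ℕ → Fin N → ℝ} {s s' : Store}

/-- Programs that keep the data write only to arrays from `99` on, where the counters and the dummy
cell are. -/
theorem Loaded.frame (h : Loaded H G piv tr V s) {p : Prog} (hp : KeepsData p)
    (hf : p.Frame s s') : Loaded H G piv tr V s' := by
  have hn : ∀ x < 99, s'.nat x = s.nat x := fun x hx =>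
    hf.nat x fun hm => absurd (hp.1 x hm) (by omega)
  have hr : ∀ x, s'.real x = s.real x := fun x => hf.real x (by rw [hp.2]; simp)
  constructor <;> simp only [hn _ (show (0 : ℕ) < 99 by norm_num),
    hn _ (show (1 : ℕ) < 99 by norm_num), hn _ (show (2 : ℕ) < 99 by norm_num),
    hn _ (show (3 : ℕ) < 99 by norm_num), hn _ (show (4 : ℕ) < 99 by norm_num),
    hn _ (show (5 : ℕ) < 99 by norm_num), hn _ (show (7 : ℕ) < 99 by norm_num),
    hn _ (show (9 : ℕ) < 99 by norm_num), hn _ (show (13 : ℕ) < 99 by norm_num), hr]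
  exacts [h.n_eq, h.m_eq, h.xBit, h.zBit, h.sign, h.matrix, h.pivot, h.tr_eq, h.states_eq, h.base,
    h.value]

/-- The number of a qubit of register `B`. -/
def bE (e : IExpr) : IExpr := .add mE e

/-- The number of a qubit of register `C`. -/
def cE (e : IExpr) : IExpr := .add (.add mE nE) e

/-- The number of a workspace qubit. -/
def stateE (e q : IExpr) : IExpr := .add (.get 13 e (.lit 0)) q

/-- The gate that flips the workspace qubit of the initial state. -/
def flipStart : Prog := .emit (.one .X (.get 13 mE (.lit 0)))

/-- The rotations on qubit `e`. -/
def rotations (e : IExpr) : Prog :=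
  .for 101 (var 9) (.when (.conj (posE (.get 5 e (.lit 0)))
      (.rlt (.ofInt (.lit 0)) (.get 1 (.add e (.lit 1)) (var 101))))
    (.emit (.ctrl (.rot (.sqrt (.div (.get 1 e (var 101)) (.get 1 (.add e (.lit 1)) (var 101))))
      (.sqrt (.div (.get 1 e (.get 7 e (var 101))) (.get 1 (.add e (.lit 1)) (var 101)))))
      (stateE (.add e (.lit 1)) (var 101)) e)))

/-- The gates that move the state of the automaton from level `e + 1` to level `e`. -/
def moves (e : IExpr) : Prog :=
  .for 101 (var 9) (.seq (.emit (.ctrl .X (stateE (.add e (.lit 1)) (var 101)) (stateE e (var 101))))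
    (.seq (.emit (.toffoli (stateE (.add e (.lit 1)) (var 101)) e (stateE e (var 101))))
      (.emit (.toffoli (stateE (.add e (.lit 1)) (var 101)) e
        (stateE e (.get 7 e (var 101)))))))

/-- The qubits in reverse order. -/
def reverseE : IExpr := .sub mE (.add (var 100) (.lit 1))

def emitPilot : Prog :=
  .seq flipStart (.seq (.for 100 mE (.seq (rotations reverseE) (moves reverseE)))
    (.seq (.for 100 mE (moves (var 100))) (.seq flipStart
      (.for 100 mE (.when (posE (.get 5 (var 100) (.lit 0))) (.emit (.one .had (var 100))))))))

def emitBellPrep : Prog :=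
  .for 100 nE (.seq (.emit (.one .had (bE (var 100)))) (.emit (.ctrl .X (bE (var 100)) (cE (var 100)))))

def emitBellMeasure : Prog :=
  .for 100 nE (.seq (.emit (.ctrl .X (bE (var 100)) (cE (var 100)))) (.emit (.one .had (bE (var 100)))))

def emitSigns : Prog :=
  .for 100 mE (.when (posE (.get 3 (var 100) (.lit 0))) (.emit (.one .Z (var 100))))

def emitPauli : Prog :=
  .cond (posE (.get 1 (var 100) (var 101)))
    (.cond (posE (.get 2 (var 100) (var 101))) (.emit (.ctrl .Y (var 100) (bE (var 101))))
      (.emit (.ctrl .X (var 100) (bE (var 101)))))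
    (.when (posE (.get 2 (var 100) (var 101))) (.emit (.ctrl .Z (var 100) (bE (var 101)))))

def emitTerms : Prog := .for 100 mE (.for 101 nE emitPauli)

/-- The gate of the decoder with target `100` and control `q`, for column `e` of the recorded row
operations. -/
def emitCorrection (e q : IExpr) : Prog :=
  .when (.conj (posE (.get 5 (var 100) (.lit 0)))
    (posE (.get 4 (.sub (.get 5 (var 100) (.lit 0)) (.lit 1)) e)))
    (.emit (.ctrl .X q (var 100)))

def emitDecoder : Prog :=
  .for 100 mE (.for 101 nE (.seq (emitCorrection (.add mE (var 101)) (cE (var 101)))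
    (emitCorrection (.add mE (.add nE (var 101))) (bE (var 101)))))

def emitCircuit : Prog :=
  .seq emitPilot (.seq emitBellPrep (.seq emitSigns (.seq emitTerms (.seq emitBellMeasure
    (.seq emitDecoder emitBellPrep)))))

/-- The number of a qubit used in the preparation of the pilot state. -/
def pilotIndex (n m N : ℕ) : Pilot.Label m N → ℕ :=
  fun q => Qubit.index (n := n) (Sum.elim Qubit.A Qubit.W q)

/-- `finProdFinEquiv` numbers the wire `(i, q)` by `q + N * i`, and array `13` already contains the
offset `m + 2 * n` of the workspace. -/
theorem Loaded.base_add (h : Loaded H G piv tr V s) (i : Fin (m + 1)) (q : Fin N) :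
    s.nat 13 i 0 + q = pilotIndex n m N (Pilot.wire i q) := by
  rw [h.base i (by omega)]
  simp only [pilotIndex, Pilot.wire, Sum.elim_inr, Qubit.W, Qubit.index, finProdFinEquiv_apply_val]
  ring

theorem _root_.Store.push_nat (s : Store) (g : Gate ℕ ℝ) : (s.push g).nat = s.nat := rfl

@[simp] theorem _root_.IExpr.eval_push (e : IExpr) (s : Store) (g : Gate ℕ ℝ) :
    e.eval (s.push g) = e.eval s := by
  induction e with
  | lit => rfl
  | get _ _ _ h1 h2 => simp only [IExpr.eval, h1, h2]; rfl
  | add _ _ h1 h2 => simp only [IExpr.eval, h1, h2]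
  | sub _ _ h1 h2 => simp only [IExpr.eval, h1, h2]

theorem _root_.Emits.emit_of {g : Gate IExpr RExpr} {g' : Gate ℕ ℝ}
    (h : g.map (fun e => e.eval s) (fun e => e.eval s) = g') : Emits (.emit g) s 1 [g'] :=
  h ▸ Emits.emit g

theorem _root_.Emits.emit_cons {g : Gate IExpr RExpr} {g' : Gate ℕ ℝ} {p : Prog} {T : ℕ}
    {l : List (Gate ℕ ℝ)} (h : g.map (fun e => e.eval s) (fun e => e.eval s) = g')
    (h' : Emits p (s.push g') T l) : Emits (.seq (.emit g) p) s (1 + T) (g' :: l) := by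
  subst h
  exact Runs.seq (Runs.emit (h'.imp fun s' _ hs => by rw [hs]; simp [Store.push]))

theorem Loaded.bE_eval (h : Loaded H G piv tr V s) {v : ℕ} {j : Fin n} (hv : s.nat v 0 0 = j)
    (a : ℕ) : (bE (var v)).eval s = Qubit.index (m := m) (n := n) (a := a) (Qubit.B j) := by
  simp only [bE, IExpr.eval, mE, var_eval, h.m_eq, hv]
  rfl

theorem Loaded.cE_eval (h : Loaded H G piv tr V s) {v : ℕ} {j : Fin n} (hv : s.nat v 0 0 = j)
    (a : ℕ) : (cE (var v)).eval s = Qubit.index (m := m) (n := n) (a := a) (Qubit.C j) := by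
  simp only [cE, IExpr.eval, mE, nE, var_eval, h.m_eq, h.n_eq, hv]
  rfl

/-- The automaton starts in state `0`, so its wire is the first one of level `m`. -/
theorem flipStart_emits (h : Loaded H G piv tr V s) {q₀ : Fin N} (hq : (q₀ : ℕ) = 0) :
    Emits flipStart s 1 ([Gate.one .X (Pilot.wire (Fin.last m) q₀)].map
      (Gate.relabel (pilotIndex n m N))) := by
  have hb := h.base_add (Fin.last m) q₀
  simp only [Fin.val_last, hq, add_zero] at hb
  refine Emits.emit_of ?_
  simp only [Gate.map, Gate.relabel, OneQubit.map, IExpr.eval, mE, h.m_eq, hb]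

theorem keepsData_rotations (e : IExpr) : KeepsData (rotations e) :=
  .for (by norm_num) (.when (.emit _))

theorem keepsData_moves (e : IExpr) : KeepsData (moves e) :=
  .for (by norm_num) (.seq (.emit _) (.seq (.emit _) (.emit _)))

/-- The expression `e` may read the counter of the enclosing loop, so its value is required in every
store reached inside. -/
theorem rotations_emits (h : Loaded H G piv tr V s) (i : Fin m) {e : IExpr}
    (he : ∀ s', (rotations e).Frame s s' → e.eval s' = i) :
    Emits (rotations e) s (N * ((0 + 2) + 2) + 2)
      ((Pilot.rotLayer (pivots m piv) tr V i).map (Gate.relabel (pilotIndex n m N))) := by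
  rw [Pilot.rotLayer, List.map_flatMap]
  refine Emits.for_loop _ (by simp [Prog.when, skip, natWrites]) (fun s' hf => ?_)
    fun q s' hf hq => ?_
  · exact (h.frame (keepsData_rotations e) hf).states_eq
  · have hL := h.frame (keepsData_rotations e) hf
    have hei := he s' hf
    have hb := hL.base_add i.succ q
    have hV := hL.value (i + 1) (by omega) q
    have hV' := hL.value i (by omega)
    simp only [Fin.val_succ] at hb
    refine Emits.when (fun hb' => ?_) (fun hb' => ?_) <;>
      simp only [Test.Holds, posE_holds, RExpr.eval, IExpr.eval, var_eval, hq, hei, hL.pivot, hV,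
        Nat.cast_zero, ← mem_pivots] at hb'
    · rw [if_pos hb']
      refine Emits.emit_of ?_
      simp only [Gate.map, Gate.relabel, OneQubit.map, IExpr.eval, RExpr.eval, stateE, var_eval, hq,
        hei, hV, hV', hL.tr_eq, hb]
      rfl
    · rw [if_neg hb', List.map_nil]

theorem moves_emits (h : Loaded H G piv tr V s) (i : Fin m) {e : IExpr}
    (he : ∀ s', (moves e).Frame s s' → e.eval s' = i) :
    Emits (moves e) s (N * ((1 + (1 + 1)) + 2) + 2)
      ((Pilot.moveLayer tr i).map (Gate.relabel (pilotIndex n m N))) := by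
  rw [Pilot.moveLayer, List.map_flatMap]
  refine Emits.for_loop _ (by simp [natWrites]) (fun s' hf => ?_) fun q s' hf hq => ?_
  · exact (h.frame (keepsData_moves e) hf).states_eq
  · have hL := h.frame (keepsData_moves e) hf
    have hei := he s' hf
    have hb := hL.base_add i.succ q
    have hb' := hL.base_add i.castSucc
    simp only [Fin.val_succ] at hb
    simp only [Fin.val_castSucc] at hb'
    refine Emits.emit_cons ?_ (Emits.emit_cons ?_ (Emits.emit_of ?_)) <;>
      simp only [IExpr.eval_push, Store.push_nat, Gate.map, Gate.relabel, OneQubit.map, IExpr.eval, stateE,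
        var_eval, hq, hei, hL.tr_eq, hb, hb'] <;> rfl

theorem emitPilot_emits (h : Loaded H G piv tr V s) {q₀ : Fin N} (hq : (q₀ : ℕ) = 0) :
    Emits emitPilot s (1 + ((m * ((N * ((0 + 2) + 2) + 2 + (N * ((1 + (1 + 1)) + 2) + 2)) + 2) + 2) +
      ((m * ((N * ((1 + (1 + 1)) + 2) + 2) + 2) + 2) + (1 + (m * (0 + 2 + 2) + 2)))))
      ((Pilot.circuit (pivots m piv) tr V q₀).map (Gate.relabel (pilotIndex n m N))) := by
  simp only [Pilot.circuit, List.map_append]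
  have hk1 : KeepsData (.for 100 mE (.seq (rotations reverseE) (moves reverseE))) :=
    .for (by norm_num) (.seq (keepsData_rotations _) (keepsData_moves _))
  have hk2 : KeepsData (.for 100 mE (moves (var 100))) := .for (by norm_num) (keepsData_moves _)
  have hk3 : KeepsData (.for 100 mE (.when (posE (.get 5 (var 100) (.lit 0)))
    (.emit (.one .had (var 100))))) := .for (by norm_num) (.when (.emit _))
  refine (flipStart_emits h hq).seq fun s1 hf1 => ?_
  have h1 := h.frame (KeepsData.emit _) hf1
  refine Emits.seq ?_ fun s2 hf2 => ?_
  · rw [List.map_flatMap]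
    simp only [List.map_append]
    refine Emits.for_loop_reverse _ (by decide) (fun s' hf => (h1.frame hk1 hf).m_eq)
      fun i s' hf hi => ?_
    have h2 := h1.frame hk1 hf
    have hrev : ∀ s'', Loaded H G piv tr V s'' → s''.nat 100 0 0 = s'.nat 100 0 0 →
        reverseE.eval s'' = i := fun s'' hs h100 => by
      simp only [reverseE, mE, IExpr.eval, var_eval, hs.m_eq, h100, hi]
      omega
    refine Emits.seq (rotations_emits h2 i fun s'' hf' => hrev s'' (h2.frame (keepsData_rotations _) hf')
      (by rw [hf'.nat 100 (by decide)])) fun s3 hf3 => ?_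
    have h3 := h2.frame (keepsData_rotations _) hf3
    exact moves_emits h3 i fun s'' hf' => hrev s'' (h3.frame (keepsData_moves _) hf')
      (by rw [hf'.nat 100 (by decide), hf3.nat 100 (by decide)])
  have h2 := h1.frame hk1 hf2
  refine Emits.seq ?_ fun s3 hf3 => ?_
  · rw [List.map_flatMap]
    refine Emits.for_loop _ (by decide) (fun s' hf => (h2.frame hk2 hf).m_eq) fun i s' hf hi => ?_
    refine moves_emits (h2.frame hk2 hf) i fun s'' hf' => ?_
    rw [var_eval, hf'.nat 100 (by decide), hi]
  have h3 := h2.frame hk2 hf3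
  refine (flipStart_emits h3 hq).seq fun s4 hf4 => ?_
  have h4 := h3.frame (KeepsData.emit _) hf4
  rw [List.map_flatMap]
  refine Emits.for_loop _ (by decide) (fun s' hf => (h4.frame hk3 hf).m_eq) fun i s' hf hi => ?_
  have h5 := h4.frame hk3 hf
  refine Emits.when (fun hb => ?_) (fun hb => ?_) <;>
    simp only [posE_holds, IExpr.eval, var_eval, hi, h5.pivot, ← mem_pivots] at hb
  · rw [if_pos hb]
    refine Emits.emit_of ?_
    simp only [Gate.map, Gate.relabel, OneQubit.map, var_eval, hi]
    rfl
  · rw [if_neg hb, List.map_nil]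

theorem emitBellPrep_emits (h : Loaded H G piv tr V s) (a : ℕ) :
    Emits emitBellPrep s (n * ((1 + 1) + 2) + 2)
      ((HDQI.bellPrep m n a).map (Gate.relabel Qubit.index)) := by
  rw [HDQI.bellPrep, List.map_flatMap]
  refine Emits.for_loop _ (by decide) (fun s' hf => (h.frame ⟨by decide, rfl⟩ hf).n_eq)
    fun j s' hf hj => ?_
  have hL := h.frame ⟨by decide, rfl⟩ hf
  refine Emits.emit_cons ?_ (Emits.emit_of ?_) <;>
    simp only [IExpr.eval_push, Gate.map, Gate.relabel, OneQubit.map, hL.bE_eval hj a,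
      hL.cE_eval hj a]

theorem emitBellMeasure_emits (h : Loaded H G piv tr V s) (a : ℕ) :
    Emits emitBellMeasure s (n * ((1 + 1) + 2) + 2)
      ((HDQI.bellMeasure m n a).map (Gate.relabel Qubit.index)) := by
  rw [HDQI.bellMeasure, List.map_flatMap]
  refine Emits.for_loop _ (by decide) (fun s' hf => (h.frame ⟨by decide, rfl⟩ hf).n_eq)
    fun j s' hf hj => ?_
  have hL := h.frame ⟨by decide, rfl⟩ hf
  refine Emits.emit_cons ?_ (Emits.emit_of ?_) <;>
    simp only [IExpr.eval_push, Gate.map, Gate.relabel, OneQubit.map, hL.bE_eval hj a,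
      hL.cE_eval hj a]

theorem emitSigns_emits (h : Loaded H G piv tr V s) (a : ℕ) :
    Emits emitSigns s (m * ((0 + 2) + 2) + 2)
      ((HDQI.signPhases a H).map (Gate.relabel Qubit.index)) := by
  rw [HDQI.signPhases, List.map_flatMap]
  refine Emits.for_loop _ (by decide) (fun s' hf => (h.frame ⟨by decide, rfl⟩ hf).m_eq)
    fun i s' hf hi => ?_
  have hL := h.frame ⟨by decide, rfl⟩ hf
  refine Emits.when (fun hb => ?_) (fun hb => ?_) <;>
    simp only [posE_holds, IExpr.eval, var_eval, hi, hL.sign] at hb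
  · rw [if_pos hb]
    refine Emits.emit_of ?_
    simp only [Gate.map, Gate.relabel, OneQubit.map, var_eval, hi]
    rfl
  · rw [if_neg hb, List.map_nil]

theorem emitPauli_emits (h : Loaded H G piv tr V s) (a : ℕ) {i : Fin m} {j : Fin n}
    (hi : s.nat 100 0 0 = i) (hj : s.nat 101 0 0 = j) :
    Emits emitPauli s 3 ((HDQI.controlledPauli (Qubit.A (a := a) i) (Qubit.B j) (H.term i j)).map
      (Gate.relabel Qubit.index)) := by
  have hx := h.xBit i j
  have hz := h.zBit i j
  have hA : (var 100).eval s = Qubit.index (m := m) (n := n) (a := a) (Qubit.A i) := hi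
  refine Runs.cond (T := 2) (fun hb => Runs.cond (T := 1) (fun hb' => ?_) fun hb' => ?_)
    fun hb => Emits.when (T := 0) (fun hb' => ?_) fun hb' => ?_ <;>
    simp only [posE_holds, IExpr.eval, var_eval, hi, hj, hx, hz] at hb hb' <;>
    revert hb hb' <;> cases H.term i j <;>
    simp only [Pauli.xBit, Pauli.zBit, ZMod.val_zero, ZMod.val_one, lt_irrefl, zero_lt_one,
      not_true, not_false_iff, HDQI.controlledPauli, List.map_nil, List.map_cons, IsEmpty.forall_iff,
      forall_const] <;>
    refine Emits.emit_of ?_ <;>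
    simp only [Gate.map, Gate.relabel, OneQubit.map, h.bE_eval hj a, hA]

theorem emitTerms_emits (h : Loaded H G piv tr V s) (a : ℕ) :
    Emits emitTerms s (m * ((n * (3 + 2) + 2) + 2) + 2)
      ((HDQI.controlledTerms a H).map (Gate.relabel Qubit.index)) := by
  rw [HDQI.controlledTerms, List.map_flatMap]
  refine Emits.for_loop _ (by decide) (fun s' hf => (h.frame ⟨by decide, rfl⟩ hf).m_eq)
    fun i s' hf hi => ?_
  have h1 := h.frame ⟨by decide, rfl⟩ hf
  rw [List.map_flatMap]
  refine Emits.for_loop _ (by decide) (fun s' hf => (h1.frame ⟨by decide, rfl⟩ hf).n_eq)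
    fun j s2 hf2 hj => ?_
  exact emitPauli_emits (h1.frame ⟨by decide, rfl⟩ hf2) a (by rw [hf2.nat 100 (by decide), hi]) hj

theorem emitCorrection_emits (h : Loaded H G piv tr V s) (a : ℕ) {i : Fin m}
    (hi : s.nat 100 0 0 = i) {e q : IExpr} {c : ℕ} (he : e.eval s = c) {b : Qubit m n a}
    (hq : q.eval s = Qubit.index b) : Emits (emitCorrection e q) s (0 + 2)
      ((if 0 < piv i ∧ 0 < G (piv i - 1) c then [Gate.ctrl .X b (Qubit.A i)] else []).map
        (Gate.relabel Qubit.index)) := by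
  refine Emits.when (fun hb => ?_) (fun hb => ?_) <;>
    simp only [Test.Holds, posE_holds, IExpr.eval, var_eval, hi, h.pivot, h.matrix, he] at hb
  · rw [if_pos hb]
    refine Emits.emit_of ?_
    simp only [Gate.map, Gate.relabel, OneQubit.map, var_eval, hi, hq]
    rfl
  · rw [if_neg hb, List.map_nil]

theorem keepsData_emitCorrection (e q : IExpr) : KeepsData (emitCorrection e q) := .when (.emit _)

theorem emitDecoder_emits (h : Loaded H G piv tr V s) (a : ℕ) :
    Emits emitDecoder s (m * ((n * ((0 + 2 + (0 + 2)) + 2) + 2) + 2) + 2)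
      ((HDQI.decoder n m a G piv).map (Gate.relabel Qubit.index)) := by
  rw [HDQI.decoder, List.map_flatMap]
  refine Emits.for_loop _ (by decide) (fun s' hf => (h.frame ⟨by decide, rfl⟩ hf).m_eq)
    fun i s' hf hi => ?_
  have h1 := h.frame ⟨by decide, rfl⟩ hf
  rw [List.map_flatMap]
  refine Emits.for_loop _ (by decide) (fun s' hf => (h1.frame ⟨by decide, rfl⟩ hf).n_eq)
    fun j s2 hf2 hj => ?_
  have h2 := h1.frame ⟨by decide, rfl⟩ hf2
  have hi2 : s2.nat 100 0 0 = i := by rw [hf2.nat 100 (by decide), hi]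
  rw [List.map_append]
  refine Emits.seq (T := 0 + 2) (T' := 0 + 2) (emitCorrection_emits h2 a hi2 ?_ (h2.cE_eval hj a)) fun s3 hf3 => ?_
  · simp only [IExpr.eval, mE, var_eval, h2.m_eq, hj]
  · have h3 := h2.frame (keepsData_emitCorrection _ _) hf3
    have hj3 : s3.nat 101 0 0 = j := by rw [hf3.nat 101 (by decide), hj]
    refine emitCorrection_emits h3 a (by rw [hf3.nat 100 (by decide), hi2]) ?_ (h3.bE_eval hj3 a)
    simp only [IExpr.eval, mE, nE, var_eval, h3.m_eq, h3.n_eq, hj3]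

def emitPilotCost {R : Type*} [Semiring R] (m N : R) : R :=
  1 + ((m * ((N * ((0 + 2) + 2) + 2 + (N * ((1 + (1 + 1)) + 2) + 2)) + 2) + 2) +
    ((m * ((N * ((1 + (1 + 1)) + 2) + 2) + 2) + 2) + (1 + (m * (0 + 2 + 2) + 2))))

def emitCircuitCost {R : Type*} [Semiring R] (n m N : R) : R :=
  emitPilotCost m N + ((n * ((1 + 1) + 2) + 2) + ((m * ((0 + 2) + 2) + 2) +
    ((m * ((n * (3 + 2) + 2) + 2) + 2) + ((n * ((1 + 1) + 2) + 2) +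
    ((m * ((n * ((0 + 2 + (0 + 2)) + 2) + 2) + 2) + 2) + (n * ((1 + 1) + 2) + 2))))))

theorem emitCircuit_emits (h : Loaded H G piv tr V s) {q₀ : Fin N} (hq : (q₀ : ℕ) = 0) :
    Emits emitCircuit s (emitCircuitCost n m N)
      ((HDQI.circuit H (Pilot.circuit (pivots m piv) tr V q₀)
        (HDQI.decoder n m ((m + 1) * N) G piv)).map (Gate.relabel Qubit.index)) := by
  simp only [HDQI.circuit, List.append_assoc, List.map_append]
  have hp : ((Pilot.circuit (pivots m piv) tr V q₀).map
      (Gate.relabel (Sum.elim (Qubit.A (n := n)) Qubit.W))).map (Gate.relabel Qubit.index) =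
      (Pilot.circuit (pivots m piv) tr V q₀).map (Gate.relabel (pilotIndex n m N)) := by
    rw [List.map_map]
    refine List.map_congr_left fun g _ => ?_
    have hid : ∀ u : OneQubit ℝ, (u.map id).map id = u.map id := fun u => by cases u <;> rfl
    cases g <;> simp only [Function.comp_apply, Gate.relabel, Gate.map, hid] <;> rfl
  rw [hp]
  refine (emitPilot_emits h hq).seq fun s1 hf1 => ?_
  have h1 := h.frame ⟨by decide, rfl⟩ hf1
  refine (emitBellPrep_emits h1 _).seq fun s2 hf2 => ?_
  have h2 := h1.frame ⟨by decide, rfl⟩ hf2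
  refine (emitSigns_emits h2 _).seq fun s3 hf3 => ?_
  have h3 := h2.frame ⟨by decide, rfl⟩ hf3
  refine (emitTerms_emits h3 _).seq fun s4 hf4 => ?_
  have h4 := h3.frame ⟨by decide, rfl⟩ hf4
  refine (emitBellMeasure_emits h4 _).seq fun s5 hf5 => ?_
  have h5 := h4.frame ⟨by decide, rfl⟩ hf5
  refine (emitDecoder_emits h5 _).seq fun s6 hf6 => ?_
  exact emitBellPrep_emits (h5.frame ⟨by decide, rfl⟩ hf6) _

end

end Compiler

/-! ## The compiler -/

theorem Gate.Valid.relabel {Q Q' : Type} {h : Q → Q'} (hh : Function.Injective h) {g : Gate Q ℝ}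
    (hg : g.Valid) : (g.relabel h).Valid := by
  have hid : ∀ u : OneQubit ℝ, u.map id = u := fun u => by cases u <;> rfl
  cases g <;> simp only [Gate.relabel, Gate.map, Gate.Valid, hid, ne_eq, hh.eq_iff] at hg ⊢ <;>
    exact hg

theorem HDQI.circuit_valid {n m a : ℕ} (H : PauliHamiltonian n m)
    {pilot : List (Gate (Fin m ⊕ Fin a) ℝ)} {decoder : List (Gate (Qubit m n a) ℝ)}
    (hp : ∀ g ∈ pilot, g.Valid) (hd : ∀ g ∈ decoder, g.Valid) :
    ∀ g ∈ circuit H pilot decoder, g.Valid := by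
  have hprep : ∀ g ∈ bellPrep m n a, g.Valid := by
    intro g hg
    simp only [bellPrep, List.mem_flatMap, List.mem_cons, List.not_mem_nil, or_false] at hg
    obtain ⟨j, -, rfl | rfl⟩ := hg
    · trivial
    · exact ⟨trivial, by simp [Qubit.B, Qubit.C]⟩
  have hinj : Function.Injective (Sum.elim Qubit.A Qubit.W : Fin m ⊕ Fin a → Qubit m n a) := by
    rintro (i | i) (j | j) h <;> simp_all [Qubit.A, Qubit.W]
  intro g hg
  simp only [circuit, List.mem_append, List.mem_map] at hg
  rcases hg with (((((⟨g, hg, rfl⟩ | hg) | hg) | hg) | hg) | hg) | hg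
  · exact (hp g hg).relabel hinj
  · exact hprep g hg
  · simp only [signPhases, List.mem_flatMap] at hg
    obtain ⟨i, -, hg⟩ := hg
    split_ifs at hg
    · rw [List.mem_singleton] at hg; subst hg; trivial
    · simp at hg
  · simp only [controlledTerms, List.mem_flatMap] at hg
    obtain ⟨i, -, j, -, hg⟩ := hg
    cases hP : H.term i j <;> simp only [hP, controlledPauli, List.not_mem_nil,
      List.mem_singleton] at hg <;> subst hg <;> exact ⟨trivial, by simp [Qubit.A, Qubit.B]⟩
  · simp only [bellMeasure, List.mem_flatMap, List.mem_cons, List.not_mem_nil, or_false] at hg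
    obtain ⟨j, -, rfl | rfl⟩ := hg
    · exact ⟨trivial, by simp [Qubit.B, Qubit.C]⟩
    · trivial
  · exact hd g hg
  · exact hprep g hg

namespace Compiler

/-- The array of relations is known to agree with `Gauss.rel` only in the first `m` entries, and the
phase reads no others. -/
theorem totalPhase_congr {n m : ℕ} {D D' : ℕ → ℕ} (h : ∀ i < m, D i = D' i) (X Z : ℕ → ℕ → ℕ)
    (sg : ℕ → ℕ) : totalPhase n m D X Z sg = totalPhase n m D' X Z sg := by
  have hbit : ∀ (X : ℕ → ℕ) k, k ≤ m → bitAfter D X k = bitAfter D' X k := by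
    intro X k
    induction k with
    | zero => intro _; rfl
    | succ k ih => intro hk; simp only [bitAfter, h k hk, ih (by omega)]
  have hq : ∀ X Z : ℕ → ℕ, qubitPhase D X Z m = qubitPhase D' X Z m := fun X Z =>
    Finset.sum_congr rfl fun i hi => by
      rw [Finset.mem_range] at hi
      simp only [h i hi, hbit X i hi.le]
  have hs : signPhase D sg m = signPhase D' sg m := Finset.sum_congr rfl fun i hi => by
    rw [h i (Finset.mem_range.1 hi)]
  simp only [totalPhase, hq, hs]

theorem weight_congr {m : ℕ} {piv ph ph' : ℕ → ℕ} {D D' : ℕ → ℕ → ℕ} (hp : ∀ j < m, ph j = ph' j)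
    (hD : ∀ j < m, ∀ i < m, D j i = D' j i) (z : Fin m → ZMod 2) :
    weight m piv ph D m z = weight m piv ph' D' m z := by
  simp only [weight]
  congr 1
  refine Finset.sum_congr rfl fun j hj => ?_
  rw [Finset.mem_range] at hj
  simp only [hp j hj, fun i : Fin m => hD j hj i i.2]

/-- The program that computes an HDQI circuit for a commuting Pauli Hamiltonian. -/
def hdqi : Prog :=
  .seq gauss (.seq relations (.seq phases (.seq trellis (.seq completions (.seq bases emitCircuit)))))

def hdqiCost {R : Type*} [Semiring R] (n m N : R) : R :=
  gaussCost n m + ((m * ((m * ((1 + 1 + 1) + 2) + 2) + 2) + 2) + (phasesCost n m + (trellisCost m N +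
    (completionsCost m N + ((1 + (m * (1 + 2) + 2)) + emitCircuitCost n m N)))))

/-- A bound for the total time: the steps, the gates, and the qubits. -/
def totalCost {R : Type*} [Semiring R] (n m N : R) : R :=
  hdqiCost n m N + hdqiCost n m N + (m + 2 * n + (m + 1) * N)

theorem totalCost_mono (n : ℕ) {m m' N N' : ℕ} (hm : m ≤ m') (hN : N ≤ N') :
    totalCost n m N ≤ totalCost n m' N' := by
  simp only [totalCost, hdqiCost, gaussCost, pivotStepCost, phasesCost, trellisCost,
    countTrellisCost, doubleTrellisCost, completionsCost, emitCircuitCost, emitPilotCost]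
  gcongr

/-- Evaluation is a semiring homomorphism, and the cost is built from sums and products only. -/
theorem eval_totalCost (n : ℕ) (p P : Polynomial ℕ) :
    (totalCost Polynomial.X p P).eval n = totalCost n (p.eval n) (P.eval n) := by
  simp only [totalCost, hdqiCost, gaussCost, pivotStepCost, phasesCost, trellisCost,
    countTrellisCost, doubleTrellisCost, completionsCost, emitCircuitCost, emitPilotCost,
    Polynomial.eval_add, Polynomial.eval_mul, Polynomial.eval_X, Polynomial.eval_one,
    Polynomial.eval_ofNat, Polynomial.eval_zero]

/-- The reduced form of the parity check matrix of the input. -/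
theorem gauss_input {n m : ℕ} (H : PauliHamiltonian n m) (f : ℝ → ℝ) :
    Runs gauss (inputStore H f) (gaussCost n m) fun s => H.Reduction ((inputStore H f).nat 1)
      ((inputStore H f).nat 2) (fun i => (inputStore H f).nat 3 i 0) (s.nat 4)
      (fun j => s.nat 5 j 0) := by
  have hbit : ∀ b : ZMod 2, b.val ≤ 1 := fun b => Nat.lt_succ_iff.1 (ZMod.val_lt b)
  refine (gauss_runs (n := n) (m := m) (by simp [inputStore]) (by simp [inputStore])
    (by simp [inputStore]) (by simp [inputStore]) (fun i l => ?_) fun i l => ?_).imp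
    fun s _ hs => ⟨?_, ?_, ?_, hs⟩
  · simp only [inputStore, OfNat.one_ne_ofNat, one_ne_zero, false_and, true_and, if_false, dif_neg,
      not_false_iff]
    split_ifs
    · exact hbit _
    · exact zero_le_one
  · simp only [inputStore, OfNat.ofNat_ne_one, OfNat.ofNat_ne_zero, false_and, true_and, if_false,
      dif_neg, not_false_iff]
    split_ifs <;> first | exact hbit _ | norm_num
  · intro i j
    simp [inputStore]
  · intro i j
    simp [inputStore]
  · intro i
    by_cases h : H.sign i = -1 <;> simp [inputStore, h]

/-- The program emits a circuit that is built from a reduction of the check matrix and an automaton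
which computes the energies. -/
theorem hdqi_runs {n m : ℕ} (H : PauliHamiltonian n m) (f : ℝ → ℝ) :
    ∃ (G : ℕ → ℕ → ℕ) (piv : ℕ → ℕ) (N : ℕ) (tr : Fin m → Fin N → Fin N) (V : ℕ → Fin N → ℝ)
      (cod : (Fin m → ZMod 2) → Fin N) (off : Fin N → ℕ) (t : ℕ) (s : Store) (X Z : ℕ → ℕ → ℕ)
      (sg : ℕ → ℕ),
      H.Reduction X Z sg G piv ∧ N = states m piv m ∧
      (∀ z i, z i = 0 → tr i (cod z) = cod (z + Pi.single i 1)) ∧ (∀ i q, 0 ≤ V i q) ∧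
      (∀ (i : Fin m) q, V (i + 1) q = V i q + if i ∈ pivots m piv then V i (tr i q) else 0) ∧
      (∀ q, off q ≤ m → V 0 q = |f ((m : ℝ) - 2 * (off q : ℝ))|) ∧
      (∀ z, off (cod z) = PauliHamiltonian.Reduction.wt n m X Z sg G piv z) ∧
      t ≤ hdqiCost n m N ∧ Exec hdqi (inputStore H f) t s ∧
      s.out = (HDQI.circuit H (Pilot.circuit (pivots m piv) tr V (cod 0))
        (HDQI.decoder n m ((m + 1) * N) G piv)).map (Gate.relabel Qubit.index) := by
  set s0 := inputStore H f with hs0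
  have hn : s0.nat 0 0 0 = n := by simp [hs0, inputStore]
  have hm : s0.nat 0 0 1 = m := by simp [hs0, inputStore]
  have h7 : ∀ i q, s0.nat 7 i q = 0 := by simp [hs0, inputStore]
  have h11 : ∀ i q, s0.nat 11 i q = 0 := by simp [hs0, inputStore]
  have h12 : ∀ i, s0.nat 12 i 0 = 0 := by simp [hs0, inputStore]
  have hbit : ∀ b : ZMod 2, b.val ≤ 1 := fun b => Nat.lt_succ_iff.1 (ZMod.val_lt b)
  have hX1 : ∀ i l, s0.nat 1 i l ≤ 1 := by
    intro i l
    simp only [hs0, inputStore, OfNat.one_ne_ofNat, one_ne_zero, false_and, true_and, if_false,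
      dif_neg, not_false_iff]
    split_ifs
    · exact hbit _
    · exact zero_le_one
  obtain ⟨t1, s1, ht1, he1, h1⟩ := gauss_input H f
  have f1 := he1.frame
  obtain ⟨t2, s2, ht2, he2, h2⟩ := relations_runs (s := s1) (m := m)
    (by rw [f1.nat 0 (by decide), hm])
  have f2 := he2.frame
  obtain ⟨t3, s3, ht3, he3, h3⟩ := phases_runs (s := s2) (n := n) (m := m)
    (by rw [f2.nat 0 (by decide), f1.nat 0 (by decide), hn])
    (by rw [f2.nat 0 (by decide), f1.nat 0 (by decide), hm])
    (by rw [f2.nat 12 (by decide), f1.nat 12 (by decide)]; exact h12)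
    (by rw [f2.nat 11 (by decide), f1.nat 11 (by decide)]; exact h11)
    (by rw [f2.nat 1 (by decide), f1.nat 1 (by decide)]; exact hX1)
  have f3 := he3.frame
  set G := s1.nat 4 with hG
  set piv : ℕ → ℕ := fun j => s1.nat 5 j 0 with hpiv
  have e10 : ∀ j < m, ∀ i < m, s3.nat 10 j i = Gauss.rel G piv j i := fun j hj i hi => by
    rw [f3.nat 10 (by decide), h2 j hj i hi]
  have hrel1 : ∀ j i, Gauss.rel G piv j i ≤ 1 := fun j i => by
    unfold Gauss.rel; split_ifs <;> simp
  have e5 : (fun j => s3.nat 5 j 0) = piv := by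
    rw [f3.nat 5 (by decide), f2.nat 5 (by decide)]
  have e12 : ∀ j < m, s3.nat 12 j 0 = relPhase n m (s0.nat 1) (s0.nat 2) (fun i => s0.nat 3 i 0) G
      piv j := fun j hj => by
    rw [h3 j hj, relPhase, f2.nat 1 (by decide), f2.nat 2 (by decide), f2.nat 3 (by decide),
      f1.nat 1 (by decide), f1.nat 2 (by decide), f1.nat 3 (by decide),
      totalPhase_congr fun i hi => h2 j hj i hi]
  obtain ⟨t4, s4, ht4, he4, h9, cod, hT⟩ := trellis_runs (s := s3) (m := m)
    (by rw [f3.nat 0 (by decide), f2.nat 0 (by decide), f1.nat 0 (by decide), hm])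
    (by rw [f3.nat 7 (by decide), f2.nat 7 (by decide), f1.nat 7 (by decide)]; exact h7)
    (fun j hj i hi => by rw [e10 j hj i hi]; exact hrel1 j i)
  have f4 := he4.frame
  rw [e5] at ht4 h9 hT
  obtain ⟨N, hN⟩ : ∃ N, N = states m piv m := ⟨_, rfl⟩
  rw [← hN] at ht4 h9 hT
  have m4 : s4.nat 0 0 1 = m := by
    rw [f4.nat 0 (by decide), f3.nat 0 (by decide), f2.nat 0 (by decide), f1.nat 0 (by decide), hm]
  obtain ⟨t5, s5, ht5, he5, hV0, hV⟩ := completions_runs m4 h9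
  have f5 := he5.frame
  obtain ⟨t6, s6, ht6, he6, h13⟩ := bases_runs (s := s5) (n := n) (m := m) (N := N)
    (by rw [f5.nat 0 (by decide), f4.nat 0 (by decide), f3.nat 0 (by decide), f2.nat 0 (by decide),
      f1.nat 0 (by decide), hn])
    (by rw [f5.nat 0 (by decide), m4]) (by rw [f5.nat 9 (by decide), h9])
  have f6 := he6.frame
  have e45 : ∀ i, s4.nat 5 i 0 = piv i := fun i => by
    rw [f4.nat 5 (by decide), ← congrFun e5 i]
  let tr : Fin m → Fin N → Fin N := fun i q => ⟨s4.nat 7 i q, hT.tr_lt i i.2 q q.2⟩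
  -- Nonnegativity is required for all `i`, but the table is specified only up to row `m`; the rows
  -- beyond are cut off.
  let V : ℕ → Fin N → ℝ := fun i q => if i ≤ m then s5.real 1 i q else 0
  let cod' : (Fin m → ZMod 2) → Fin N := fun z => ⟨cod z, hT.cod_lt z⟩
  have hVstep : ∀ (i : Fin m) q,
      V (i + 1) q = V i q + if i ∈ pivots m piv then V i (tr i q) else 0 := by
    intro i q
    have hle : (i : ℕ) ≤ m := by omega
    have hlt : (i : ℕ) + 1 ≤ m := by omega
    simp only [V, hle, hlt, if_true, mem_pivots, tr]
    rw [hV i i.2 q q.2, e45]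
  have hVnonneg : ∀ i q, 0 ≤ V i q := by
    intro i
    induction i with
    | zero =>
      intro q
      simp only [V, Nat.zero_le, if_true]
      rw [hV0 q q.2]
      exact abs_nonneg _
    | succ i ih =>
      intro q
      by_cases hi : i < m
      · have := hVstep ⟨i, hi⟩ q
        simp only at this
        rw [this]
        refine add_nonneg (ih q) ?_
        split_ifs
        · exact ih _
        · exact le_rfl
      · simp only [V]
        rw [if_neg (by omega)]
  have hred : ∀ x, x ∈ [1, 2, 3] → s6.nat x = s0.nat x := fun x hx => by
    rw [f6.nat x (by revert x; decide), f5.nat x (by revert x; decide),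
      f4.nat x (by revert x; decide), f3.nat x (by revert x; decide),
      f2.nat x (by revert x; decide), f1.nat x (by revert x; decide)]
  have hL : Loaded H G piv tr V s6 := by
    have e0 : s6.nat 0 = s0.nat 0 := by
      rw [f6.nat 0 (by decide), f5.nat 0 (by decide), f4.nat 0 (by decide), f3.nat 0 (by decide),
        f2.nat 0 (by decide), f1.nat 0 (by decide)]
    refine ⟨by rw [e0, hn], by rw [e0, hm], ?_, ?_, ?_, ?_, ?_, ?_, ?_, h13, ?_⟩
    · rw [hred 1 (by decide)]; exact h1.xBit
    · rw [hred 2 (by decide)]; exact h1.zBit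
    · rw [hred 3 (by decide)]; exact h1.sign
    · rw [f6.nat 4 (by decide), f5.nat 4 (by decide), f4.nat 4 (by decide), f3.nat 4 (by decide),
        f2.nat 4 (by decide)]
      exact fun _ _ => rfl
    · rw [f6.nat 5 (by decide), f5.nat 5 (by decide)]
      exact e45
    · rw [f6.nat 7 (by decide), f5.nat 7 (by decide)]
      exact fun _ _ => rfl
    · rw [f6.nat 9 (by decide), f5.nat 9 (by decide), h9]
    · intro i hi q
      rw [f6.real 1 (by decide)]
      simp only [V, hi, if_true]
  obtain ⟨t7, s7, ht7, he7, h7'⟩ := emitCircuit_emits hL (q₀ := cod' 0) hT.cod_zero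
  refine ⟨G, piv, N, tr, V, cod', fun q => s4.nat 8 q 0, _, s7, s0.nat 1, s0.nat 2,
    fun i => s0.nat 3 i 0, h1, hN, ?_, hVnonneg, hVstep, ?_, ?_, ?_,
    .seq he1 (.seq he2 (.seq he3 (.seq he4 (.seq he5 (.seq he6 he7))))), ?_⟩
  · intro z i hz
    exact Fin.ext (hT.step z i hz)
  · intro q hq
    simp only [V, Nat.zero_le, if_true]
    rw [hV0 q q.2, f4.real 0 (by decide), f3.real 0 (by decide), f2.real 0 (by decide),
      f1.real 0 (by decide)]
    simp [inputStore, hq]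
  · intro z
    exact (hT.off_cod z).trans (weight_congr e12 e10 z)
  · unfold hdqiCost
    omega
  · have o6 : s6.out = [] := by
      rw [f6.out (by decide), f5.out (by decide), f4.out (by decide), f3.out (by decide),
        f2.out (by decide), f1.out (by decide)]
      rfl
    rw [h7', o6, List.nil_append]

theorem hdqi_prepares {n m : ℕ} (H : PauliHamiltonian n m) (hH : H.IsCommuting) (f : ℝ → ℝ)
    (hf : ∀ E ∈ H.Spec, 0 ≤ f E) (hne : ∃ E ∈ H.Spec, f E ≠ 0) {T : ℕ}
    (hT : totalCost n m ((m + 1) * 2 ^ Module.finrank (ZMod 2) H.sympCode) ≤ T) :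
    HDQI.Prepares hdqi H f T (H.rho f) := by
  obtain ⟨G, piv, N, tr, V, cod, off, t, s, X, Z, sg, hred, hN, hstep, hV0, hV, hval, hoff, ht, he,
    hout⟩ := hdqi_runs H f
  have hmem : ∀ z ∈ supported (pivots m piv) 0,
      PauliHamiltonian.Reduction.energy n m X Z sg G piv z ∈ H.Spec := fun z hz => by
    rw [hred.spec_eq hH]; exact ⟨z, hz, rfl⟩
  have hw : ∀ z ∈ supported (pivots m piv) 0,
      V 0 (cod z) = f (PauliHamiltonian.Reduction.energy n m X Z sg G piv z) := fun z hz => by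
    -- Vectors supported on the pivots have weight at most `m`, so the input contains `f` at their
    -- energy; there `f` is nonnegative and the absolute value disappears.
    rw [hval _ (by rw [hoff]; exact PauliHamiltonian.Reduction.wt_le hz), hoff]
    exact abs_of_nonneg (hf _ (hmem z hz))
  have hpos : 0 < ∑ z ∈ supported (pivots m piv) 0, V 0 (cod z) := by
    rw [Finset.sum_congr rfl hw]
    exact hred.sum_pos hH hf hne
  have hrun := Pilot.circuit_run hstep hV0 hV hpos
  have hsupp : ∀ y, y ∉ ((supported (pivots m piv) 0 : Finset (Fin m → ZMod 2)) :
      Set (Fin m → ZMod 2)) → Pilot.amplitude (pivots m piv) (fun z => V 0 (cod z)) y = 0 :=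
    fun y hy => if_neg hy
  refine ⟨t, (m + 1) * N, s, _, _, (supported (pivots m piv) 0 : Finset (Fin m → ZMod 2)), he, hout,
    ?_, HDQI.circuit_valid H (Pilot.circuit_valid hV0 hV _) (HDQI.decoder_valid _ _),
    ⟨_, hsupp, ?_⟩, HDQI.decodes hred, ?_⟩
  -- There are at most as many gates as steps, which is why `totalCost` contains `hdqiCost` twice.
  · have hlen := he.length_out_le
    rw [hout, List.length_map] at hlen
    simp only [inputStore, List.length_nil, zero_add] at hlen
    have hNle : N ≤ (m + 1) * 2 ^ Module.finrank (ZMod 2) H.sympCode := by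
      rw [hN, states]
      exact Nat.mul_le_mul_left _ (Nat.pow_le_pow_right (by norm_num) hred.card_relations_le)
    have := (totalCost_mono n le_rfl hNle).trans hT
    rw [totalCost] at this
    omega
  · rw [hrun]
  · rw [HDQI.reducedB_circuit H _ _ _ _ hsupp (by rw [hrun]) (HDQI.decodes hred)]
    exact hred.amplitude_state hH hw hf

end Compiler

/-! ### The main theorem -/

theorem theorem2p1 :
    ∃ prog : Prog, ∀ (k : ℕ) (p : Polynomial ℕ), ∃ q : Polynomial ℕ,
      ∀ (n m : ℕ) (H : PauliHamiltonian n m),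
        m ≤ p.eval n → H.IsCommuting → Module.finrank (ZMod 2) H.sympCode ≤ k →
          (∀ f : ℝ → ℝ, (∀ E ∈ H.Spec, 0 ≤ f E) → (∃ E ∈ H.Spec, f E ≠ 0) →
            HDQI.Prepares prog H f (q.eval n) (H.rho f)) ∧
          (∀ β : ℝ≥0∞, ∃ ρ : Matrix (Fin n → ZMod 2) (Fin n → ZMod 2) ℂ,
            H.IsGibbsState β ρ ∧ HDQI.Prepares prog H (H.gibbsWeight β) (q.eval n) ρ) := by
  -- The number of states is at most `(m + 1) * 2 ^ k`, and `m ≤ p.eval n`; substituting the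
  -- corresponding polynomials into the cost gives the bound.
  refine ⟨Compiler.hdqi, fun k p => ⟨Compiler.totalCost Polynomial.X p
    ((p + 1) * Polynomial.C (2 ^ k)), fun n m H hm hH hk => ?_⟩⟩
  have hT : Compiler.totalCost n m ((m + 1) * 2 ^ Module.finrank (ZMod 2) H.sympCode) ≤
      (Compiler.totalCost Polynomial.X p ((p + 1) * Polynomial.C (2 ^ k))).eval n := by
    rw [Compiler.eval_totalCost, Polynomial.eval_mul, Polynomial.eval_add, Polynomial.eval_one,
      Polynomial.eval_C]
    exact Compiler.totalCost_mono n hm (Nat.mul_le_mul (Nat.add_le_add_right hm 1)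
      (Nat.pow_le_pow_right (by norm_num) hk))
  refine ⟨fun f hf hne => Compiler.hdqi_prepares H hH f hf hne hT, fun β => ?_⟩
  -- The reduction depends on `H` alone, so a run on the zero function provides one.
  obtain ⟨-, s, -, -, hred⟩ := Compiler.gauss_input H fun _ => 0
  exact ⟨_, hred.isGibbsState hH β, Compiler.hdqi_prepares H hH _
    (fun E _ => PauliHamiltonian.Reduction.gibbsWeight_nonneg H β E)
    (hred.gibbsWeight_ne_zero hH β) hT⟩
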